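/- Let $d \ge 1$ and let $Q_d$ be the $d$-dimensional hypercube: its vertices are the $0/1$-vectors of length $d$, two of them being adjacent when they differ in exactly one coordinate. Let $\varphi$ be a proper edge coloring, with colors from $\{1,\dots,d\}$, of a set of exactly $d$ edges of $Q_d$; the other edges are called uncolored. Let $\mathcal{C}$ be the class of those $\varphi$ that satisfy at least one of the following conditions. 1. There is an uncolored edge $uv$ such that each of the $d$ colors appears under $\varphi$ on an edge incident with $u$ or with $v$. 2. There are a vertex $u$ and a color $c$ such that no edge incident with $u$ has color $c$, and for every uncolored edge $uv$ at $u$ the vertex $v$ is incident with an edge colored $c$. 3. There are a vertex $u$ and a color $c$ such that every edge incident with $u$ is uncolored, and each of these edges is adjacent to another edge colored $c$. 4. $d = 3$, the three colored edges have three different colors, and they lie in one dimensional matching, that is, there is a coordinate in which the two ends of each of the three edges differ. Then $\varphi$ extends to a proper edge coloring of all of $Q_d$ with the colors $1,\dots,d$ if and only if $\varphi \notin \mathcal{C}$. -/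

import Mathlib

/-- The `d`-dimensional hypercube `Q_d`: the vertices are the 0/1-vectors of length `d`, and two
of them are adjacent when they differ in exactly one coordinate. -/
def hypercube (d : ℕ) : SimpleGraph (Fin d → Bool) where
  Adj u v := ∃! i, u i ≠ v i
  symm := ⟨fun _ _ h => by simpa only [ne_comm] using h⟩
  loopless := ⟨fun _ h => by obtain ⟨_, hi, _⟩ := h; exact hi rfl⟩

/-- An edge `t`-precoloring of `G`: a proper coloring of some of the edges of `G` with colors from
a set of `t` colors. The value `none` marks an uncolored edge; adjacency in the line graph means
that two distinct edges share an endpoint. -/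
structure EdgePrecoloring {V : Type*} (G : SimpleGraph V) (t : ℕ) where
  color : G.edgeSet → Option (Fin t)
  proper : ∀ e f : G.edgeSet, G.lineGraph.Adj e f → ∀ c, color e = some c → color f ≠ some c

namespace EdgePrecoloring

variable {V : Type*} {G : SimpleGraph V} {t : ℕ}

/-- The set of precolored edges. -/
def coloredEdges (φ : EdgePrecoloring G t) : Set G.edgeSet :=
  {e | φ.color e ≠ none}

/-- The set of colors on the precolored edges that are incident with the vertex `u`. -/
def colorsAt (φ : EdgePrecoloring G t) (u : V) : Set (Fin t) :=
  {c | ∃ e : G.edgeSet, u ∈ (e : Sym2 V) ∧ φ.color e = some c}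

/-- `φ` is extendable: there is a proper edge coloring of all of `G` with the same `t` colors
(a proper vertex coloring of the line graph) that agrees with `φ` on every precolored edge. -/
def Extendable (φ : EdgePrecoloring G t) : Prop :=
  ∃ f : G.lineGraph.Coloring (Fin t), ∀ e c, φ.color e = some c → f e = c

/-- Some uncolored edge `uv` is adjacent to edges of all `t` colors. -/
def HasSaturatedEdge (φ : EdgePrecoloring G t) : Prop :=
  ∃ (u v : V) (h : G.Adj u v),
    φ.color ⟨s(u, v), h⟩ = none ∧ φ.colorsAt u ∪ φ.colorsAt v = Set.univ

/-- For some vertex `u` there is a color `c`, not present at `u`, such that every uncolored edge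
`uv` at `u` has an edge of color `c` at its other end `v`. (If the degree of `u` is the number
`t` of colors, then at least one edge at `u` is uncolored, because `c` is not present at `u`.) -/
def HasBlockedVertex (φ : EdgePrecoloring G t) : Prop :=
  ∃ (u : V) (c : Fin t), c ∉ φ.colorsAt u ∧
    ∀ (v : V) (h : G.Adj u v), φ.color ⟨s(u, v), h⟩ = none → c ∈ φ.colorsAt v

/-- For some vertex `u` all edges at `u` are uncolored, and there is a color `c` such that every
edge at `u` is adjacent to another edge of color `c`. -/
def HasBlockedUncoloredVertex (φ : EdgePrecoloring G t) : Prop :=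
  ∃ (u : V) (c : Fin t), ∀ (v : V) (h : G.Adj u v),
    φ.color ⟨s(u, v), h⟩ = none ∧
      ∃ e : G.edgeSet, G.lineGraph.Adj ⟨s(u, v), h⟩ e ∧ φ.color e = some c

end EdgePrecoloring

/-- The dimensional matching of `Q_d` in direction `i`: all edges whose two ends differ in the
coordinate `i`. -/
def dimensionalMatching (d : ℕ) (i : Fin d) : Set (hypercube d).edgeSet :=
  {e | ∃ u v : Fin d → Bool, (e : Sym2 (Fin d → Bool)) = s(u, v) ∧ u i ≠ v i}

/-- The exceptional configuration in `Q_3`: the precolored edges are three edges with three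
different colors, all in one dimensional matching. -/
def IsParallelTriple {d : ℕ} (φ : EdgePrecoloring (hypercube d) d) : Prop :=
  d = 3 ∧ φ.coloredEdges.ncard = 3 ∧ Set.InjOn φ.color φ.coloredEdges ∧
    ∃ i, φ.coloredEdges ⊆ dimensionalMatching d i

/-- The class `𝒞` of obstructed precolorings of `Q_d`. -/
def obstructionClass (d : ℕ) : Set (EdgePrecoloring (hypercube d) d) :=
  {φ | φ.HasSaturatedEdge ∨ φ.HasBlockedVertex ∨ φ.HasBlockedUncoloredVertex ∨
    IsParallelTriple φ}

/-! Necessity is local. A proper coloring of a `d`-regular graph with `d` colors shows every color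
at every vertex, whereas at an obstruction some edge has no color left, or some color has no edge
left at a vertex; condition 3 is a special case of condition 2. For the parallel triple in `Q_3`,
the colors around a square transverse to the three edges are forced into a conflict
(`IsCol.false_of_corner`).

Sufficiency is proved by induction on the dimension, for a set `S` of directions and a set `T` of
colors with `|S| = |T| = n`. The ambient cube stays fixed, and coordinates outside `S` merely
separate components. One deletes a direction `i` and a color `c`: the two sides of `i` are colored
without `c`, and the `i`-edges get `c`. What makes this flexible is an exchange (`IsCol.merge`): if
an edge and its mirror image across `i` have the same color `x`, the square through them is colored
`x`, `c` alternately, and swapping puts `c` on the edge and `x` on two `i`-edges. The ways to use it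
are `extends_of_split`, `extends_of_oneSided`, `extends_of_exchange` and `extends_of_cross`. Fewer
than `n` precolored edges always extend (`extends_of_card_lt`), so only a side that keeps as many
edges as its dimension needs attention.

With exactly `n` edges the obstructions are rigid: every precolored edge has a definite role in a
saturated edge or a blocked vertex (`sat_struct`, `blk_struct`). Thus, if a side becomes obstructed,
the position of nearly all edges is known, and another choice of direction, color or exchanged edge
succeeds. There are two regimes: all colors different (`extends_of_rainbow`), and some color
repeated (`extends_of_repeated_color`), where a spare color `c₀` is available. Configurations
consisting of a star and one color class escape this induction; there Hall's theorem extends the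
color class to a perfect matching, and what remains is a regular bipartite graph, hence properly
colorable (`extends_of_star`).

Dimensions up to `4` are settled by a search: up to symmetry and permutation of colors, every
unobstructed pattern occurs in an explicit list of colorings. The induction starts at `4`, beyond
the exceptional triple in dimension `3`. -/

/-! ### Hypercubes by coordinate flips -/

/-- The neighbour of the vertex `v` in direction `j`. -/
def flipAt {ι : Type*} [DecidableEq ι] (j : ι) (v : ι → Bool) : ι → Bool :=
  Function.update v j (!v j)

/-- The vertex `v` with its coordinate `j` replaced by `s`. -/
def setAt {ι : Type*} [DecidableEq ι] (j : ι) (s : Bool) (v : ι → Bool) : ι → Bool :=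
  Function.update v j s

section Flip

variable {ι : Type*} [DecidableEq ι]

theorem flipAt_apply (j : ι) (v : ι → Bool) (i : ι) :
    flipAt j v i = if i = j then !v i else v i := by
  by_cases h : i = j
  · subst h; simp [flipAt]
  · simp [flipAt, h]

theorem setAt_apply (j : ι) (s : Bool) (v : ι → Bool) (i : ι) :
    setAt j s v i = if i = j then s else v i := by
  by_cases h : i = j
  · subst h; simp [setAt]
  · simp [setAt, h]

@[simp] theorem flipAt_flipAt (j : ι) (v : ι → Bool) : flipAt j (flipAt j v) = v := by
  funext i; by_cases h : i = j <;> simp [flipAt_apply, h]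

theorem flipAt_comm (j k : ι) (v : ι → Bool) : flipAt j (flipAt k v) = flipAt k (flipAt j v) := by
  funext i; simp only [flipAt_apply]; grind

theorem flipAt_ne (j : ι) (v : ι → Bool) : flipAt j v ≠ v := fun h => by
  have := congrFun h j; simp [flipAt_apply] at this

@[simp] theorem flipAt_inj (j : ι) {v w : ι → Bool} : flipAt j v = flipAt j w ↔ v = w :=
  ⟨fun h => by simpa using congrArg (flipAt j) h, fun h => h ▸ rfl⟩

theorem eq_flipAt_comm {j : ι} {v w : ι → Bool} : v = flipAt j w ↔ w = flipAt j v :=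
  ⟨fun h => by simp [h], fun h => by simp [h]⟩

@[simp] theorem flipAt_eq_flipAt {j k : ι} {v : ι → Bool} : flipAt j v = flipAt k v ↔ j = k := by
  refine ⟨fun h => ?_, fun h => h ▸ rfl⟩
  by_contra hne
  have := congrFun h j
  simp [flipAt_apply, hne] at this

/-- Two flips preserve the parity of the number of ones and one flip changes it. This is how
bipartiteness enters the incidence arguments. -/
theorem flipAt_flipAt_ne (j k l : ι) (v : ι → Bool) : flipAt j (flipAt k v) ≠ flipAt l v := fun h => by
  by_cases hjk : j = k
  · subst hjk; simp at h; exact flipAt_ne l v h.symm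
  · have h1 := congrFun h j
    have h2 := congrFun h k
    by_cases hl : j = l
    · subst hl; simp [flipAt_apply, Ne.symm hjk] at h2
    · simp [flipAt_apply, hjk, hl] at h1

theorem flipAt_flipAt_eq {j k a b : ι} {v : ι → Bool} (hjk : j ≠ k)
    (h : flipAt j (flipAt k v) = flipAt a (flipAt b v)) : (j = a ∧ k = b) ∨ (j = b ∧ k = a) := by
  have h1 := congrFun h j
  have h2 := congrFun h k
  simp only [flipAt_apply] at h1 h2
  grind

theorem setAt_of_eq {j : ι} {s : Bool} {v : ι → Bool} (h : v j = s) : setAt j s v = v := by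
  funext i; by_cases hi : i = j <;> simp [setAt_apply, hi, h]

theorem setAt_of_ne {j : ι} {s : Bool} {v : ι → Bool} (h : v j ≠ s) : setAt j s v = flipAt j v := by
  funext i; by_cases hi : i = j
  · subst hi; cases s <;> simp_all [setAt_apply, flipAt_apply]
  · simp [setAt_apply, flipAt_apply, hi]

@[simp] theorem setAt_flipAt_self (j : ι) (s : Bool) (v : ι → Bool) :
    setAt j s (flipAt j v) = setAt j s v := by
  funext i; by_cases hi : i = j <;> simp [setAt_apply, flipAt_apply, hi]

theorem setAt_flipAt {i j : ι} (h : j ≠ i) (s : Bool) (v : ι → Bool) :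
    setAt i s (flipAt j v) = flipAt j (setAt i s v) := by
  funext k; by_cases hk : k = i
  · subst hk; simp [setAt_apply, flipAt_apply, h.symm]
  · simp [setAt_apply, flipAt_apply, hk]

@[simp] theorem setAt_setAt (i : ι) (s s' : Bool) (v : ι → Bool) :
    setAt i s (setAt i s' v) = setAt i s v := by
  funext k; by_cases hk : k = i <;> simp [setAt_apply, hk]

@[simp] theorem setAt_self (i : ι) (v : ι → Bool) : setAt i (v i) v = v := setAt_of_eq rfl

@[simp] theorem setAt_apply_self (i : ι) (s : Bool) (v : ι → Bool) : setAt i s v i = s := by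
  simp [setAt_apply]

@[simp] theorem flipAt_apply_self (i : ι) (v : ι → Bool) : flipAt i v i = !v i := by
  simp [flipAt_apply]

theorem flipAt_apply_of_ne {i j : ι} (h : i ≠ j) (v : ι → Bool) : flipAt j v i = v i := by
  simp [flipAt_apply, h]

theorem setAt_not (i : ι) (v : ι → Bool) : setAt i (!v i) v = flipAt i v :=
  setAt_of_ne (by simp)

end Flip

/-! ### Precolourings as finite sets of entries -/

/-- An entry `(v, j, c)`: the edge at `v` in direction `j` gets the colour `c`. -/
abbrev Entry (ι C : Type*) := (ι → Bool) × ι × C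

section Entries

variable {ι C : Type*} [DecidableEq ι]

/-- The vertex `v` is an end of the edge of the entry `t`. -/
def Touch (t : Entry ι C) (v : ι → Bool) : Prop := v = t.1 ∨ v = flipAt t.2.1 t.1

/-- The edge at `v` in direction `j` is coloured `c` by `P`. -/
def Has (P : Finset (Entry ι C)) (v : ι → Bool) (j : ι) (c : C) : Prop :=
  ∃ t ∈ P, t.2.1 = j ∧ t.2.2 = c ∧ Touch t v

/-- `P` is a proper precolouring of the edges with directions in `S` by the colours in `T`. -/
structure Good (S : Finset ι) (T : Finset C) (P : Finset (Entry ι C)) : Prop where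
  dir : ∀ t ∈ P, t.2.1 ∈ S
  col : ∀ t ∈ P, t.2.2 ∈ T
  proper : ∀ {v j k c c'}, Has P v j c → Has P v k c' → (j = k ↔ c = c')

/-- `f` is a proper edge colouring of the edges with directions in `S` by the colours in `T`. -/
structure IsCol (S : Finset ι) (T : Finset C) (f : (ι → Bool) → ι → C) : Prop where
  mem : ∀ v, ∀ j ∈ S, f v j ∈ T
  symm : ∀ v, ∀ j ∈ S, f (flipAt j v) j = f v j
  inj : ∀ v, ∀ j ∈ S, ∀ k ∈ S, f v j = f v k → j = k

/-- The precolouring `P` extends to a proper edge colouring. -/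
def Extends (S : Finset ι) (T : Finset C) (P : Finset (Entry ι C)) : Prop :=
  ∃ f, IsCol S T f ∧ ∀ t ∈ P, f t.1 t.2.1 = t.2.2

variable {S : Finset ι} {T : Finset C} {P Q R : Finset (Entry ι C)}

theorem touch_fst (t : Entry ι C) : Touch t t.1 := Or.inl rfl

theorem touch_flip (t : Entry ι C) : Touch t (flipAt t.2.1 t.1) := Or.inr rfl

theorem touch_flipAt_iff {t : Entry ι C} {v : ι → Bool} : Touch t (flipAt t.2.1 v) ↔ Touch t v := by
  unfold Touch
  rw [flipAt_inj, or_comm, eq_comm (a := flipAt _ _), ← eq_flipAt_comm (v := v), eq_comm]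

theorem Touch.eq_or {t : Entry ι C} {v w : ι → Bool} (hv : Touch t v) (hw : Touch t w) :
    w = v ∨ w = flipAt t.2.1 v := by
  rcases hv with rfl | rfl <;> rcases hw with rfl | rfl <;> simp

theorem Touch.apply_eq {t : Entry ι C} {v w : ι → Bool} (hv : Touch t v) (hw : Touch t w) {i : ι}
    (hi : t.2.1 ≠ i) : w i = v i := by
  rcases hv.eq_or hw with rfl | rfl
  · rfl
  · exact flipAt_apply_of_ne hi.symm _

theorem has_of_mem {t : Entry ι C} (h : t ∈ P) : Has P t.1 t.2.1 t.2.2 := ⟨t, h, rfl, rfl, Or.inl rfl⟩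

theorem has_of_touch {t : Entry ι C} (h : t ∈ P) {v} (hv : Touch t v) : Has P v t.2.1 t.2.2 :=
  ⟨t, h, rfl, rfl, hv⟩

theorem Has.symm {v : ι → Bool} {j : ι} {c : C} (h : Has P v j c) : Has P (flipAt j v) j c := by
  obtain ⟨t, ht, rfl, rfl, hv⟩ := h
  exact ⟨t, ht, rfl, rfl, touch_flipAt_iff.2 hv⟩

theorem has_flip {v : ι → Bool} {j : ι} {c : C} : Has P (flipAt j v) j c ↔ Has P v j c :=
  ⟨fun h => by simpa using h.symm, Has.symm⟩

theorem Has.mono (h : P ⊆ Q) {v : ι → Bool} {j : ι} {c : C} : Has P v j c → Has Q v j c :=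
  fun ⟨t, ht, h'⟩ => ⟨t, h ht, h'⟩

theorem Good.mono (h : Good S T Q) (hP : P ⊆ Q) : Good S T P :=
  ⟨fun t ht => h.dir t (hP ht), fun t ht => h.col t (hP ht),
    fun h1 h2 => h.proper (h1.mono hP) (h2.mono hP)⟩

theorem Good.weaken (h : Good S T P) {S' : Finset ι} {T' : Finset C}
    (hS : ∀ t ∈ P, t.2.1 ∈ S') (hT : ∀ t ∈ P, t.2.2 ∈ T') : Good S' T' P :=
  ⟨hS, hT, h.proper⟩

theorem Good.dir_mem (h : Good S T P) {v : ι → Bool} {j : ι} {c : C} (h' : Has P v j c) : j ∈ S := by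
  obtain ⟨t, ht, rfl, rfl, -⟩ := h'
  exact h.dir t ht

theorem has_insert [DecidableEq (Entry ι C)] {t : Entry ι C} {v : ι → Bool} {j : ι} {c : C} :
    Has (insert t P) v j c ↔ (t.2.1 = j ∧ t.2.2 = c ∧ Touch t v) ∨ Has P v j c := by
  simp [Has]

theorem has_union [DecidableEq (Entry ι C)] {v : ι → Bool} {j : ι} {c : C} :
    Has (P ∪ Q) v j c ↔ Has P v j c ∨ Has Q v j c := by
  simp only [Has, Finset.mem_union]
  grind

theorem has_filter {p : Entry ι C → Prop} [DecidablePred p] {v : ι → Bool} {j : ι} {c : C} :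
    Has (P.filter p) v j c ↔ ∃ t ∈ P, p t ∧ t.2.1 = j ∧ t.2.2 = c ∧ Touch t v := by
  simp only [Has, Finset.mem_filter]
  grind

theorem not_has_empty {v : ι → Bool} {j : ι} {c : C} : ¬ Has (∅ : Finset (Entry ι C)) v j c := by
  simp [Has]

theorem good_empty : Good S T (∅ : Finset (Entry ι C)) :=
  ⟨by simp, by simp, fun h => (not_has_empty h).elim⟩

/-- Adding one entry to a proper precolouring. -/
theorem Good.insert [DecidableEq (Entry ι C)] (h : Good S T P) {v : ι → Bool} {j : ι} {c : C}
    (hj : j ∈ S) (hc : c ∈ T) (h1 : ∀ x, Has P v j x → x = c)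
    (h2 : ∀ k, Has P v k c → k = j) (h3 : ∀ k, Has P (flipAt j v) k c → k = j) :
    Good S T (insert (v, j, c) P) := by
  have key : ∀ w, Touch ((v, j, c) : Entry ι C) w →
      (∀ x, Has P w j x → x = c) ∧ ∀ k, Has P w k c → k = j := by
    rintro w (rfl | rfl)
    · exact ⟨h1, h2⟩
    · exact ⟨fun x hx => h1 x (has_flip.1 hx), h3⟩
  refine ⟨?_, ?_, ?_⟩
  · simpa [hj] using h.dir
  · simpa [hc] using h.col
  · intro w a b x y ha hb
    rw [has_insert] at ha hb
    rcases ha with ⟨rfl, rfl, ha⟩ | ha <;> rcases hb with ⟨rfl, rfl, hb⟩ | hb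
    · simp
    · obtain ⟨k1, k2⟩ := key w ha
      constructor <;> rintro rfl
      exacts [(k1 _ hb).symm, (k2 _ hb).symm]
    · obtain ⟨k1, k2⟩ := key w hb
      constructor <;> rintro rfl
      exacts [k1 _ ha, k2 _ ha]
    · exact h.proper ha hb

theorem IsCol.eq_of_has {f : (ι → Bool) → ι → C} (hf : IsCol S T f) (hP : Good S T P)
    (h : ∀ t ∈ P, f t.1 t.2.1 = t.2.2) {v : ι → Bool} {j : ι} {c : C} (hv : Has P v j c) :
    f v j = c := by
  obtain ⟨t, ht, rfl, rfl, rfl | rfl⟩ := hv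
  · exact h t ht
  · rw [hf.symm _ _ (hP.dir t ht), h t ht]

theorem IsCol.eq_of_has' {f : (ι → Bool) → ι → C} (hf : IsCol S T f)
    (h : ∀ t ∈ P, f t.1 t.2.1 = t.2.2) {v : ι → Bool} {j : ι} (hj : j ∈ S) {c : C}
    (hv : Has P v j c) : f v j = c := by
  obtain ⟨t, ht, rfl, rfl, rfl | rfl⟩ := hv
  · exact h t ht
  · rw [hf.symm _ _ hj, h t ht]

/-- Colourings of the two sides of direction `i` are merged; the edges of `N` and the edges in
direction `i` exchange their colours. -/
theorem IsCol.merge [DecidableEq C] {i : ι} {c : C} (hi : i ∈ S) (hc : c ∈ T)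
    {g : (ι → Bool) → ι → C} (hg : IsCol (S.erase i) (T.erase c) g)
    {N : (ι → Bool) → ι → Prop} (N1 : ∀ v j, N v j → j ∈ S.erase i)
    (N2 : ∀ v j, N v j → N (flipAt j v) j) (N3 : ∀ v j k, N v j → N v k → j = k)
    (N4 : ∀ v j, N v j → N (flipAt i v) j ∧ g (flipAt i v) j = g v j) :
    ∃ F, IsCol S T F ∧ (∀ v, (∀ j, ¬ N v j) → F v i = c) ∧
      (∀ v j, N v j → F v i = g v j ∧ F v j = c) ∧
      ∀ v j, j ≠ i → ¬ N v j → F v j = g v j := by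
  classical
  -- An edge of `N`, its mirror image and the two `i`-edges between them form a square colored `g`,
  -- `c`, `g`, `c`. Exchanging the two colors on it keeps the coloring proper, and by `N3` these
  -- squares are vertex-disjoint.
  let F : (ι → Bool) → ι → C := fun v k =>
    if k = i then (if h : ∃ j, N v j then g v h.choose else c) else if N v k then c else g v k
  have F1 : ∀ v, (∀ j, ¬ N v j) → F v i = c := fun v hv => by simp [F, hv]
  have F2 : ∀ v j, N v j → F v i = g v j := fun v j hv => by
    have h : ∃ j, N v j := ⟨j, hv⟩
    have e : h.choose = j := N3 v _ _ h.choose_spec hv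
    simp [F, h, e]
  have F3 : ∀ v j, N v j → F v j = c := fun v j hv => by
    have : j ≠ i := (Finset.mem_erase.1 (N1 v j hv)).1
    simp [F, this, hv]
  have F4 : ∀ v j, j ≠ i → ¬ N v j → F v j = g v j := fun v j hj hv => by simp [F, hj, hv]
  refine ⟨F, ⟨?_, ?_, ?_⟩, F1, fun v j h => ⟨F2 v j h, F3 v j h⟩, F4⟩
  · intro v j hj
    by_cases hji : j = i
    · subst hji
      by_cases h : ∃ k, N v k
      · obtain ⟨k, hk⟩ := h
        rw [F2 v k hk]
        exact Finset.mem_of_mem_erase (hg.mem v k (N1 v k hk))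
      · rw [F1 v (by simpa using h)]; exact hc
    · by_cases h : N v j
      · rw [F3 v j h]; exact hc
      · rw [F4 v j hji h]
        exact Finset.mem_of_mem_erase (hg.mem v j (Finset.mem_erase.2 ⟨hji, hj⟩))
  · intro v j hj
    by_cases hji : j = i
    · subst hji
      by_cases h : ∃ k, N v k
      · obtain ⟨k, hk⟩ := h
        rw [F2 v k hk, F2 _ k (N4 v k hk).1, (N4 v k hk).2]
      · have h' : ∀ k, ¬ N v k := by simpa using h
        rw [F1 v h', F1]
        intro k hk
        exact h' k (by simpa using (N4 _ k hk).1)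
    · by_cases h : N v j
      · rw [F3 v j h, F3 _ j (N2 v j h)]
      · have h' : ¬ N (flipAt j v) j := fun h' => h (by simpa using N2 _ j h')
        rw [F4 v j hji h, F4 _ j hji h', hg.symm v j (Finset.mem_erase.2 ⟨hji, hj⟩)]
  · have key : ∀ v j, j ∈ S → j ≠ i → F v i ≠ F v j := by
      intro v j hj hji he
      have hj' : j ∈ S.erase i := Finset.mem_erase.2 ⟨hji, hj⟩
      by_cases h : ∃ k, N v k
      · obtain ⟨k, hk⟩ := h
        rw [F2 v k hk] at he
        by_cases hjN : N v j
        · rw [F3 v j hjN] at he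
          exact (Finset.mem_erase.1 (hg.mem v k (N1 v k hk))).1 he
        · rw [F4 v j hji hjN] at he
          have := hg.inj v k (N1 v k hk) j hj' he
          exact hjN (this ▸ hk)
      · have h' : ∀ k, ¬ N v k := by simpa using h
        rw [F1 v h', F4 v j hji (h' j)] at he
        exact (Finset.mem_erase.1 (hg.mem v j hj')).1 he.symm
    intro v j hj k hk he
    by_cases hji : j = i
    · by_cases hki : k = i
      · rw [hji, hki]
      · rw [hji] at he; exact (key v k hk hki he).elim
    · by_cases hki : k = i
      · rw [hki] at he; exact (key v j hj hji he.symm).elim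
      · have hj' : j ∈ S.erase i := Finset.mem_erase.2 ⟨hji, hj⟩
        have hk' : k ∈ S.erase i := Finset.mem_erase.2 ⟨hki, hk⟩
        by_cases hjN : N v j <;> by_cases hkN : N v k
        · exact N3 v j k hjN hkN
        · rw [F3 v j hjN, F4 v k hki hkN] at he
          exact ((Finset.mem_erase.1 (hg.mem v k hk')).1 he.symm).elim
        · rw [F3 v k hkN, F4 v j hji hjN] at he
          exact ((Finset.mem_erase.1 (hg.mem v j hj')).1 he).elim
        · rw [F4 v j hji hjN, F4 v k hki hkN] at he
          exact hg.inj v j hj' k hk' he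

/-- The general reduction to the sides of direction `i`. The edges of `R`, normalised to the side
`s`, are those that exchange their colours with edges in direction `i`. -/
theorem extends_of_merge [DecidableEq C] {i : ι} {c : C} (hi : i ∈ S) (hc : c ∈ T)
    {g : (ι → Bool) → ι → C} (hg : IsCol (S.erase i) (T.erase c) g) (s : Bool)
    (hR : Good (S.erase i) {c} R)
    (hgR : ∀ v j, Has R (setAt i s v) j c → g (flipAt i v) j = g v j)
    (h1 : ∀ t ∈ P, t.2.1 ≠ i → (Has R (setAt i s t.1) t.2.1 c ∧ t.2.2 = c) ∨
      (¬ Has R (setAt i s t.1) t.2.1 c ∧ g t.1 t.2.1 = t.2.2))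
    (h2 : ∀ t ∈ P, t.2.1 = i → (t.2.2 = c ∧ ∀ k, ¬ Has R (setAt i s t.1) k c) ∨
      ∃ k, Has R (setAt i s t.1) k c ∧ g t.1 k = t.2.2) : Extends S T P := by
  obtain ⟨F, hF, F1, F2, F3⟩ := hg.merge hi hc (N := fun v j => Has R (setAt i s v) j c)
    (fun v j h => hR.dir_mem h)
    (fun v j h => by
      rw [setAt_flipAt (Finset.mem_erase.1 (hR.dir_mem h)).1]
      exact h.symm)
    (fun v j k hj hk => (hR.proper hj hk).2 rfl)
    (fun v j h => ⟨by rwa [setAt_flipAt_self], hgR v j h⟩)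
  refine ⟨F, hF, fun t ht => ?_⟩
  by_cases hti : t.2.1 = i
  · rcases h2 t ht hti with ⟨h, h'⟩ | ⟨k, hk, h⟩
    · rw [hti, F1 _ h', h]
    · rw [hti, (F2 _ k hk).1, h]
  · rcases h1 t ht hti with ⟨h, h'⟩ | ⟨h, h'⟩
    · rw [(F2 _ _ h).2, h']
    · rw [F3 _ _ hti h, h']

/-- Both sides of direction `i` get copies of the same colouring. -/
theorem extends_of_copy [DecidableEq C] {i : ι} {c : C} (hi : i ∈ S) (hc : c ∈ T) (s : Bool)
    (hQ : Extends (S.erase i) (T.erase c) Q) (hR : Good (S.erase i) {c} R)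
    (h1 : ∀ t ∈ P, t.2.1 ≠ i → (Has R (setAt i s t.1) t.2.1 c ∧ t.2.2 = c) ∨
      (¬ Has R (setAt i s t.1) t.2.1 c ∧ Has Q (setAt i s t.1) t.2.1 t.2.2))
    (h2 : ∀ t ∈ P, t.2.1 = i → (t.2.2 = c ∧ ∀ k, ¬ Has R (setAt i s t.1) k c) ∨
      ∃ k, Has R (setAt i s t.1) k c ∧ Has Q (setAt i s t.1) k t.2.2)
    (hdir : ∀ t ∈ P, t.2.1 ∈ S) : Extends S T P := by
  obtain ⟨f, hf, hfQ⟩ := hQ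
  have hg : IsCol (S.erase i) (T.erase c) fun v j => f (setAt i s v) j := by
    refine ⟨fun v j hj => hf.mem _ j hj, fun v j hj => ?_, fun v => hf.inj _⟩
    simp only [setAt_flipAt (Finset.mem_erase.1 hj).1]
    exact hf.symm _ j hj
  refine extends_of_merge hi hc hg s hR (fun v j _ => by simp) (fun t ht hti => ?_) fun t ht hti => ?_
  · rcases h1 t ht hti with h | ⟨h, h'⟩
    · exact Or.inl h
    · exact Or.inr ⟨h, hf.eq_of_has' hfQ (Finset.mem_erase.2 ⟨hti, hdir t ht⟩) h'⟩
  · rcases h2 t ht hti with h | ⟨k, hk, h'⟩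
    · exact Or.inl h
    · exact Or.inr ⟨k, hk, hf.eq_of_has' hfQ (hR.dir_mem hk) h'⟩

/-- The two sides of direction `i` get colourings that extend `Q false` and `Q true`. -/
theorem extends_of_sides [DecidableEq C] {i : ι} {c : C} (hi : i ∈ S) (hc : c ∈ T) (s : Bool)
    {Q : Bool → Finset (Entry ι C)}
    (hQ : ∀ b, Extends (S.erase i) (T.erase c) (Q b)) (hR : Good (S.erase i) {c} R)
    (hRQ : ∀ t ∈ R, ∃ x, ∀ b, Has (Q b) (setAt i b t.1) t.2.1 x)
    (h1 : ∀ t ∈ P, t.2.1 ≠ i → (Has R (setAt i s t.1) t.2.1 c ∧ t.2.2 = c) ∨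
      (¬ Has R (setAt i s t.1) t.2.1 c ∧ Has (Q (t.1 i)) t.1 t.2.1 t.2.2))
    (h2 : ∀ t ∈ P, t.2.1 = i → (t.2.2 = c ∧ ∀ k, ¬ Has R (setAt i s t.1) k c) ∨
      ∃ k, Has R (setAt i s t.1) k c ∧ Has (Q (t.1 i)) t.1 k t.2.2)
    (hdir : ∀ t ∈ P, t.2.1 ∈ S) : Extends S T P := by
  choose f hf hfQ using hQ
  have hg : IsCol (S.erase i) (T.erase c) fun v j => f (v i) v j := by
    refine ⟨fun v j hj => (hf _).mem _ j hj, fun v j hj => ?_, fun v => (hf _).inj _⟩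
    simp only [flipAt_apply_of_ne (Finset.mem_erase.1 hj).1.symm]
    exact (hf _).symm _ j hj
  have hR' : ∀ v j, Has R (setAt i s v) j c → ∃ x, ∀ b, Has (Q b) (setAt i b v) j x := by
    rintro v j ⟨t, ht, rfl, -, h⟩
    obtain ⟨x, hx⟩ := hRQ t ht
    have hne := (Finset.mem_erase.1 (hR.dir t ht)).1
    refine ⟨x, fun b => ?_⟩
    rcases h with h | h
    · have : setAt i b v = setAt i b t.1 := by rw [← h, setAt_setAt]
      rw [this]; exact hx b
    · have : setAt i b v = flipAt t.2.1 (setAt i b t.1) := by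
        rw [← setAt_flipAt hne, ← h, setAt_setAt]
      rw [this]; exact (hx b).symm
  refine extends_of_merge hi hc hg s hR (fun v j h => ?_) (fun t ht hti => ?_) fun t ht hti => ?_
  · obtain ⟨x, hx⟩ := hR' v j h
    have hj := hR.dir_mem h
    have e1 := (hf (v i)).eq_of_has' (hfQ _) hj (by simpa using hx (v i))
    have e2 := (hf (!v i)).eq_of_has' (hfQ _) hj (hx (!v i))
    rw [setAt_not] at e2
    simp only [flipAt_apply_self, e1, e2]
  · rcases h1 t ht hti with h | ⟨h, h'⟩
    · exact Or.inl h
    · exact Or.inr ⟨h, (hf _).eq_of_has' (hfQ _) (Finset.mem_erase.2 ⟨hti, hdir t ht⟩) h'⟩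
  · rcases h2 t ht hti with h | ⟨k, hk, h'⟩
    · exact Or.inl h
    · exact Or.inr ⟨k, hk, (hf _).eq_of_has' (hfQ _) (hR.dir_mem hk) h'⟩

end Entries

/-! ### Pigeonhole principles -/

section Counting

/-- A relation that assigns to every element of `S` an element of the set `P`, no element of `P` to
two elements of `S`, is a bijection if `P` is not larger than `S`. -/
theorem rel_bijective {α β : Type*} {P : Finset α} {S : Finset β} {r : α → β → Prop}
    (h1 : ∀ j ∈ S, ∃ t ∈ P, r t j) (h2 : ∀ t ∈ P, ∀ j ∈ S, ∀ k ∈ S, r t j → r t k → j = k)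
    (hc : P.card ≤ S.card) :
    (∀ t ∈ P, ∃ j ∈ S, r t j) ∧ (∀ t ∈ P, ∀ t' ∈ P, ∀ j ∈ S, r t j → r t' j → t = t') ∧
      P.card = S.card := by
  classical
  choose f hf hr using fun j : S => h1 j.1 j.2
  have hinj : Function.Injective f := fun a b hab =>
    Subtype.ext (h2 _ (hf a) _ a.2 _ b.2 (hr a) (hab ▸ hr b))
  have himg : S.attach.image f = P := by
    refine Finset.eq_of_subset_of_card_le (fun t ht => ?_) ?_
    · obtain ⟨a, -, rfl⟩ := Finset.mem_image.1 ht; exact hf a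
    · rw [Finset.card_image_of_injective _ hinj, Finset.card_attach]; exact hc
  have hsurj : ∀ t ∈ P, ∃ a, f a = t := fun t ht => by
    rw [← himg] at ht
    obtain ⟨a, -, rfl⟩ := Finset.mem_image.1 ht
    exact ⟨a, rfl⟩
  refine ⟨fun t ht => ?_, fun t ht t' ht' j hj hrt hrt' => ?_, ?_⟩
  · obtain ⟨a, rfl⟩ := hsurj t ht
    exact ⟨a.1, a.2, hr a⟩
  · obtain ⟨a, rfl⟩ := hsurj t ht
    obtain ⟨b, rfl⟩ := hsurj t' ht'
    have e1 := h2 _ ht _ a.2 _ hj (hr a) hrt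
    have e2 := h2 _ ht' _ b.2 _ hj (hr b) hrt'
    exact congrArg f (Subtype.ext (e1.trans e2.symm))
  · rw [← himg, Finset.card_image_of_injective _ hinj, Finset.card_attach]

theorem exists_notMem_image {α β : Type*} {P : Finset α} {S : Finset β} (f : α → β)
    (h : P.card < S.card) : ∃ j ∈ S, ∀ t ∈ P, f t ≠ j := by
  classical
  obtain ⟨j, hj, hj'⟩ := Finset.exists_mem_notMem_of_card_lt_card
    (Finset.card_image_le.trans_lt h : (P.image f).card < S.card)
  exact ⟨j, hj, fun t ht e => hj' (Finset.mem_image.2 ⟨t, ht, e⟩)⟩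

end Counting

/-! ### Saturated edges, blocked vertices and their rigidity -/

section Obstructions

variable {ι C : Type*} [DecidableEq ι] {S : Finset ι} {T : Finset C} {P Q R : Finset (Entry ι C)}

/-- Some uncoloured edge is adjacent to edges of all colours in `T`. -/
def Sat (S : Finset ι) (T : Finset C) (P : Finset (Entry ι C)) : Prop :=
  ∃ v, ∃ j ∈ S, (∀ c, ¬ Has P v j c) ∧ ∀ c ∈ T, ∃ k, Has P v k c ∨ Has P (flipAt j v) k c

/-- Some colour is missing at a vertex and cannot be used on any of its uncoloured edges. -/
def Blk (S : Finset ι) (T : Finset C) (P : Finset (Entry ι C)) : Prop :=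
  ∃ u, ∃ c ∈ T, (∀ k, ¬ Has P u k c) ∧ ∀ j ∈ S, (∃ x, Has P u j x) ∨ ∃ k, Has P (flipAt j u) k c

/-- Each entry has only one color, so showing `|T|` colors with at most `|T|` entries uses every
entry exactly once. A saturated edge therefore locates all entries and makes their colors distinct.
-/
theorem sat_struct (hcard : P.card ≤ T.card) {v : ι → Bool} {j : ι}
    (h0 : ∀ c, ¬ Has P v j c) (h : ∀ c ∈ T, ∃ k, Has P v k c ∨ Has P (flipAt j v) k c) :
    (∀ t ∈ P, (Touch t v ∨ Touch t (flipAt j v)) ∧ t.2.1 ≠ j) ∧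
      (∀ t ∈ P, ∀ t' ∈ P, t.2.2 = t'.2.2 → t = t') ∧ P.card = T.card ∧ ∀ t ∈ P, t.2.2 ∈ T := by
  obtain ⟨a1, a2, a3⟩ := rel_bijective (P := P) (S := T)
    (r := fun t c => t.2.2 = c ∧ (Touch t v ∨ Touch t (flipAt j v)))
    (fun c hc => by
      obtain ⟨k, ⟨t, ht, -, e, h'⟩ | ⟨t, ht, -, e, h'⟩⟩ := h c hc
      exacts [⟨t, ht, e, Or.inl h'⟩, ⟨t, ht, e, Or.inr h'⟩])
    (fun t _ a _ b _ h1 h2 => h1.1.symm.trans h2.1) hcard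
  refine ⟨fun t ht => ?_, fun t ht t' ht' e => ?_, a3, fun t ht => ?_⟩
  · obtain ⟨c, -, -, h'⟩ := a1 t ht
    refine ⟨h', fun e => h0 t.2.2 ?_⟩
    subst e
    exact ⟨t, ht, rfl, rfl, h'.elim id touch_flipAt_iff.1⟩
  · obtain ⟨c, hc, e1, h1⟩ := a1 t ht
    obtain ⟨c', -, e2, h2⟩ := a1 t' ht'
    exact a2 t ht t' ht' c hc ⟨e1, h1⟩ ⟨e ▸ e1, h2⟩
  · obtain ⟨c, hc, e1, h1⟩ := a1 t ht
    exact e1 ▸ hc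

/-- The entry `t` is the one that keeps the colour `c` away from the edge at `u` in direction `j`. -/
def Hits (u : ι → Bool) (c : C) (t : Entry ι C) (j : ι) : Prop :=
  (Touch t u ∧ t.2.1 = j) ∨ (t.2.2 = c ∧ Touch t (flipAt j u))

/-- An entry at `u` does not have color `c`, so it hits its own direction only. An entry of color
`c` is not at `u` and cannot meet two neighbours of `u`, which have equal parity. -/
theorem Hits.unique {u : ι → Bool} {c : C} (h0 : ∀ k, ¬ Has P u k c) {t : Entry ι C} (ht : t ∈ P)
    {j k : ι} (h1 : Hits u c t j) (h2 : Hits u c t k) : j = k := by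
  have hn : t.2.2 = c → ¬ Touch t u := fun e h' => h0 _ ⟨t, ht, rfl, e, h'⟩
  rcases h1 with ⟨a, b⟩ | ⟨a, b⟩ <;> rcases h2 with ⟨a', b'⟩ | ⟨a', b'⟩
  · exact b.symm.trans b'
  · exact (hn a' a).elim
  · exact (hn a a').elim
  · rcases b.eq_or b' with e | e
    · exact (flipAt_eq_flipAt.1 e).symm
    · exact (flipAt_flipAt_ne _ _ _ _ e.symm).elim

/-- The same count as in `sat_struct` with directions in place of colors: at most `|S|` entries have
to hit `|S|` directions. -/
theorem blk_struct (hcard : P.card ≤ S.card) {u : ι → Bool} {c : C}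
    (h0 : ∀ k, ¬ Has P u k c)
    (h : ∀ j ∈ S, (∃ x, Has P u j x) ∨ ∃ k, Has P (flipAt j u) k c) :
    (∀ t ∈ P, ∃ j ∈ S, Hits u c t j) ∧
      (∀ t ∈ P, ∀ t' ∈ P, ∀ j ∈ S, Hits u c t j → Hits u c t' j → t = t') ∧ P.card = S.card :=
  rel_bijective (P := P) (S := S)
    (fun j hj => by
      rcases h j hj with ⟨x, t, ht, e, -, h'⟩ | ⟨k, t, ht, -, e, h'⟩
      exacts [⟨t, ht, Or.inl ⟨h', e⟩⟩, ⟨t, ht, Or.inr ⟨e, h'⟩⟩])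
    (fun t ht j _ k _ => Hits.unique h0 ht) hcard

end Obstructions

/-! ### Reduction along a direction, and fewer than `n` precolored edges -/

section Extension

variable {ι C : Type*} [DecidableEq ι] [DecidableEq C]
  {S : Finset ι} {T : Finset C} {P Q R : Finset (Entry ι C)}

/-- A colouring that colours the entries of `P` in the right pattern becomes an extension of `P`
by a permutation of the colours. -/
theorem IsCol.extends_of_pattern {f : (ι → Bool) → ι → C} (hf : IsCol S T f) (hP : Good S T P)
    (h : ∀ t ∈ P, ∀ t' ∈ P, f t.1 t.2.1 = f t'.1 t'.2.1 ↔ t.2.2 = t'.2.2) : Extends S T P := by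
  classical
  have hfT : ∀ t : P, f t.1.1 t.1.2.1 ∈ T := fun t => hf.mem _ _ (hP.dir _ t.2)
  let s : Finset T := P.attach.image fun t => ⟨f t.1.1 t.1.2.1, hfT t⟩
  have hs : ∀ x : T, x ∈ s ↔ ∃ t ∈ P, f t.1 t.2.1 = x := by
    intro x
    simp only [s, Finset.mem_image, Finset.mem_attach, true_and, Subtype.exists]
    constructor
    · rintro ⟨t, ht, rfl⟩; exact ⟨t, ht, rfl⟩
    · rintro ⟨t, ht, e⟩; exact ⟨t, ht, Subtype.ext e⟩
  have hg : ∀ x : T, ∃ y : C, y ∈ T ∧ ∀ t ∈ P, f t.1 t.2.1 = x → t.2.2 = y := by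
    intro x
    by_cases hx : x ∈ s
    · obtain ⟨t, ht, e⟩ := (hs x).1 hx
      exact ⟨t.2.2, hP.col t ht, fun t' ht' e' => (h t' ht' t ht).1 (e'.trans e.symm)⟩
    · exact ⟨x, x.2, fun t ht e => (hx ((hs x).2 ⟨t, ht, e⟩)).elim⟩
  choose g hgT hg using hg
  -- By `h` the map from the colors that `f` uses on `P` to the prescribed ones is injective, so it
  -- extends to a permutation of `T`.
  obtain ⟨σ, hσ⟩ := Finset.exists_equiv_extend_of_card_eq (α := T) (t := T) (by simp) (s := s)
    (f := g) (fun y hy => by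
      obtain ⟨x, -, rfl⟩ := Finset.mem_image.1 hy; exact hgT x)
    (fun x hx y hy e => by
      obtain ⟨t, ht, e1⟩ := (hs x).1 hx
      obtain ⟨t', ht', e2⟩ := (hs y).1 hy
      refine Subtype.ext ?_
      rw [← e1, ← e2, h t ht t' ht', hg x t ht e1, hg y t' ht' e2, e])
  let F : (ι → Bool) → ι → C := fun v j => if hx : f v j ∈ T then σ ⟨f v j, hx⟩ else f v j
  have hF : ∀ v, ∀ j, ∀ hj : j ∈ S, F v j = σ ⟨f v j, hf.mem v j hj⟩ := fun v j hj => by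
    simp [F, hf.mem v j hj]
  refine ⟨F, ⟨fun v j hj => ?_, fun v j hj => ?_, fun v j hj k hk e => ?_⟩, fun t ht => ?_⟩
  · rw [hF v j hj]; exact (σ _).2
  · simp only [F, hf.symm v j hj]
  · rw [hF v j hj, hF v k hk] at e
    have := σ.injective (Subtype.ext e)
    exact hf.inj v j hj k hk (congrArg Subtype.val this)
  · rw [hF _ _ (hP.dir t ht), hσ _ ((hs _).2 ⟨t, ht, rfl⟩)]
    exact (hg _ t ht rfl).symm

/-- If the colour class `c` is the colour class of the edges in direction `i`, both sides can be
extended separately. -/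
theorem extends_of_split {i : ι} {c : C} (hP : Good S T P) (hi : i ∈ S) (hc : c ∈ T)
    (h : ∀ t ∈ P, t.2.1 = i → t.2.2 = c)
    (hQ : ∀ b, Extends (S.erase i) (T.erase c) (P.filter fun t => t.2.1 ≠ i ∧ t.1 i = b)) :
    Extends S T P := by
  refine extends_of_sides (R := ∅) hi hc true hQ good_empty (by simp) (fun t ht hti => Or.inr
    ⟨not_has_empty, ?_⟩) (fun t ht hti => Or.inl ⟨h t ht hti, fun k => not_has_empty⟩) hP.dir
  exact has_filter.2 ⟨t, ht, ⟨hti, rfl⟩, rfl, rfl, touch_fst t⟩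

/-- If all entries lie on one side of the direction `i` or have direction `i` and colour `c`, the
colour `c` is removed first. -/
theorem extends_of_oneSided {i : ι} {c : C} (hP : Good S T P) (hi : i ∈ S) (hc : c ∈ T) (s : Bool)
    (h : ∀ t ∈ P, t.2.1 = i → t.2.2 = c) (hs : ∀ t ∈ P, t.2.1 ≠ i → t.1 i = s)
    (hQ : Extends (S.erase i) (T.erase c) (P.filter fun t => t.2.1 ≠ i ∧ t.2.2 ≠ c)) :
    Extends S T P := by
  -- Both sides receive the same coloring, so the edges of color `c` can be exchanged with `i`-edges
  -- whatever color they have there. Only the entries of other colors have to be prescribed.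
  have hR : Good (S.erase i) {c} (P.filter fun t => t.2.1 ≠ i ∧ t.2.2 = c) :=
    (hP.mono (Finset.filter_subset _ _)).weaken
      (fun t ht => by
        rw [Finset.mem_filter] at ht
        exact Finset.mem_erase.2 ⟨ht.2.1, hP.dir t ht.1⟩)
      (fun t ht => by rw [Finset.mem_filter] at ht; simp [ht.2.2])
  refine extends_of_copy hi hc s hQ hR (fun t ht hti => ?_) (fun t ht hti => ?_) hP.dir
  · rw [setAt_of_eq (hs t ht hti)]
    by_cases htc : t.2.2 = c
    · exact Or.inl ⟨has_filter.2 ⟨t, ht, ⟨hti, htc⟩, rfl, htc, touch_fst t⟩, htc⟩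
    · refine Or.inr ⟨fun h' => htc ?_, has_filter.2 ⟨t, ht, ⟨hti, htc⟩, rfl, rfl, touch_fst t⟩⟩
      exact (hP.proper (h'.mono (Finset.filter_subset _ _)) (has_of_mem ht)).1 rfl |>.symm
  · refine Or.inl ⟨h t ht hti, fun k hk => ?_⟩
    have hk' : k ≠ i := (Finset.mem_erase.1 (hR.dir_mem hk)).1
    have h1 : Touch t (setAt i s t.1) := by
      by_cases e : t.1 i = s
      · rw [setAt_of_eq e]; exact touch_fst t
      · rw [setAt_of_ne e, ← hti]; exact touch_flip t
    refine hk' ?_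
    rw [← hti]
    exact (hP.proper (hk.mono (Finset.filter_subset _ _)) (has_of_touch ht h1)).2 (h t ht hti).symm

theorem Good.filter_side (hP : Good S T P) {i : ι} {c : C} {p : Entry ι C → Prop}
    [DecidablePred p] (h : ∀ t ∈ P, p t → t.2.1 ≠ i ∧ t.2.2 ≠ c) :
    Good (S.erase i) (T.erase c) (P.filter p) :=
  (hP.mono (Finset.filter_subset _ _)).weaken
    (fun t ht => by
      rw [Finset.mem_filter] at ht
      exact Finset.mem_erase.2 ⟨(h t ht.1 ht.2).1, hP.dir t ht.1⟩)
    (fun t ht => by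
      rw [Finset.mem_filter] at ht
      exact Finset.mem_erase.2 ⟨(h t ht.1 ht.2).2, hP.col t ht.1⟩)

/-- A proper precolouring of fewer than `n` edges of the `n`-dimensional hypercube extends. -/
theorem extends_of_card_lt {n : ℕ} (hS : S.card = n) (hT : T.card = n) (hP : Good S T P)
    (hn : P.card < n) : Extends S T P := by
  induction n generalizing S T P with
  | zero => omega
  | succ n ih =>
    obtain ⟨i, hi, hiP⟩ := exists_notMem_image (P := P) (S := S) (fun t => t.2.1) (by omega)
    have hSi : (S.erase i).card = n := by rw [Finset.card_erase_of_mem hi, hS]; rfl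
    have hTc : ∀ c ∈ T, (T.erase c).card = n := fun c hc => by
      rw [Finset.card_erase_of_mem hc, hT]; rfl
    -- If one side contains all entries, deleting the color of one of them lowers the count. If both
    -- sides contain entries, an unused color goes to direction `i`, and each side has fewer
    -- entries.
    by_cases hone : ∃ s, ∀ t ∈ P, t.1 i = s
    · obtain ⟨s, hs⟩ := hone
      rcases P.eq_empty_or_nonempty with rfl | ⟨t0, ht0⟩
      -- Dimension `1` with no entries is done by hand, since the induction hypothesis is vacuous in
      -- dimension `0`.
      · rcases Nat.eq_zero_or_pos n with rfl | hpos
        · obtain ⟨c, rfl⟩ := Finset.card_eq_one.1 hT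
          refine ⟨fun _ _ => c, ⟨by simp, by simp, fun v j hj k hk _ => ?_⟩, by simp⟩
          exact Finset.card_le_one.1 hS.le _ hj _ hk
        · obtain ⟨c, hc⟩ : T.Nonempty := Finset.card_pos.1 (by omega)
          exact extends_of_oneSided hP hi hc s (by simp) (by simp)
            (ih hSi (hTc c hc) (hP.filter_side (fun t _ h => h)) (by simpa using hpos))
      · refine extends_of_oneSided hP hi (hP.col _ ht0) s (fun t ht e => (hiP t ht e).elim)
          (fun t ht _ => hs t ht)
          (ih hSi (hTc _ (hP.col _ ht0)) (hP.filter_side (fun t _ h => h)) ?_)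
        have : (P.filter fun t => t.2.1 ≠ i ∧ t.2.2 ≠ t0.2.2).card < P.card :=
          Finset.card_lt_card (Finset.filter_ssubset.2 ⟨t0, ht0, by simp⟩)
        omega
    · obtain ⟨c, hc, hcP⟩ := exists_notMem_image (P := P) (S := T) (fun t => t.2.2) (by omega)
      push Not at hone
      refine extends_of_split hP hi hc (fun t ht e => (hiP t ht e).elim) fun b =>
        ih hSi (hTc c hc) (hP.filter_side (fun t ht h => ⟨h.1, hcP t ht⟩)) ?_
      obtain ⟨t0, ht0, hb⟩ := hone b
      have : (P.filter fun t => t.2.1 ≠ i ∧ t.1 i = b).card < P.card :=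
        Finset.card_lt_card (Finset.filter_ssubset.2 ⟨t0, ht0, by simp [hb]⟩)
      omega

/-- If the entries do not all lie in one component, each component can be treated separately. -/
theorem extends_of_components {n : ℕ} (hS : S.card = n) (hT : T.card = n) (hP : Good S T P)
    (hn : P.card ≤ n) {t₁ t₂ : Entry ι C} (h1 : t₁ ∈ P) (h2 : t₂ ∈ P) {i : ι} (hi : i ∉ S)
    (hne : t₁.1 i ≠ t₂.1 i) : Extends S T P := by
  have key : ∀ b, Extends S T (P.filter fun t => t.1 i = b) := by
    intro b
    refine extends_of_card_lt hS hT (hP.mono (Finset.filter_subset _ _)) ?_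
    have : ∃ t ∈ P, t.1 i ≠ b := by
      by_cases e : t₁.1 i = b
      · exact ⟨t₂, h2, fun e' => hne (e.trans e'.symm)⟩
      · exact ⟨t₁, h1, e⟩
    have := Finset.card_lt_card (Finset.filter_ssubset.2 this)
    omega
  choose f hf hfP using key
  refine ⟨fun v j => f (v i) v j, ⟨fun v j hj => (hf _).mem v j hj, fun v j hj => ?_,
    fun v j hj k hk => (hf _).inj v j hj k hk⟩, fun t ht => hfP _ t (by simp [ht])⟩
  simp only [flipAt_apply_of_ne (i := i) (j := j) (by rintro rfl; exact hi hj)]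
  exact (hf _).symm v j hj

end Extension

/-! ### Perfect matchings by Hall's theorem -/

/-! ### Parity classes and sets of vertices without edges between them -/

section Parity

variable {ι : Type*} [DecidableEq ι] [Fintype ι]

/-- The parity of the number of ones of `v`, as a sign. -/
def vsign (v : ι → Bool) : ℤˣ := ∏ i, if v i then -1 else 1

theorem vsign_flipAt (j : ι) (v : ι → Bool) : vsign (flipAt j v) = -vsign v := by
  unfold vsign
  rw [← Finset.mul_prod_erase _ _ (Finset.mem_univ j),
    ← Finset.mul_prod_erase _ (fun i => if v i then (-1 : ℤˣ) else 1) (Finset.mem_univ j)]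
  have : ∏ i ∈ Finset.univ.erase j, (if flipAt j v i then (-1 : ℤˣ) else 1) =
      ∏ i ∈ Finset.univ.erase j, if v i then (-1 : ℤˣ) else 1 :=
    Finset.prod_congr rfl fun i hi => by rw [flipAt_apply_of_ne (Finset.mem_erase.1 hi).1]
  rw [this, flipAt_apply_self]
  cases v j <;> simp

theorem sign_ne_iff {a p : ℤˣ} : a ≠ p ↔ a = -p := by
  rcases Int.units_eq_one_or a with rfl | rfl <;> rcases Int.units_eq_one_or p with rfl | rfl <;>
    decide

/-- The vertices of sign `p` in the component of `b`, if only the directions in `S` are used. -/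
def halfCube (S : Finset ι) (b : ι → Bool) (p : ℤˣ) : Finset (ι → Bool) :=
  Finset.univ.filter fun v => (∀ i, i ∉ S → v i = b i) ∧ vsign v = p

theorem mem_halfCube {S : Finset ι} {b : ι → Bool} {p : ℤˣ} {v : ι → Bool} :
    v ∈ halfCube S b p ↔ (∀ i, i ∉ S → v i = b i) ∧ vsign v = p := by
  simp [halfCube]

theorem flipAt_mem_halfCube {S : Finset ι} {b : ι → Bool} {p : ℤˣ} {v : ι → Bool} {j : ι}
    (hj : j ∈ S) (hv : v ∈ halfCube S b p) : flipAt j v ∈ halfCube S b (-p) := by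
  rw [mem_halfCube] at hv ⊢
  refine ⟨fun i hi => ?_, by rw [vsign_flipAt, hv.2]⟩
  rw [flipAt_apply_of_ne (by rintro rfl; exact hi hj), hv.1 i hi]

theorem halfCube_erase {S : Finset ι} {b : ι → Bool} {p : ℤˣ} {i : ι} (hi : i ∈ S) (b' : ι → Bool)
    (hb : ∀ k, k ≠ i → b' k = b k) :
    halfCube (S.erase i) b' p = (halfCube S b p).filter fun v => v i = b' i := by
  ext v
  simp only [Finset.mem_filter, mem_halfCube, Finset.mem_erase]
  constructor
  · rintro ⟨h1, h2⟩
    refine ⟨⟨fun k hk => ?_, h2⟩, h1 i (by simp)⟩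
    rw [h1 k (fun h => hk h.2), hb k (fun e => hk (e ▸ hi))]
  · rintro ⟨⟨h1, h2⟩, h3⟩
    refine ⟨fun k hk => ?_, h2⟩
    by_cases e : k = i
    · rw [e, h3]
    · rw [h1 k (fun h => hk ⟨e, h⟩), hb k e]

theorem card_halfCube_split {S : Finset ι} {b : ι → Bool} {p : ℤˣ} {i : ι} (hi : i ∈ S) :
    (halfCube S b p).card =
      (halfCube (S.erase i) b p).card + (halfCube (S.erase i) (flipAt i b) p).card := by
  rw [halfCube_erase hi b (fun _ _ => rfl),
    halfCube_erase hi (flipAt i b) (fun k hk => flipAt_apply_of_ne hk b),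
    ← Finset.card_filter_add_card_filter_not (s := halfCube S b p) (fun v => v i = b i)]
  congr 2
  ext v
  simp only [Finset.mem_filter, flipAt_apply_self]
  cases v i <;> cases b i <;> simp

theorem card_halfCube_empty (b : ι → Bool) (p : ℤˣ) :
    (halfCube ∅ b p).card = if vsign b = p then 1 else 0 := by
  have : halfCube ∅ b p = if vsign b = p then {b} else ∅ := by
    ext v
    rw [mem_halfCube]
    constructor
    · rintro ⟨h1, h2⟩
      have : v = b := funext fun i => h1 i (by simp)
      subst this
      simp [h2]
    · split_ifs with h
      · intro hv
        rw [Finset.mem_singleton.1 hv]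
        exact ⟨fun _ _ => rfl, h⟩
      · simp
  rw [this]
  split_ifs <;> simp

theorem card_halfCube {n : ℕ} {S : Finset ι} (hS : S.card = n + 1) (b : ι → Bool) (p : ℤˣ) :
    (halfCube S b p).card = 2 ^ n := by
  induction n generalizing S b with
  | zero =>
    obtain ⟨i, rfl⟩ := Finset.card_eq_one.1 hS
    rw [card_halfCube_split (Finset.mem_singleton_self i)]
    simp only [Finset.erase_singleton, card_halfCube_empty, vsign_flipAt]
    rcases Int.units_eq_one_or (vsign b) with h | h <;>
      rcases Int.units_eq_one_or p with rfl | rfl <;> rw [h] <;> decide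
  | succ n ih =>
    obtain ⟨i, hi⟩ : S.Nonempty := Finset.card_pos.1 (by omega)
    have : (S.erase i).card = n + 1 := by rw [Finset.card_erase_of_mem hi, hS]; rfl
    rw [card_halfCube_split hi, ih this, ih this]
    ring

/-- Two sets of vertices of opposite signs without edges between them, restricted to the two sides
of a direction. -/
theorem cross_split {n : ℕ} {S : Finset ι} (hS : S.card = n + 2) {b : ι → Bool} {p : ℤˣ}
    {X Y : Finset (ι → Bool)} (hX : X ⊆ halfCube S b p) (hY : Y ⊆ halfCube S b (-p))
    (h : ∀ x ∈ X, ∀ j ∈ S, flipAt j x ∉ Y) :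
    ∃ (S' : Finset ι) (b₀ b₁ : ι → Bool) (X₀ X₁ Y₀ Y₁ : Finset (ι → Bool)), S'.card = n + 1 ∧
      X.card = X₀.card + X₁.card ∧ Y.card = Y₀.card + Y₁.card ∧
      X₀.card + Y₁.card ≤ 2 ^ n ∧ X₁.card + Y₀.card ≤ 2 ^ n ∧
      X₀ ⊆ halfCube S' b₀ p ∧ Y₀ ⊆ halfCube S' b₀ (-p) ∧
      X₁ ⊆ halfCube S' b₁ p ∧ Y₁ ⊆ halfCube S' b₁ (-p) ∧
      (∀ x ∈ X₀, ∀ j ∈ S', flipAt j x ∉ Y₀) ∧ ∀ x ∈ X₁, ∀ j ∈ S', flipAt j x ∉ Y₁ := by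
  obtain ⟨i, hi⟩ : S.Nonempty := Finset.card_pos.1 (by omega)
  have hS' : (S.erase i).card = n + 1 := by rw [Finset.card_erase_of_mem hi, hS]; rfl
  have hside : ∀ (Z : Finset (ι → Bool)) (b' : ι → Bool) (q : ℤˣ), (∀ k, k ≠ i → b' k = b k) →
      Z ⊆ halfCube S b q → (Z.filter fun v => v i = b' i) ⊆ halfCube (S.erase i) b' q := by
    intro Z b' q hb hZ
    rw [halfCube_erase hi b' hb]
    exact Finset.filter_subset_filter _ hZ
  have hcard : ∀ Z : Finset (ι → Bool), Z.card =
      (Z.filter fun v => v i = b i).card + (Z.filter fun v => v i = flipAt i b i).card := by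
    intro Z
    rw [← Finset.card_filter_add_card_filter_not (s := Z) (fun v => v i = b i)]
    congr 2
    ext v
    simp only [Finset.mem_filter, flipAt_apply_self]
    cases v i <;> cases b i <;> simp
  -- The part of `X` on one side and the reflection of the part of `Y` on the other lie in a common
  -- half cube of size `2 ^ n`. They are disjoint, as no `i`-edge joins `X` to `Y`.
  have hcross : ∀ b₁ b₂ : ι → Bool, (∀ k, k ≠ i → b₁ k = b k) → (∀ k, k ≠ i → b₂ k = b k) →
      (X.filter fun v => v i = b₁ i).card + (Y.filter fun v => v i = b₂ i).card ≤ 2 ^ n ∨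
        b₁ i = b₂ i := by
    intro b₁ b₂ h1 h2
    by_cases hb : b₁ i = b₂ i
    · exact Or.inr hb
    left
    have hb' : (!b₂ i) = b₁ i := by revert hb; cases b₁ i <;> cases b₂ i <;> simp
    have hinj : Function.Injective (flipAt i) := fun v w e => (flipAt_inj i).1 e
    rw [← card_halfCube hS' b₁ p, ← Finset.card_image_of_injective (Y.filter _) hinj,
      ← Finset.card_union_of_disjoint]
    · refine Finset.card_le_card (Finset.union_subset (hside X b₁ p h1 hX) ?_)
      intro v hv
      obtain ⟨w, hw, rfl⟩ := Finset.mem_image.1 hv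
      rw [Finset.mem_filter] at hw
      rw [halfCube_erase hi b₁ h1, Finset.mem_filter]
      refine ⟨?_, by simp [hw.2, hb']⟩
      have := flipAt_mem_halfCube hi (hY hw.1)
      rwa [neg_neg] at this
    · rw [Finset.disjoint_left]
      intro v hv hv'
      obtain ⟨w, hw, rfl⟩ := Finset.mem_image.1 hv'
      have := h _ (Finset.mem_filter.1 hv).1 i hi
      rw [flipAt_flipAt] at this
      exact this (Finset.mem_filter.1 hw).1
  have hne : b i ≠ flipAt i b i := by simp
  have hb1 : ∀ k, k ≠ i → flipAt i b k = b k := fun k hk => flipAt_apply_of_ne hk b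
  refine ⟨S.erase i, b, flipAt i b, _, _, _, _, hS', hcard X, hcard Y,
    (hcross b (flipAt i b) (fun _ _ => rfl) hb1).resolve_right hne,
    (hcross (flipAt i b) b hb1 (fun _ _ => rfl)).resolve_right hne.symm,
    hside X b p (fun _ _ => rfl) hX, hside Y b _ (fun _ _ => rfl) hY, hside X _ p hb1 hX,
    hside Y _ _ hb1 hY, ?_, ?_⟩ <;>
  · intro x hx j hj hy
    exact h x (Finset.mem_filter.1 hx).1 j (Finset.mem_of_mem_erase hj) (Finset.mem_filter.1 hy).1

/-- Induction on the dimension: a side that meets both sets is bounded by induction, and the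
diagonal pairs by `cross_split`. A single vertex together with all its non-neighbours of opposite
sign shows that the bound is sharp. -/
theorem cross_card {n : ℕ} {S : Finset ι} (hS : S.card = n + 1) {b : ι → Bool} {p : ℤˣ}
    {X Y : Finset (ι → Bool)} (hX : X ⊆ halfCube S b p) (hY : Y ⊆ halfCube S b (-p))
    (h : ∀ x ∈ X, ∀ j ∈ S, flipAt j x ∉ Y) (hX0 : 1 ≤ X.card) (hY0 : 1 ≤ Y.card) :
    X.card + Y.card + n ≤ 2 ^ n := by
  induction n generalizing S b X Y with
  | zero =>
    obtain ⟨i, rfl⟩ := Finset.card_eq_one.1 hS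
    obtain ⟨x, hx⟩ := Finset.card_pos.1 hX0
    obtain ⟨y, hy⟩ := Finset.card_pos.1 hY0
    have h1 := mem_halfCube.1 (hX hx)
    have h2 := mem_halfCube.1 (hY hy)
    have hne : y ≠ x := by
      rintro rfl
      exact sign_ne_iff.2 h2.2 h1.2
    refine (h x hx i (by simp) ?_).elim
    have : flipAt i x = y := by
      funext k
      by_cases hk : k = i
      · subst hk
        have : y k ≠ x k := fun e => hne (funext fun l => by
          by_cases hl : l = k
          · rw [hl, e]
          · rw [h1.1 l (by simpa using hl), h2.1 l (by simpa using hl)])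
        rw [flipAt_apply_self]
        revert this; cases y k <;> cases x k <;> simp
      · rw [flipAt_apply_of_ne hk, h1.1 k (by simpa using hk), h2.1 k (by simpa using hk)]
    rwa [this]
  | succ n ih =>
    obtain ⟨S', b₀, b₁, X₀, X₁, Y₀, Y₁, hS', cX, cY, c1, c2, x0, y0, x1, y1, e0, e1⟩ :=
      cross_split hS hX hY h
    have i0 : X₀.card = 0 ∨ Y₀.card = 0 ∨ X₀.card + Y₀.card + n ≤ 2 ^ n := by
      have := ih hS' x0 y0 e0; omega
    have i1 : X₁.card = 0 ∨ Y₁.card = 0 ∨ X₁.card + Y₁.card + n ≤ 2 ^ n := by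
      have := ih hS' x1 y1 e1; omega
    have hn : n < 2 ^ n := Nat.lt_two_pow_self
    rw [pow_succ]
    rcases n with _ | n
    · simp only [pow_zero] at *
      omega
    · omega

/-- Excluding singletons gains one over `cross_card`. Exactly this gain is needed in Hall's
condition for a matching of `n + 1` edges in dimension `n + 1`. -/
theorem cross_card_of_two_le {n : ℕ} (hn : 3 ≤ n) {S : Finset ι} (hS : S.card = n + 1)
    {b : ι → Bool} {p : ℤˣ} {X Y : Finset (ι → Bool)} (hX : X ⊆ halfCube S b p)
    (hY : Y ⊆ halfCube S b (-p)) (h : ∀ x ∈ X, ∀ j ∈ S, flipAt j x ∉ Y) (hX0 : 2 ≤ X.card)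
    (hY0 : 2 ≤ Y.card) : X.card + Y.card + (n + 1) ≤ 2 ^ n := by
  obtain ⟨n, rfl⟩ : ∃ m, n = m + 1 := ⟨n - 1, by omega⟩
  obtain ⟨S', b₀, b₁, X₀, X₁, Y₀, Y₁, hS', cX, cY, c1, c2, x0, y0, x1, y1, e0, e1⟩ :=
    cross_split hS hX hY h
  have i0 : X₀.card = 0 ∨ Y₀.card = 0 ∨ X₀.card + Y₀.card + n ≤ 2 ^ n := by
    have := cross_card hS' x0 y0 e0; omega
  have i1 : X₁.card = 0 ∨ Y₁.card = 0 ∨ X₁.card + Y₁.card + n ≤ 2 ^ n := by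
    have := cross_card hS' x1 y1 e1; omega
  have hn' : n + 2 ≤ 2 ^ n := by
    clear * - hn
    obtain ⟨k, rfl⟩ : ∃ k, n = k + 2 := ⟨n - 2, by omega⟩
    have : k < 2 ^ k := Nat.lt_two_pow_self
    rw [pow_add]; omega
  rw [pow_succ]
  omega

end Parity

/-! ### Hall's theorem and factorisations of regular subgraphs -/

section Hall

variable {ι : Type*} [DecidableEq ι] [Fintype ι]

/-- Hall's theorem for spanning subgraphs of the hypercube on the vertex set `U`. -/
theorem exists_matching_of_hall {U : Finset (ι → Bool)} {D : (ι → Bool) → Finset ι}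
    (hD : ∀ v ∈ U, ∀ j ∈ D v, j ∈ D (flipAt j v) ∧ flipAt j v ∈ U)
    (hU : (U.filter fun v => vsign v = -1).card ≤ (U.filter fun v => vsign v = 1).card)
    (hall : ∀ A ⊆ U.filter fun v => vsign v = 1,
      A.card ≤ (A.biUnion fun v => (D v).image fun j => flipAt j v).card) (i₀ : ι) :
    ∃ m : (ι → Bool) → ι, ∀ v ∈ U, m v ∈ D v ∧ m (flipAt (m v) v) = m v := by
  classical
  set U₀ := U.filter fun v => vsign v = 1 with hU₀
  set U₁ := U.filter fun v => vsign v = -1 with hU₁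
  obtain ⟨f, hf, hfD⟩ := (Finset.all_card_le_biUnion_card_iff_exists_injective
    (fun v : U₀ => (D v.1).image fun j => flipAt j v.1)).1 fun A => by
      have := hall (A.image Subtype.val) (fun v hv => by
        obtain ⟨w, -, rfl⟩ := Finset.mem_image.1 hv; exact w.2)
      rw [Finset.card_image_of_injective _ Subtype.val_injective, Finset.image_biUnion] at this
      exact this
  choose! a haD ha using fun v : U₀ => Finset.mem_image.1 (hfD v)
  have hf1 : ∀ v, f v ∈ U₁ := fun v => by
    have h0 := Finset.mem_filter.1 v.2
    rw [← ha v]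
    refine Finset.mem_filter.2 ⟨(hD v h0.1 _ (haD v)).2, ?_⟩
    rw [vsign_flipAt, h0.2]
  -- By `hU` the injection from Hall's theorem is onto.
  have himg : Finset.univ.image f = U₁ := by
    refine Finset.eq_of_subset_of_card_le (fun w hw => ?_) ?_
    · obtain ⟨v, -, rfl⟩ := Finset.mem_image.1 hw; exact hf1 v
    · rw [Finset.card_image_of_injective _ hf, Finset.card_univ, Fintype.card_coe]; exact hU
  let m : (ι → Bool) → ι := fun v =>
    if h : v ∈ U₀ then a ⟨v, h⟩ else if h : ∃ w, f w = v then a h.choose else i₀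
  have m0 : ∀ v : U₀, m v = a v := fun v => by simp [m, v.2]
  have m1 : ∀ v : U₀, m (f v) = a v := fun v => by
    have h1 : f v ∉ U₀ := fun h => by
      have e1 := (Finset.mem_filter.1 h).2
      have e2 := (Finset.mem_filter.1 (hf1 v)).2
      rw [e1] at e2
      exact absurd e2 (by decide)
    have h : ∃ w, f w = f v := ⟨v, rfl⟩
    simp only [m, h1, h, dif_pos, dif_neg, not_false_eq_true]
    rw [hf h.choose_spec]
  refine ⟨m, fun v hv => ?_⟩
  by_cases hs : vsign v = 1
  · have hv0 : v ∈ U₀ := Finset.mem_filter.2 ⟨hv, hs⟩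
    have e := m0 ⟨v, hv0⟩
    have e1 := m1 ⟨v, hv0⟩
    rw [← ha ⟨v, hv0⟩] at e1
    simp only at e e1
    rw [e]
    exact ⟨haD ⟨v, hv0⟩, e1⟩
  · have hv1 : v ∈ U₁ := Finset.mem_filter.2 ⟨hv, sign_ne_iff.1 hs⟩
    rw [← himg] at hv1
    obtain ⟨w, -, rfl⟩ := Finset.mem_image.1 hv1
    rw [m1 w, ← ha w, flipAt_flipAt, m0]
    exact ⟨(hD w (Finset.mem_filter.1 w.2).1 _ (haD w)).1, rfl⟩

theorem card_sign_eq (i : ι) :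
    ((Finset.univ : Finset (ι → Bool)).filter fun v => vsign v = -1).card =
      ((Finset.univ : Finset (ι → Bool)).filter fun v => vsign v = 1).card := by
  refine Finset.card_bij (fun v _ => flipAt i v) (fun v hv => ?_) (fun v _ w _ e => (flipAt_inj i).1 e)
    fun v hv => ⟨flipAt i v, ?_, by simp⟩ <;>
  · simp only [Finset.mem_filter, Finset.mem_univ, true_and] at hv ⊢
    rw [vsign_flipAt, hv]
    try simp

/-- A regular spanning subgraph of the hypercube has a perfect matching. -/
theorem exists_matching_of_regular {k : ℕ} {D : (ι → Bool) → Finset ι}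
    (hcard : ∀ v, (D v).card = k + 1) (hD : ∀ v, ∀ j ∈ D v, j ∈ D (flipAt j v)) :
    ∃ m : (ι → Bool) → ι, ∀ v, m v ∈ D v ∧ m (flipAt (m v) v) = m v := by
  classical
  obtain ⟨i₀, -⟩ : (D fun _ => true).Nonempty := Finset.card_pos.1 (by rw [hcard]; omega)
  obtain ⟨m, hm⟩ := exists_matching_of_hall (U := Finset.univ) (D := D)
    (fun v _ j hj => ⟨hD v j hj, Finset.mem_univ _⟩) (card_sign_eq i₀).le (fun A _ => by
      -- Double counting of the edges between `A` and its neighbourhood, all degrees being `k + 1`.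
      have := Finset.card_mul_le_card_mul (s := A) (m := k + 1) (n := k + 1)
        (t := A.biUnion fun v => (D v).image fun j => flipAt j v)
        (fun v w => ∃ j ∈ D v, flipAt j v = w) (fun v hv => ?_) (fun w hw => ?_)
      · exact Nat.le_of_mul_le_mul_right this (by omega)
      · rw [← hcard v, ← Finset.card_image_of_injOn (s := D v) (f := fun j => flipAt j v)
          (fun a _ b _ e => flipAt_eq_flipAt.1 e)]
        refine Finset.card_le_card fun w hw => ?_
        rw [Finset.mem_bipartiteAbove]
        exact ⟨Finset.mem_biUnion.2 ⟨v, hv, hw⟩, Finset.mem_image.1 hw⟩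
      · rw [← hcard w]
        refine le_trans (Finset.card_le_card (t := (D w).image fun j => flipAt j w) ?_)
          Finset.card_image_le
        intro v hv
        rw [Finset.mem_bipartiteBelow] at hv
        obtain ⟨-, j, hj, rfl⟩ := hv
        exact Finset.mem_image.2 ⟨j, hD v j hj, by simp⟩) i₀
  exact ⟨m, fun v => hm v (Finset.mem_univ _)⟩

/-- A regular spanning subgraph of the hypercube has a proper edge colouring. -/
theorem exists_coloring_of_regular {C : Type*} [DecidableEq C] {k : ℕ}
    {D : (ι → Bool) → Finset ι} (hcard : ∀ v, (D v).card = k)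
    (hD : ∀ v, ∀ j ∈ D v, j ∈ D (flipAt j v)) {T : Finset C} (hT : T.card = k) (c₀ : C) :
    ∃ f : (ι → Bool) → ι → C, ∀ v, ∀ j ∈ D v, f v j ∈ T ∧ f (flipAt j v) j = f v j ∧
      ∀ l ∈ D v, f v j = f v l → j = l := by
  induction k generalizing D T with
  | zero => exact ⟨fun _ _ => c₀, fun v j hj => by simp [Finset.card_eq_zero.1 (hcard v)] at hj⟩
  | succ k ih =>
    obtain ⟨m, hm⟩ := exists_matching_of_regular hcard hD
    obtain ⟨c, hc⟩ : T.Nonempty := Finset.card_pos.1 (by omega)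
    obtain ⟨f, hf⟩ := ih (D := fun v => (D v).erase (m v)) (T := T.erase c)
      (fun v => by rw [Finset.card_erase_of_mem (hm v).1, hcard]; rfl)
      (fun v j hj => by
        rw [Finset.mem_erase] at hj ⊢
        refine ⟨fun e => hj.1 ?_, hD v j hj.2⟩
        have := (hm (flipAt j v)).2
        rw [← e, flipAt_flipAt] at this
        exact this.symm)
      (by rw [Finset.card_erase_of_mem hc, hT]; rfl)
    refine ⟨fun v j => if j = m v then c else f v j, fun v j hj => ?_⟩
    by_cases hjm : j = m v
    · subst hjm
      refine ⟨by simp [hc], by simp [(hm v).2], fun l hl e => ?_⟩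
      by_contra hne
      have := (hf v l (Finset.mem_erase.2 ⟨Ne.symm hne, hl⟩)).1
      simp only [if_true, Ne.symm hne, if_false] at e
      exact (Finset.mem_erase.1 this).1 e.symm
    · have h := hf v j (Finset.mem_erase.2 ⟨hjm, hj⟩)
      have hjm' : j ≠ m (flipAt j v) := fun e => hjm (by
        have := (hm (flipAt j v)).2
        rw [← e, flipAt_flipAt] at this
        exact this.symm)
      refine ⟨by simpa [hjm] using Finset.mem_of_mem_erase h.1, by simp [hjm, hjm', h.2.1],
        fun l hl e => ?_⟩
      by_cases hl' : l = m v
      · simp only [hjm, hl', if_true, if_false] at e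
        exact ((Finset.mem_erase.1 h.1).1 e).elim
      · simp only [hjm, hl', if_false] at e
        exact h.2.2 l (Finset.mem_erase.2 ⟨hl', hl⟩) e

/-- A perfect matching is a colour class of a proper edge colouring. -/
theorem exists_isCol_of_matching {C : Type*} [DecidableEq C] {S : Finset ι} {T : Finset C}
    (hST : S.card = T.card) {m : (ι → Bool) → ι}
    (hm : ∀ v, m v ∈ S ∧ m (flipAt (m v) v) = m v) {c : C} (hc : c ∈ T) :
    ∃ f, IsCol S T f ∧ ∀ v, f v (m v) = c := by
  have hm' : ∀ v j, j ≠ m v → j ≠ m (flipAt j v) := fun v j hj e => hj (by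
    have := (hm (flipAt j v)).2
    rw [← e, flipAt_flipAt] at this
    exact this.symm)
  obtain ⟨f, hf⟩ := exists_coloring_of_regular (D := fun v => S.erase (m v)) (k := S.card - 1)
    (fun v => Finset.card_erase_of_mem (hm v).1)
    (fun v j hj => by
      rw [Finset.mem_erase] at hj ⊢
      exact ⟨hm' v j hj.1, hj.2⟩) (T := T.erase c)
    (by rw [Finset.card_erase_of_mem hc, hST]) c
  refine ⟨fun v j => if j = m v then c else f v j, ⟨fun v j hj => ?_, fun v j hj => ?_,
    fun v j hj k hk e => ?_⟩, fun v => by simp⟩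
  · by_cases h : j = m v
    · simp [h, hc]
    · simpa [h] using Finset.mem_of_mem_erase (hf v j (Finset.mem_erase.2 ⟨h, hj⟩)).1
  · by_cases h : j = m v
    · subst h; simp [(hm v).2]
    · simpa [h, hm' v j h] using (hf v j (Finset.mem_erase.2 ⟨h, hj⟩)).2.1
  · by_cases h : j = m v <;> by_cases h' : k = m v
    · rw [h, h']
    · simp only [h, h', if_true, if_false] at e
      exact ((Finset.mem_erase.1 (hf v k (Finset.mem_erase.2 ⟨h', hk⟩)).1).1 e.symm).elim
    · simp only [h, h', if_true, if_false] at e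
      exact ((Finset.mem_erase.1 (hf v j (Finset.mem_erase.2 ⟨h, hj⟩)).1).1 e).elim
    · simp only [h, h', if_false] at e
      exact (hf v j (Finset.mem_erase.2 ⟨h, hj⟩)).2.2 k (Finset.mem_erase.2 ⟨h', hk⟩) e

end Hall

/-! ### Perfect matchings that contain given edges -/

section Matching

variable {ι C : Type*} [DecidableEq ι] [Fintype ι] [DecidableEq C] {S : Finset ι} {c : C}
  {M : Finset (Entry ι C)}

/-- Hall's theorem on the vertices left unmatched by `M`, with the edges of `F` forbidden. If Hall's
condition fails for `A`, let `A'` be the unmatched negative vertices outside its neighbourhood. All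
edges between `A` and `A'` lie in `F`, and `|A| + |A'|` exceeds `2 ^ n - |M|`, against `hcross`. If
`A` or `A'` has fewer than two elements, failure would mean a vertex without a usable neighbour,
which `hfree` excludes. -/
theorem exists_matching_of_cross {n : ℕ} (hS : S.card = n + 1) {b : ι → Bool}
    (hM : Good S {c} M) (hb : ∀ t ∈ M, ∀ i, i ∉ S → t.1 i = b i)
    {F : (ι → Bool) → ι → Prop} (hF : ∀ v j, F v j → F (flipAt j v) j)
    (hfree : ∀ u, (∀ i, i ∉ S → u i = b i) → (∀ k, ¬ Has M u k c) →
      ∃ j ∈ S, ¬ F u j ∧ ∀ k, ¬ Has M (flipAt j u) k c)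
    (hcross : ∀ X Y : Finset (ι → Bool), X ⊆ halfCube S b 1 → Y ⊆ halfCube S b (-1) →
      2 ≤ X.card → 2 ≤ Y.card → (∀ x ∈ X, ∀ j ∈ S, flipAt j x ∈ Y → F x j) →
      X.card + Y.card + M.card ≤ 2 ^ n) :
    ∃ m : (ι → Bool) → ι, (∀ v, m v ∈ S ∧ m (flipAt (m v) v) = m v) ∧
      (∀ t ∈ M, m t.1 = t.2.1) ∧
      ∀ v, (∀ i, i ∉ S → v i = b i) → (∀ k, ¬ Has M v k c) → ¬ F v (m v) := by
  classical
  obtain ⟨i₀, hi₀⟩ : S.Nonempty := Finset.card_pos.1 (by omega)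
  have : Nonempty ι := ⟨i₀⟩
  have uniq : ∀ {v j k}, Has M v j c → Has M v k c → j = k := fun h1 h2 => (hM.proper h1 h2).2 rfl
  set K : (ι → Bool) → Prop := fun v => ∀ i, i ∉ S → v i = b i with hK
  have Kflip : ∀ {v j}, j ∈ S → K v → K (flipAt j v) := fun {v j} hj h i hi => by
    rw [flipAt_apply_of_ne (by rintro rfl; exact hi hj), h i hi]
  have Khas : ∀ {v j}, Has M v j c → K v := fun {v j} h => by
    obtain ⟨t, ht, rfl, -, rfl | rfl⟩ := h
    · exact hb t ht
    · exact Kflip (hM.dir t ht) (hb t ht)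
  set τ : (ι → Bool) → Prop := fun v => ∃ k, Has M v k c with hτ
  have hU : ∀ p : ℤˣ, (halfCube S b p).card =
      ((halfCube S b p).filter τ).card + ((halfCube S b p).filter fun v => ¬ τ v).card := fun p =>
    (Finset.card_filter_add_card_filter_not _).symm
  -- Every edge of `M` covers one vertex of each sign, so the unmatched vertices stay balanced.
  have hτcard : ((halfCube S b 1).filter τ).card = ((halfCube S b (-1)).filter τ).card := by
    choose! k hk using fun (v : ι → Bool) (h : τ v) => h
    have : ∀ p : ℤˣ, ((halfCube S b p).filter τ).card ≤ ((halfCube S b (-p)).filter τ).card := by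
      intro p
      refine Finset.card_le_card_of_injOn (fun v => flipAt (k v) v) (fun v hv => ?_) ?_
      · have hv := Finset.mem_filter.1 (Finset.mem_coe.1 hv)
        have h := hk v hv.2
        exact Finset.mem_coe.2 (Finset.mem_filter.2
          ⟨flipAt_mem_halfCube (hM.dir_mem h) hv.1, ⟨_, h.symm⟩⟩)
      · intro v hv w hw e
        have h1 := hk v (Finset.mem_filter.1 (Finset.mem_coe.1 hv)).2
        have h2 := hk w (Finset.mem_filter.1 (Finset.mem_coe.1 hw)).2
        simp only at e
        have e2 := uniq h1.symm (e ▸ h2.symm)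
        rw [← e2] at e
        exact (flipAt_inj _).1 e
    exact le_antisymm (this 1) (by simpa using this (-1))
  have hτM : ((halfCube S b (-1)).filter τ).card ≤ M.card := by
    refine le_trans (Finset.card_le_card (t := M.image fun t =>
      if vsign t.1 = -1 then t.1 else flipAt t.2.1 t.1) fun v hv => ?_) Finset.card_image_le
    rw [Finset.mem_filter, mem_halfCube] at hv
    obtain ⟨⟨-, hv⟩, j, t, ht, -, -, rfl | rfl⟩ := hv
    · exact Finset.mem_image.2 ⟨t, ht, if_pos hv⟩
    · refine Finset.mem_image.2 ⟨t, ht, if_neg fun e => ?_⟩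
      rw [vsign_flipAt, e] at hv
      exact absurd hv (by decide)
  set U : Finset (ι → Bool) := Finset.univ.filter fun v => K v ∧ ¬ τ v with hUdef
  have hUp : ∀ p : ℤˣ, (U.filter fun v => vsign v = p) = (halfCube S b p).filter fun v => ¬ τ v := by
    intro p
    ext v
    simp only [U, Finset.mem_filter, Finset.mem_univ, true_and, mem_halfCube, hK]
    tauto
  have c1 := hU 1
  have c2 := hU (-1)
  rw [card_halfCube hS] at c1 c2
  set D : (ι → Bool) → Finset ι := fun v => S.filter fun j => flipAt j v ∈ U ∧ ¬ F v j with hDdef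
  have memU : ∀ {v}, v ∈ U ↔ K v ∧ ¬ τ v := by intro v; simp [U]
  have memD : ∀ {v j}, j ∈ D v ↔ j ∈ S ∧ flipAt j v ∈ U ∧ ¬ F v j := by intro v j; simp [D]
  have Dne : ∀ u ∈ U, ∃ j, j ∈ D u := fun u hu => by
    obtain ⟨h1, h2⟩ := memU.1 hu
    obtain ⟨j, hj, hjF, hj'⟩ := hfree u h1 (fun k hk => h2 ⟨k, hk⟩)
    exact ⟨j, memD.2 ⟨hj, memU.2 ⟨Kflip hj h1, fun ⟨k, hk⟩ => hj' k hk⟩, hjF⟩⟩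
  have hD : ∀ v ∈ U, ∀ j ∈ D v, j ∈ D (flipAt j v) ∧ flipAt j v ∈ U := fun v hv j hj => by
    obtain ⟨h1, h2, h3⟩ := memD.1 hj
    exact ⟨memD.2 ⟨h1, by rwa [flipAt_flipAt], fun h => h3 (by simpa using hF _ _ h)⟩, h2⟩
  have hcard : (U.filter fun v => vsign v = -1).card = (U.filter fun v => vsign v = 1).card := by
    rw [hUp, hUp]; omega
  obtain ⟨m, hm⟩ := exists_matching_of_hall (U := U) (D := D) hD hcard.le (fun A hA => by
    set N := A.biUnion fun v => (D v).image fun j => flipAt j v with hN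
    have memN : ∀ {w}, w ∈ N ↔ ∃ v ∈ A, ∃ j ∈ D v, flipAt j v = w := by
      intro w; simp [N]
    have hA' := hA
    rw [hUp] at hA'
    have AU : ∀ v ∈ A, v ∈ U ∧ vsign v = 1 := fun v hv => Finset.mem_filter.1 (hA hv)
    have hNU : N ⊆ U.filter fun v => vsign v = -1 := fun w hw => by
      obtain ⟨v, hv, j, hj, rfl⟩ := memN.1 hw
      exact Finset.mem_filter.2 ⟨(hD v (AU v hv).1 j hj).2, by rw [vsign_flipAt, (AU v hv).2]⟩
    set A' := (U.filter fun v => vsign v = -1) \ N with hA'def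
    have hcA' : A'.card + N.card = (U.filter fun v => vsign v = -1).card :=
      Finset.card_sdiff_add_card_eq_card hNU
    have hAle := Finset.card_le_card hA
    rcases Nat.lt_or_ge A.card 2 with hA2 | hA2
    · rcases A.eq_empty_or_nonempty with h0 | ⟨v, hv⟩
      · simp [h0]
      · obtain ⟨j, hj⟩ := Dne v (AU v hv).1
        have : 0 < N.card := Finset.card_pos.2 ⟨_, memN.2 ⟨v, hv, j, hj, rfl⟩⟩
        omega
    rcases Nat.lt_or_ge A'.card 2 with hB2 | hB2
    · rcases A'.eq_empty_or_nonempty with h0 | ⟨w, hw⟩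
      · rw [h0, Finset.card_empty] at hcA'
        omega
      · have hw' := Finset.mem_sdiff.1 hw
        have hwU := Finset.mem_filter.1 hw'.1
        obtain ⟨j, hj⟩ := Dne w hwU.1
        have h1 := hD w hwU.1 j hj
        have : A.card < (U.filter fun v => vsign v = 1).card := by
          refine Finset.card_lt_card ((Finset.ssubset_iff_of_subset hA).2 ⟨flipAt j w, ?_, ?_⟩)
          · exact Finset.mem_filter.2 ⟨h1.2, by rw [vsign_flipAt, hwU.2, neg_neg]⟩
          · exact fun h => hw'.2 (memN.2 ⟨_, h, j, h1.1, flipAt_flipAt j w⟩)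
        omega
    have := hcross A A' (fun v hv => (Finset.mem_filter.1 (hA' hv)).1) (fun w hw => by
        have := (Finset.mem_sdiff.1 hw).1
        rw [hUp] at this
        exact (Finset.mem_filter.1 this).1) hA2 hB2 (fun x hx j hj hjx => by
        by_contra hFx
        have h := Finset.mem_sdiff.1 hjx
        exact h.2 (memN.2 ⟨x, hx, j, memD.2 ⟨hj, (Finset.mem_filter.1 h.1).1, hFx⟩, rfl⟩))
    have e1 : (U.filter fun v => vsign v = -1).card =
      ((halfCube S b (-1)).filter fun v => ¬ τ v).card := by rw [hUp]
    omega) i₀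
  choose! k hk using fun (v : ι → Bool) (h : τ v) => h
  -- The other components are simply matched along `i₀`.
  refine ⟨fun v => if τ v then k v else if K v then m v else i₀, fun v => ?_, fun t ht => ?_,
    fun v hv hv' => ?_⟩
  · by_cases h1 : τ v
    · have h2 := hk v h1
      have h3 : τ (flipAt (k v) v) := ⟨_, h2.symm⟩
      simp only [h1, if_true, h3]
      exact ⟨hM.dir_mem h2, uniq (hk _ h3) h2.symm⟩
    · by_cases h2 : K v
      · have h3 := hm v (memU.2 ⟨h2, h1⟩)
        have h4 := memD.1 h3.1
        have h5 := memU.1 h4.2.1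
        simp only [h1, h2, if_true, if_false, h5.1, h5.2]
        exact ⟨h4.1, h3.2⟩
      · have h3 : ¬ K (flipAt i₀ v) := fun h => h2 (by simpa using Kflip hi₀ h)
        have h4 : ¬ τ (flipAt i₀ v) := fun ⟨_, h⟩ => h3 (Khas h)
        simp only [h1, h2, if_false, h3, h4]
        exact ⟨hi₀, trivial⟩
  · have hc := hM.col t ht
    rw [Finset.mem_singleton] at hc
    have h1 : Has M t.1 t.2.1 c := hc ▸ has_of_mem ht
    have h2 : τ t.1 := ⟨_, h1⟩
    simp only [h2, if_true]
    exact uniq (hk _ h2) h1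
  · have h1 : ¬ τ v := fun ⟨k, h⟩ => hv' k h
    simp only [h1, if_false, show K v from hv, if_true]
    exact (memD.1 (hm v (memU.2 ⟨hv, h1⟩)).1).2.2

/-- A matching of at most `n` edges of the `n`-dimensional hypercube that leaves no vertex
without a free neighbour extends to a perfect matching. -/
theorem exists_matching_of_free {n : ℕ} (hn : 3 ≤ n) (hS : S.card = n + 1) {b : ι → Bool}
    (hM : Good S {c} M) (hb : ∀ t ∈ M, ∀ i, i ∉ S → t.1 i = b i) (hcard : M.card ≤ n + 1)
    (hfree : ∀ u, (∀ i, i ∉ S → u i = b i) → (∀ k, ¬ Has M u k c) →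
      ∃ j ∈ S, ∀ k, ¬ Has M (flipAt j u) k c) :
    ∃ m : (ι → Bool) → ι, (∀ v, m v ∈ S ∧ m (flipAt (m v) v) = m v) ∧
      ∀ t ∈ M, m t.1 = t.2.1 := by
  obtain ⟨m, h1, h2, -⟩ := exists_matching_of_cross (F := fun _ _ => False) hS hM hb
    (fun _ _ h => h) (fun u h h' => by simpa using hfree u h h')
    (fun X Y hX hY h1 h2 h => by
      have := cross_card_of_two_le hn hS hX hY h h1 h2
      omega)
  exact ⟨m, h1, h2⟩

/-- The same with one fewer edge in the matching and one edge that has to be avoided. -/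
theorem exists_matching_of_free_avoiding {n : ℕ} (hn : 3 ≤ n) (hS : S.card = n + 1)
    (hM : Good S {c} M) {y : ι → Bool} {a : ι} (ha : a ∈ S)
    (hb : ∀ t ∈ M, ∀ i, i ∉ S → t.1 i = y i) (hcard : M.card ≤ n) (hy : ∀ k, ¬ Has M y k c)
    (hfree : ∀ u, (∀ i, i ∉ S → u i = y i) → (∀ k, ¬ Has M u k c) →
      ∃ j ∈ S, ¬ (j = a ∧ (u = y ∨ u = flipAt a y)) ∧ ∀ k, ¬ Has M (flipAt j u) k c) :
    ∃ m : (ι → Bool) → ι, (∀ v, m v ∈ S ∧ m (flipAt (m v) v) = m v) ∧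
      (∀ t ∈ M, m t.1 = t.2.1) ∧ m y ≠ a := by
  obtain ⟨m, h1, h2, h3⟩ := exists_matching_of_cross
    (F := fun u j => j = a ∧ (u = y ∨ u = flipAt a y)) hS hM hb
    (fun v j h => by obtain ⟨rfl, rfl | rfl⟩ := h <;> simp) hfree
    (fun X Y hX hY h1 h2 h => by
      -- Only the forbidden edge can join `X` to `Y`. Removing one of its ends from a set with at
      -- least three elements costs one, which is compensated by `|M| ≤ n`. If both sets have two
      -- elements, this numerical inequality suffices.
      have hn' : n + 5 ≤ 2 ^ n + 1 := by
        clear * - hn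
        obtain ⟨k, rfl⟩ : ∃ k, n = k + 3 := ⟨n - 3, by omega⟩
        have : k < 2 ^ k := Nat.lt_two_pow_self
        rw [pow_add]; omega
      have key : ∀ z ∈ ({y, flipAt a y} : Finset (ι → Bool)),
          ∀ x ∈ X, ∀ j ∈ S, flipAt j x ∈ Y → x = z ∨ flipAt j x = z := by
        intro z hz x hx j hj hxy
        obtain ⟨rfl, h⟩ := h x hx j hj hxy
        simp only [Finset.mem_insert, Finset.mem_singleton] at hz
        rcases hz with rfl | rfl <;> rcases h with rfl | rfl <;> simp
      by_cases hyX : ∃ z ∈ ({y, flipAt a y} : Finset (ι → Bool)), z ∈ X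
      · obtain ⟨z, hz, hzX⟩ := hyX
        rcases Nat.lt_or_ge X.card 3 with hX3 | hX3
        · rcases Nat.lt_or_ge Y.card 3 with hY3 | hY3
          · omega
          · by_cases hzY : ∃ z ∈ ({y, flipAt a y} : Finset (ι → Bool)), z ∈ Y
            · obtain ⟨w, hw, hwY⟩ := hzY
              have e := Finset.card_erase_of_mem hwY
              have := cross_card_of_two_le hn hS hX ((Finset.erase_subset w Y).trans hY)
                (fun x hx j hj hxy => by
                  obtain ⟨h5, h6⟩ := Finset.mem_erase.1 hxy
                  rcases key w hw x hx j hj h6 with h7 | h7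
                  · have s1 := (mem_halfCube.1 (hX hx)).2
                    have s2 := (mem_halfCube.1 (hY hwY)).2
                    rw [← h7, s1] at s2
                    exact absurd s2 (by decide)
                  · exact h5 h7) h1 (by omega)
              omega
            · have := cross_card_of_two_le hn hS hX hY (fun x hx j hj hxy => by
                obtain ⟨rfl, h5⟩ := h x hx j hj hxy
                refine hzY ⟨_, ?_, hxy⟩
                rcases h5 with rfl | rfl <;> simp) h1 h2
              omega
        · have e := Finset.card_erase_of_mem hzX
          have := cross_card_of_two_le hn hS ((Finset.erase_subset z X).trans hX) hY
            (fun x hx j hj hxy => by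
              obtain ⟨h5, h6⟩ := Finset.mem_erase.1 hx
              rcases key z hz x h6 j hj hxy with h7 | h7
              · exact h5 h7
              · have s1 := (mem_halfCube.1 (hX hzX)).2
                have s2 := (mem_halfCube.1 (hY hxy)).2
                rw [h7, s1] at s2
                exact absurd s2 (by decide)) (by omega) h2
          omega
      · have := cross_card_of_two_le hn hS hX hY (fun x hx j hj hxy => by
          obtain ⟨rfl, h5⟩ := h x hx j hj hxy
          refine hyX ⟨x, ?_, hx⟩
          rcases h5 with rfl | rfl <;> simp) h1 h2
        omega)
  exact ⟨m, h1, h2, fun e => h3 y (fun _ _ => rfl) hy ⟨e, Or.inl rfl⟩⟩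

end Matching

/-! ### Precolourings that consist of a star and a colour class -/

section Star

variable {ι C : Type*} [DecidableEq ι] [Fintype ι] [DecidableEq C] {S : Finset ι} {T : Finset C}
  {P : Finset (Entry ι C)}

/-- A precolouring of at most `n` edges that is not blocked extends, if all edges of colours other
than `c` are incident with a vertex `u`. -/
theorem extends_of_star {n : ℕ} (hn : 4 ≤ n) (hS : S.card = n) (hT : T.card = n) (hP : Good S T P)
    (hPn : P.card ≤ n) (hblk : ¬ Blk S T P) {u : ι → Bool} {c : C}
    (h : ∀ t ∈ P, Touch t u ∨ t.2.2 = c) : Extends S T P := by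
  obtain ⟨n, rfl⟩ : ∃ m, n = m + 1 := ⟨n - 1, by omega⟩
  by_cases hlt : P.card < n + 1
  · exact extends_of_card_lt hS hT hP hlt
  by_cases hcomp : ∀ t ∈ P, ∀ t' ∈ P, ∀ i, i ∉ S → t.1 i = t'.1 i
  swap
  · push Not at hcomp
    obtain ⟨t, ht, t', ht', i, hi, hne⟩ := hcomp
    exact extends_of_components hS hT hP hPn ht ht' hi hne
  -- If `c` does not occur, all entries are at `u`, and any color that occurs can take its place.
  obtain ⟨c, t₀, ht₀, hc₀, h⟩ : ∃ c, ∃ t₀ ∈ P, t₀.2.2 = c ∧ ∀ t ∈ P, Touch t u ∨ t.2.2 = c := by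
    by_cases hcP : ∃ t ∈ P, t.2.2 = c
    · obtain ⟨t₀, ht₀, hc₀⟩ := hcP
      exact ⟨c, t₀, ht₀, hc₀, h⟩
    · obtain ⟨t₀, ht₀⟩ : P.Nonempty := Finset.card_pos.1 (by omega)
      exact ⟨_, t₀, ht₀, rfl, fun t ht => Or.inl ((h t ht).resolve_right fun e => hcP ⟨t, ht, e⟩)⟩
  have hcT : c ∈ T := hc₀ ▸ hP.col _ ht₀
  set M := P.filter fun t => t.2.2 = c with hMdef
  have hMP : M ⊆ P := Finset.filter_subset _ _
  have memM : ∀ {t}, t ∈ M ↔ t ∈ P ∧ t.2.2 = c := Finset.mem_filter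
  have hM : Good S {c} M := (hP.mono hMP).weaken (fun t ht => hP.dir t (hMP ht))
    fun t ht => by simp [(memM.1 ht).2]
  have hasM : ∀ {v j}, Has P v j c → Has M v j c := fun ⟨t, ht, e1, e2, e3⟩ =>
    ⟨t, memM.2 ⟨ht, e2⟩, e1, e2, e3⟩
  have colM : ∀ {v j x}, Has M v j x → x = c := fun ⟨t, ht, _, e2, _⟩ => e2.symm.trans (memM.1 ht).2
  have hcardM := Finset.card_filter_add_card_filter_not (s := P) (fun t : Entry ι C => t.2.2 = c)
  rw [← hMdef] at hcardM
  -- Only the color `c` has to be right. The entries of other colors are all at `u`, where distinct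
  -- directions receive distinct colors, so a permutation of the colors does the rest.
  have finish : ∀ f, IsCol S T f → (∀ t ∈ M, f t.1 t.2.1 = c) →
      (∀ t ∈ P, t.2.2 ≠ c → f u t.2.1 ≠ c) → Extends S T P := by
    intro f hf h1 h2
    have hu : ∀ t ∈ P, t.2.2 ≠ c → f t.1 t.2.1 = f u t.2.1 ∧ Touch t u := fun t ht hne => by
      have h3 := (h t ht).resolve_right hne
      refine ⟨?_, h3⟩
      rcases h3 with rfl | rfl
      · rfl
      · rw [hf.symm _ _ (hP.dir t ht)]
    refine hf.extends_of_pattern hP fun t ht t' ht' => ?_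
    by_cases e : t.2.2 = c <;> by_cases e' : t'.2.2 = c
    · rw [h1 t (memM.2 ⟨ht, e⟩), h1 t' (memM.2 ⟨ht', e'⟩), e, e']
    · rw [h1 t (memM.2 ⟨ht, e⟩), e, (hu t' ht' e').1]
      exact ⟨fun h => (h2 t' ht' e' h.symm).elim, fun h => (e' h.symm).elim⟩
    · rw [h1 t' (memM.2 ⟨ht', e'⟩), e', (hu t ht e).1]
      exact ⟨fun h => (h2 t ht e h).elim, fun h => (e h).elim⟩
    · obtain ⟨k1, k2⟩ := hu t ht e
      obtain ⟨k3, k4⟩ := hu t' ht' e'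
      rw [k1, k3, ← hP.proper (has_of_touch ht k2) (has_of_touch ht' k4)]
      exact ⟨hf.inj u _ (hP.dir t ht) _ (hP.dir t' ht'), fun e => by rw [e]⟩
  have matched : ∀ m : (ι → Bool) → ι, (∀ v, m v ∈ S ∧ m (flipAt (m v) v) = m v) →
      (∀ t ∈ M, m t.1 = t.2.1) → (∀ t ∈ P, t.2.2 ≠ c → m u ≠ t.2.1) → Extends S T P := by
    intro m h1 h2 h3
    obtain ⟨f, hf, hfm⟩ := exists_isCol_of_matching (hS.trans hT.symm) h1 hcT
    refine finish f hf (fun t ht => by rw [← h2 t ht, hfm]) fun t ht hne e => h3 t ht hne ?_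
    exact hf.inj u _ (h1 u).1 _ (hP.dir t ht) ((hfm u).trans e.symm)
  -- Once `c` is fixed at `u` in a direction of its own, the other entries at `u` avoid `c`
  -- automatically.
  have extM : ∀ Q, Good S T Q → M ⊆ Q → Q.card < n + 1 → (∃ j, Has Q u j c ∧
      ∀ t ∈ P, t.2.2 ≠ c → t.2.1 ≠ j) → Extends S T P := by
    rintro Q hQ hMQ hQn ⟨j, hj, hjP⟩
    obtain ⟨f, hf, hfQ⟩ := extends_of_card_lt hS hT hQ hQn
    refine finish f hf (fun t ht => ?_) fun t ht hne e => hjP t ht hne ?_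
    · rw [hfQ t (hMQ ht), (memM.1 ht).2]
    · exact hf.inj u _ (hP.dir t ht) _ (hQ.dir_mem hj) (e.trans (hf.eq_of_has hQ hfQ hj).symm)
  rcases Nat.eq_zero_or_pos (P.filter fun t => ¬ t.2.2 = c).card with hK | hK
  · have hall : ∀ t ∈ P, t.2.2 = c := fun t ht => by
      by_contra hne
      exact (Finset.card_pos.2 ⟨t, Finset.mem_filter.2 ⟨ht, hne⟩⟩).ne' hK
    obtain ⟨m, h1, h2⟩ := exists_matching_of_free (n := n) (b := t₀.1) (by omega) hS hM
      (fun t ht => hcomp t (hMP ht) t₀ ht₀) (by omega) (fun w _ hw => by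
        by_contra hcon
        push Not at hcon
        refine hblk ⟨w, c, hcT, fun k hk => hw k (hasM hk), fun j hj => Or.inr ?_⟩
        obtain ⟨k, hk⟩ := hcon j hj
        exact ⟨k, hk.mono hMP⟩)
    exact matched m h1 h2 fun t ht hne => (hne (hall t ht)).elim
  by_cases hu : ∃ j, Has P u j c
  · obtain ⟨j, hj⟩ := hu
    refine extM M (hP.mono hMP) subset_rfl (by omega) ⟨j, hasM hj, fun t ht hne e => hne ?_⟩
    exact ((hP.proper hj (has_of_touch ht ((h t ht).resolve_right hne))).1 e.symm).symm
  push Not at hu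
  have huM : ∀ k, ¬ Has M u k c := fun k hk => hu k (hk.mono hMP)
  -- With a single entry `g` of another colour, `M` plus one more entry would already be `n + 1`,
  -- too many for `extends_of_card_lt`; hence the matching theorem that avoids one edge. With two or
  -- more there is room for an entry of color `c` at `u`, in a direction that exists because `u` is
  -- not blocked.
  rcases Nat.lt_or_ge (P.filter fun t => ¬ t.2.2 = c).card 2 with hK2 | hK2
  · obtain ⟨g, hg⟩ := Finset.card_eq_one.1 (by omega : (P.filter fun t => ¬ t.2.2 = c).card = 1)
    have hgP := Finset.mem_filter.1 (hg ▸ Finset.mem_singleton_self g : g ∈ P.filter _)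
    have hgu := (h g hgP.1).resolve_right hgP.2
    have hKg : ∀ t ∈ P, t.2.2 ≠ c → t = g := fun t ht hne => by
      have : t ∈ P.filter fun t => ¬ t.2.2 = c := Finset.mem_filter.2 ⟨ht, hne⟩
      rwa [hg, Finset.mem_singleton] at this
    obtain ⟨m, h1, h2, h3⟩ := exists_matching_of_free_avoiding (n := n) (y := u) (a := g.2.1)
      (by omega) hS hM (hP.dir g hgP.1) (fun t ht i hi => by
        rw [hcomp t (hMP ht) g hgP.1 i hi]
        exact hgu.apply_eq (touch_fst g) fun e => hi (e ▸ hP.dir g hgP.1)) (by omega) huM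
      (fun w _ hw => by
        by_contra hcon
        push Not at hcon
        refine hblk ⟨w, c, hcT, fun k hk => hw k (hasM hk), fun j hj => ?_⟩
        by_cases hja : j = g.2.1 ∧ (w = u ∨ w = flipAt g.2.1 u)
        · obtain ⟨rfl, rfl | rfl⟩ := hja
          · exact Or.inl ⟨_, has_of_touch hgP.1 hgu⟩
          · exact Or.inl ⟨_, (has_of_touch hgP.1 hgu).symm⟩
        · obtain ⟨k, hk⟩ := hcon j hj (fun e => by
            by_contra h'
            push Not at h'
            exact hja ⟨e, by tauto⟩)
          exact Or.inr ⟨k, hk.mono hMP⟩)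
    exact matched m h1 h2 fun t ht hne => by rwa [hKg t ht hne]
  · have : ∃ j ∈ S, (∀ x, ¬ Has P u j x) ∧ ∀ k, ¬ Has P (flipAt j u) k c := by
      by_contra hcon
      push Not at hcon
      refine hblk ⟨u, c, hcT, hu, fun j hj => ?_⟩
      by_cases h' : ∃ x, Has P u j x
      · exact Or.inl h'
      · push Not at h'
        exact Or.inr (hcon j hj h')
    obtain ⟨j, hj, hj1, hj2⟩ := this
    refine extM (insert (u, j, c) M) ?_ (Finset.subset_insert _ _) ?_ ⟨j, ?_, ?_⟩
    · exact (hP.mono hMP).insert hj hcT (fun x hx => colM hx) (fun k hk => (huM k hk).elim)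
        fun k hk => (hj2 k (hk.mono hMP)).elim
    · have := Finset.card_insert_le (u, j, c) M
      omega
    · exact has_of_mem (Finset.mem_insert_self (u, j, c) M)
    · rintro t ht hne rfl
      exact hj1 _ (has_of_touch ht ((h t ht).resolve_right hne))

end Star

/-! ### Small dimensions by computation -/

section Search

/-- The number of the edge at the vertex number `x` in direction `j`. -/
def edgeCode (x j : ℕ) : ℕ := 4 * (if x.testBit j then x ^^^ 2 ^ j else x) + j

/-- The value of `f`, after the evaluation of the argument. -/
def force (n : ℕ) (f : ℕ → Bool) : Bool := Nat.casesOn n (f 0) fun k => f (Nat.succ k)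

/-- A family of `num` edge colourings of a hypercube: bit `k` of the entry of `lo` or `hi` with
number `p` is the low or high bit of the colour of the edge `p` in the `k`-th colouring. -/
structure ColTable where
  num : ℕ
  lo : ℕ
  hi : ℕ

namespace ColTable

/-- The low bits of the colours of an edge. -/
def loAt (A : ColTable) (p : ℕ) : ℕ := Nat.mod (Nat.shiftRight A.lo (Nat.mul 128 p)) (2 ^ 128)

/-- The high bits of the colours of an edge. -/
def hiAt (A : ColTable) (p : ℕ) : ℕ := Nat.mod (Nat.shiftRight A.hi (Nat.mul 128 p)) (2 ^ 128)

/-- The set of the colourings in which two edges have different colours. -/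
def diff (A : ColTable) (p q : ℕ) : ℕ :=
  Nat.lor (Nat.xor (A.loAt p) (A.loAt q)) (Nat.xor (A.hiAt p) (A.hiAt q))

/-- The set of all colourings. -/
def full (A : ColTable) : ℕ := Nat.sub (2 ^ A.num) 1

/-- The colour of the edge `p` in the `k`-th colouring. -/
def colAt (A : ColTable) (k p : ℕ) : ℕ :=
  2 * ((A.hiAt p).testBit k).toNat + ((A.loAt p).testBit k).toNat

/-- All members of the family are proper edge colourings with `d` colours. -/
def valid (A : ColTable) (d : ℕ) : Bool :=
  (List.range (2 ^ d)).all fun x => (List.range d).all fun i =>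
    ((List.range A.num).all fun k => Nat.blt (A.colAt k (edgeCode x i)) d) &&
      (List.range d).all fun j => i == j ||
        Nat.beq (Nat.land (A.diff (edgeCode x i) (edgeCode x j)) A.full) A.full

/-- The entries of `L` with the sets of the colourings in which they differ from `p` or not. -/
def row (A : ColTable) (p : ℕ) : List (ℕ × ℕ) → (List (ℕ × ℕ × ℕ) → Bool) → Bool
  | [], f => f []
  | q :: L, f => force (A.diff p q.1) fun x => force (Nat.xor A.full x) fun y =>
    row A p L fun R => f ((q.2, x, y) :: R)

end ColTable

/-- The members of `m` that fit an entry labelled `l` with the differences `R`. -/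
def fit (l : ℕ) : List (ℕ × ℕ × ℕ) → ℕ → ℕ
  | [], m => m
  | q :: R, m => fit l R (Nat.land m (bif Nat.beq q.1 l then q.2.2 else q.2.1))

/-- The vertex `x` is an end of the edge `p`. -/
def touchCode (p x : ℕ) : Bool :=
  Nat.beq x (Nat.div p 4) || Nat.beq x (Nat.xor (Nat.div p 4) (2 ^ (Nat.mod p 4)))

/-- Some entry in `L` has the label `l` and an end in common with `p`. -/
def improperCode (p l : ℕ) (L : List (ℕ × ℕ)) : Bool :=
  L.any fun q => Nat.beq q.2 l &&
    (touchCode q.1 (Nat.div p 4) || touchCode q.1 (Nat.xor (Nat.div p 4) (2 ^ (Nat.mod p 4))))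

/-- An uncoloured edge adjacent to all labels. -/
def satCode (d : ℕ) (ls : List ℕ) (L : List (ℕ × ℕ)) : Bool :=
  ls.length == d && (List.range (2 ^ d)).any fun x => (List.range d).any fun j =>
    (L.all fun p => p.1 != edgeCode x j) && ls.all fun l => L.any fun p =>
      p.2 == l && (touchCode p.1 x || touchCode p.1 (x ^^^ 2 ^ j))

/-- A vertex at which some label is blocked. -/
def blkCode (d : ℕ) (ls : List ℕ) (L : List (ℕ × ℕ)) : Bool :=
  (List.range (2 ^ d)).any fun x => ls.any fun l =>
    (L.all fun p => !(p.2 == l && touchCode p.1 x)) && (List.range d).all fun j =>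
      (L.any fun p => p.1 == edgeCode x j) ||
        L.any fun p => p.2 == l && touchCode p.1 (x ^^^ 2 ^ j)

/-- Three parallel edges with different labels in dimension `3`. -/
def parCode (d : ℕ) (ls : List ℕ) (L : List (ℕ × ℕ)) : Bool :=
  d == 3 && ls.length == d && L.all fun p => L.all fun q => p.1 % 4 == q.1 % 4

/-- One of the obstructions. -/
def badCode (d : ℕ) (ls : List ℕ) (L : List (ℕ × ℕ)) : Bool :=
  satCode d ls L || blkCode d ls L || parCode d ls L

/-- Every choice of `r` further entries from the list of edges is obstructed or extends `L` to a
pattern in one of the colourings in `m`. -/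
def search (A : ColTable) (d : ℕ) : List ℕ → ℕ → List ℕ → List (ℕ × ℕ) → ℕ → Bool
  -- `m = 0` means that no coloring of the table realises the pattern `L`.
  | _, 0, ls, L, m => bif Nat.beq m 0 then badCode d ls L else true
  | [], _ + 1, _, _, _ => true
  | p :: es, r + 1, ls, L, m =>
    search A d es (r + 1) ls L m && A.row p L fun R =>
      -- A chosen edge takes an old label or a new one, its own number. Labelling a color by the
      -- first edge that carries it enumerates patterns up to permutation of the colors.
      (ls.all fun l => improperCode p l L ||
        force (fit l R m) fun m' => search A d es r ls ((p, l) :: L) m') &&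
        force (fit p R m) fun m' => search A d es r (p :: ls) ((p, p) :: L) m'

/-- The numbers of the edges other than the first one. -/
def edgeCodes (d : ℕ) : List ℕ :=
  (List.range (4 * 2 ^ d)).filter fun p =>
    -- By symmetry the edge with number `0` may be assumed precolored. The last test selects one of
    -- the two ends, so that every edge is listed once.
    p != 0 && Nat.blt (p % 4) d && !(p / 4).testBit (p % 4)

/-- The search succeeds. -/
def searchAll (A : ColTable) (d : ℕ) : Bool :=
  A.valid d && search A d (edgeCodes d) (d - 1) [0] [(0, 0)] A.full

/-- Edge colourings of the hypercube of dimension `1`. -/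
def colTableOne : ColTable :=
  ⟨1, 0x0,
    0x0⟩

/-- Edge colourings of the hypercube of dimension `2`. -/
def colTableTwo : ColTable :=
  ⟨1, 0x10000000000000000000000000000000000000000000000000000000000000000000000000000000000000000000000000000000000000000000000000000000100000000000000000000000000000000,
    0x0⟩

/-- Edge colourings of the hypercube of dimension `3`. -/
def colTableThree : ColTable :=
  ⟨4, 0x20000000000000000000000000000000000000000000000000000000000000000000000000000000000000000000000050000000000000000000000000000000000000000000000000000000000000000000000000000000000000000000000000000000000000000000000000000000d0000000000000000000000000000000200000000000000000000000000000000000000000000000000000000000000080000000000000000000000000000000000000000000000000000000000000000000000000000000000000000000000000000000000000000000000000000000000000000000000000000000000000000000000000000000000000000000000000000000000000000000000000000000000000000000000000000000000000008000000000000000000000000000000070000000000000000000000000000000000000000000000000000000000000000000000000000000000000000000000000000000000000000000000000000000f00000000000000000000000000000000,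
    0x4000000000000000000000000000000000000000000000000000000000000000000000000000000000000000000000008000000000000000000000000000000000000000000000000000000000000000000000000000000000000000000000000000000000000000000000000000000000000000000000000000000000000000000000000000000000000000000000000000000000000000000000000000000030000000000000000000000000000000000000000000000000000000000000000000000000000000000000000000000000000000000000000000000000000000b000000000000000000000000000000000000000000000000000000000000000400000000000000000000000000000000000000000000000000000000000000070000000000000000000000000000000800000000000000000000000000000000000000000000000000000000000000000000000000000000000000000000000f0000000000000000000000000000000000000000000000000000000000000000⟩

/-- Edge colourings of the hypercube of dimension `4`. -/
def colTableFour : ColTable :=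
  -- Each edge owns a block of `128` bits, one bit for each of the `119` colorings.
  ⟨119, 0x1506da1175213810ab742722337c4c0000000000000000000000000000000000000000000000000000000000000000006fce2cf4eaf3caeb1cabbc9ccc3717000000000000000000000000000000000000000000000000000000000000000000000000000000000000000000000000006bce2fe2ba968fed10e7585de6033300508f523f056b3920eb3c4d53599cec0000000000000000000000000000000000283131ca0cdc37145708daf16183b2000000000000000000000000000000000000000000000000000000000000000000000000000000000000000000000000002e3170ce0c584412dd08eef558f3dc0000000000000000000000000000000000550e8e45d3b10efbaafd1b8e9aeeaa0000000000000000000000000000000000043081405f84351d04d492ed33c0e2007bc672b62d62d8e255a66450ad3c5500000000000000000000000000000000000000000000000000000000000000000004308040418040134440a2a800f084007bc673b23e66b9cc11b65441a708710000090c0d80190620aa09091658070a0052f9c72f930ec5efe0d7414f9ec8e90000000000000000000000000000000000000000000000000000000000000000000000000000000000000000000000000050f9853dc3eff3ef669b918a8d8ca30000000000000000000000000000000000000000000000000000000000000000000501ca91e27d2c022d66b0f763334e003b71ff8bb01cc6d6f3436322a66b1900000000000000000000000000000000007ffe3dfc3cb2dbdd1b39af2854c59100000000000000000000000000000000003f7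1fd9dfe7df6debf9bb7a6bf6f5b00000000000000000000000000000000007bfe3fee3d92dff5db7d6f7976f5bd00448fc273c3ef292b64e6d8dfc99ae60006f9cd39f20fe10da853a52f56514d00280630424dc13230d6885e90a93e3600000000000000000000000000000000000000000000000000000000000000000000f98d39e18ff3256643a13a651507002e0670421c00001890804e04984a5000000000000000000000000000000000005100028402700cc2093c10c102a0a8007ffffffbf2ffebdffb7bffabc6fbbd00000000044f4134208c9c14d53b346e007fffffffbdbedfff77e7eb7efdcfd300000000000000000000000000000000007fffffffffffffffffffffffffffff00000000000000000000000000000000007fffffffffffffffffffffffffffff00000000000000000000000000000000,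
    0x121423467829b485acb0e1e8d4583e000000000000000000000000000000000000000000000000000000000000000000052b985980162971d60d143be0e5d000000000000000000000000000000000000000000000000000000000000000000000000000000000000000000000000000012b9848c1d36b7b6add1538eed5a60074d4636613e9148d5d72ebcf8ab9d6000000000000000000000000000000000079c87eb2bfc24f7a63738f853b3a8b000000000000000000000000000000000000000000000000000000000000000000000000000000000000000000000000007ec87cb7aee61f7811475ec70b2ad100000000000000000000000000000000007b2603401e78a8cec8bcb070f6c87c00000000000000000000000000000000005b8e4eb2febaef4a21a5c984755a2b000411800d410511219e0a52db0c65f40000000000000000000000000000000000000000000000000000000000000000005b8e4eb7ac3e9b6081a55853750a690004118008410144032e08038c085582002060314012c0209c5052a42082a014006ef7c5ad47fdd28e19ce7a560f8765000000000000000000000000000000000000000000000000000000000000000000000000000000000000000000000000006df7c7b9171cc086d72aaa1731a74900000000000000000000000000000000000000000000000000000000000000000002f033c6e9616db962b174b18cf83a002a71b58d6d45d2b6aada36701f062d000000000000000000000000000000000015080810169235419d1d858d7271da00000000000000000000000000000000002e71b5997e04e496b60aa6a411661900000000000000000000000000000000001108080400921361095501486601a400408642628169080840a058138898420006fffdffe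0bff69535c56d2ec1970300790ffe7bb80e8a76e6628b6af10e8500000000000000000000000000000000000000000000000000000000000000000001fffffff19ff3b5f7f3ed3bf5b72f007e0ffc7bfeefbe5ebccedfeedb5ed700000000000000000000000000000000007ff003840f704deb4b3d32d52ee9f8007fffffffad7fdef7effd3f7ffb9fcb007ffffffffabeefff7767ebeee5efb5000000000057c13108989ad4911e707e00000000000000000000000000000000007fffffffffffffffffffffffffffff007fffffffffffffffffffffffffffff0000000000000000000000000000000000000000000000000000000000000000⟩

theorem searchAll_one : searchAll colTableOne 1 = true := by decide +kernel

theorem searchAll_two : searchAll colTableTwo 2 = true := by decide +kernel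

theorem searchAll_three : searchAll colTableThree 3 = true := by decide +kernel

theorem searchAll_four : searchAll colTableFour 4 = true := by decide +kernel

end Search

/-! ### Soundness of the search -/

section SearchSound

theorem force_eq (n : ℕ) (f : ℕ → Bool) : force n f = f n := by cases n <;> rfl

namespace ColTable

theorem diff_testBit (A : ColTable) (k p q : ℕ) :
    (A.diff p q).testBit k = true ↔ A.colAt k p ≠ A.colAt k q := by
  have : (A.diff p q).testBit k = (((A.loAt p).testBit k ^^ (A.loAt q).testBit k) ||
      ((A.hiAt p).testBit k ^^ (A.hiAt q).testBit k)) := by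
    change ((_ ^^^ _) ||| (_ ^^^ _) : ℕ).testBit k = _
    rw [Nat.testBit_or, Nat.testBit_xor, Nat.testBit_xor]
  rw [this, colAt, colAt]
  cases (A.loAt p).testBit k <;> cases (A.loAt q).testBit k <;> cases (A.hiAt p).testBit k <;>
    cases (A.hiAt q).testBit k <;> simp

theorem full_testBit (A : ColTable) (k : ℕ) : A.full.testBit k = true ↔ k < A.num := by
  change (2 ^ A.num - 1).testBit k = true ↔ _
  simp [Nat.testBit_two_pow_sub_one]

/-- The row of differences as a list. -/
def rowList (A : ColTable) (p : ℕ) (L : List (ℕ × ℕ)) : List (ℕ × ℕ × ℕ) :=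
  L.map fun q => (q.2, A.diff p q.1, Nat.xor A.full (A.diff p q.1))

theorem row_eq (A : ColTable) (p : ℕ) (L : List (ℕ × ℕ)) (f : List (ℕ × ℕ × ℕ) → Bool) :
    A.row p L f = f (A.rowList p L) := by
  induction L generalizing f with
  | nil => rfl
  | cons q L ih => simp only [row, force_eq, ih]; rfl

theorem fit_testBit (A : ColTable) {k p l : ℕ} {L : List (ℕ × ℕ)} {m : ℕ}
    (h : (fit l (A.rowList p L) m).testBit k = true) (hk : k < A.num) :
    m.testBit k = true ∧ ∀ q ∈ L, A.colAt k p = A.colAt k q.1 ↔ q.2 = l := by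
  induction L generalizing m with
  | nil => exact ⟨h, by simp⟩
  | cons q L ih =>
    obtain ⟨h1, h2⟩ := ih h
    change (m &&& _ : ℕ).testBit k = true at h1
    rw [Nat.testBit_and, Bool.and_eq_true] at h1
    refine ⟨h1.1, fun r hr => ?_⟩
    rcases List.mem_cons.1 hr with rfl | hr
    · have h3 := h1.2
      have h4 := A.diff_testBit k p r.1
      by_cases e : r.2 = l
      · rw [show Nat.beq r.2 l = true from by rw [Nat.beq_eq]; exact e] at h3
        change (A.full ^^^ A.diff p r.1 : ℕ).testBit k = true at h3
        rw [Nat.testBit_xor, (A.full_testBit k).2 hk] at h3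
        simp only [Bool.true_xor, Bool.not_eq_true'] at h3
        rw [h3] at h4
        simpa [e] using h4
      · rw [show Nat.beq r.2 l = false from by rw [← Bool.not_eq_true, Nat.beq_eq]; exact e] at h3
        exact ⟨fun h5 => (h4.1 h3 h5).elim, fun h5 => (e h5).elim⟩
    · exact h2 r hr

theorem valid_colAt_lt {A : ColTable} {d : ℕ} (h : A.valid d = true) {x i k : ℕ} (hx : x < 2 ^ d)
    (hi : i < d) (hk : k < A.num) : A.colAt k (edgeCode x i) < d := by
  simp only [valid, List.all_eq_true, List.mem_range, Bool.and_eq_true] at h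
  simpa [Nat.blt_eq] using (h x hx i hi).1 k hk

theorem valid_colAt_inj {A : ColTable} {d : ℕ} (h : A.valid d = true) {x i j k : ℕ}
    (hx : x < 2 ^ d) (hi : i < d) (hj : j < d) (hk : k < A.num)
    (e : A.colAt k (edgeCode x i) = A.colAt k (edgeCode x j)) : i = j := by
  simp only [valid, List.all_eq_true, List.mem_range, Bool.and_eq_true, Bool.or_eq_true,
    beq_iff_eq] at h
  refine ((h x hx i hi).2 j hj).resolve_right fun h' => ?_
  have h1 : (A.diff (edgeCode x i) (edgeCode x j) &&& A.full : ℕ) = A.full := by rwa [Nat.beq_eq] at h'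
  have h2 := (A.full_testBit k).2 hk
  rw [← h1, Nat.testBit_and, Bool.and_eq_true] at h2
  exact (A.diff_testBit k _ _).1 h2.1 e

end ColTable

theorem edgeCode_xor (x j : ℕ) : edgeCode (x ^^^ 2 ^ j) j = edgeCode x j := by
  unfold edgeCode
  rw [Nat.testBit_xor, Nat.testBit_two_pow_self]
  cases h : x.testBit j <;> simp

theorem edgeCode_mod {x j : ℕ} (hj : j < 4) : edgeCode x j % 4 = j := by
  unfold edgeCode; omega

theorem edgeCode_div {x j : ℕ} (hj : j < 4) :
    edgeCode x j / 4 = if x.testBit j then x ^^^ 2 ^ j else x := by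
  unfold edgeCode; omega

theorem touchCode_edgeCode {x j y : ℕ} (hj : j < 4) :
    touchCode (edgeCode x j) y = true ↔ y = x ∨ y = x ^^^ 2 ^ j := by
  change (Nat.beq y (edgeCode x j / 4) || Nat.beq y ((edgeCode x j / 4) ^^^ 2 ^ (edgeCode x j % 4)))
    = true ↔ _
  rw [edgeCode_mod hj, edgeCode_div hj, Bool.or_eq_true, Nat.beq_eq, Nat.beq_eq]
  split_ifs
  · rw [Nat.xor_assoc, Nat.xor_self, Nat.xor_zero, or_comm]
  · rfl

theorem edgeCode_inj {x y i j : ℕ} (hi : i < 4) (hj : j < 4) (h : edgeCode x i = edgeCode y j) :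
    i = j ∧ (y = x ∨ y = x ^^^ 2 ^ i) := by
  have h1 := edgeCode_mod (x := x) hi
  rw [h, edgeCode_mod hj] at h1
  subst h1
  refine ⟨rfl, (touchCode_edgeCode hi).1 ?_⟩
  rw [h]
  exact (touchCode_edgeCode hi).2 (Or.inl rfl)

variable {ι C : Type*} [DecidableEq ι]

/-- A numbering of the vertices of the component of `b` and of the directions in `S`. -/
structure Coding (S : Finset ι) (b : ι → Bool) (d : ℕ) where
  enc : (ι → Bool) → ℕ
  dir : ι → ℕ
  enc_lt : ∀ v, enc v < 2 ^ d
  dir_lt : ∀ j ∈ S, dir j < d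
  dir_inj : ∀ j ∈ S, ∀ k ∈ S, dir j = dir k → j = k
  dir_surj : ∀ i < d, ∃ j ∈ S, dir j = i
  enc_flip : ∀ v, ∀ j ∈ S, enc (flipAt j v) = enc v ^^^ 2 ^ dir j
  enc_inj : ∀ v w, (∀ i, i ∉ S → v i = b i) → (∀ i, i ∉ S → w i = b i) → enc v = enc w → v = w
  enc_surj : ∀ x < 2 ^ d, ∃ v, (∀ i, i ∉ S → v i = b i) ∧ enc v = x

/-- Bits are taken relative to `b`, and the directions are renumbered by a transposition, so that
any chosen edge can receive the number `0`. -/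
theorem exists_coding {S : Finset ι} {d : ℕ} (hS : S.card = d) (b : ι → Bool) {j₀ : ι}
    (hj₀ : j₀ ∈ S) : ∃ A : Coding S b d, A.enc b = 0 ∧ A.dir j₀ = 0 := by
  have hd : 0 < d := hS ▸ Finset.card_pos.2 ⟨j₀, hj₀⟩
  obtain ⟨e, he⟩ : ∃ e : S ≃ Fin d, e ⟨j₀, hj₀⟩ = ⟨0, hd⟩ := by
    let e' := S.equivFinOfCardEq hS
    exact ⟨e'.trans (Equiv.swap (e' ⟨j₀, hj₀⟩) ⟨0, hd⟩), by simp⟩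
  obtain ⟨enc, hbit, hlt⟩ : ∃ enc : (ι → Bool) → ℕ,
      (∀ v (i : Fin d), (enc v).testBit i = (v (e.symm i).1 ^^ b (e.symm i).1)) ∧
        ∀ v, enc v < 2 ^ d :=
    ⟨fun v => Nat.ofBits fun i : Fin d => v (e.symm i).1 ^^ b (e.symm i).1,
      fun v i => by simp [Nat.testBit_ofBits_lt], fun v => Nat.ofBits_lt_two_pow _⟩
  let dir : ι → ℕ := fun j => if h : j ∈ S then (e ⟨j, h⟩ : ℕ) else 0
  have hdir : ∀ j, ∀ h : j ∈ S, dir j = e ⟨j, h⟩ := fun j h => by simp [dir, h]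
  have hge : ∀ x < 2 ^ d, ∀ i, ¬ i < d → x.testBit i = false := fun x hx i hi =>
    Nat.testBit_lt_two_pow (hx.trans_le (Nat.pow_le_pow_right (by omega) (by omega)))
  refine ⟨⟨enc, dir, hlt, fun j hj => by rw [hdir j hj]; exact (e _).2,
    fun j hj k hk h => ?_, fun i hi => ⟨e.symm ⟨i, hi⟩, (e.symm ⟨i, hi⟩).2, ?_⟩, fun v j hj => ?_,
    fun v w hv hw h => ?_, fun x hx => ?_⟩, ?_, ?_⟩
  · rw [hdir j hj, hdir k hk] at h
    exact congrArg Subtype.val (e.injective (Fin.ext h))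
  · rw [hdir _ (e.symm ⟨i, hi⟩).2]; simp
  · refine Nat.eq_of_testBit_eq fun i => ?_
    rw [Nat.testBit_xor, hdir j hj, Nat.testBit_two_pow]
    by_cases hi : i < d
    · have h1 := hbit (flipAt j v) ⟨i, hi⟩
      have h2 := hbit v ⟨i, hi⟩
      simp only at h1 h2
      rw [h1, h2, flipAt_apply]
      by_cases h3 : (e.symm ⟨i, hi⟩).1 = j
      · have h4 : e ⟨j, hj⟩ = ⟨i, hi⟩ := by
          rw [← e.apply_symm_apply ⟨i, hi⟩]; congr 1; exact Subtype.ext h3.symm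
        rw [if_pos h3, h4]
        simp only [decide_true, h3]
        cases v j <;> cases b j <;> rfl
      · have h4 : ¬ (e ⟨j, hj⟩ : ℕ) = i := fun h => h3 (by
          have : e ⟨j, hj⟩ = ⟨i, hi⟩ := Fin.ext h
          rw [← this, e.symm_apply_apply])
        rw [if_neg h3]
        simp [h4]
    · rw [hge _ (hlt _) i hi, hge _ (hlt _) i hi]
      have := (e ⟨j, hj⟩).2
      simp; omega
  · funext i
    by_cases hi : i ∈ S
    · have h1 := hbit v (e ⟨i, hi⟩)
      have h2 := hbit w (e ⟨i, hi⟩)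
      rw [h, h2] at h1
      simp only [e.symm_apply_apply] at h1
      revert h1
      cases v i <;> cases w i <;> cases b i <;> simp
    · rw [hv i hi, hw i hi]
  · refine ⟨fun i => if h : i ∈ S then x.testBit (e ⟨i, h⟩) ^^ b i else b i,
      fun i hi => by simp [hi], Nat.eq_of_testBit_eq fun i => ?_⟩
    by_cases hi : i < d
    · have := hbit (fun i => if h : i ∈ S then x.testBit (e ⟨i, h⟩) ^^ b i else b i) ⟨i, hi⟩
      simp only at this
      rw [this]
      simp
    · rw [hge x hx i hi]
      exact hge _ (hlt _) i hi
  · refine Nat.eq_of_testBit_eq fun i => ?_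
    rw [Nat.zero_testBit]
    by_cases hi : i < d
    · have := hbit b ⟨i, hi⟩
      simp only at this
      change (enc b).testBit i = false
      rw [this]; simp
    · exact hge _ (hlt b) i hi
  · change dir j₀ = 0
    rw [hdir j₀ hj₀, he]

namespace Coding

variable {S : Finset ι} {b : ι → Bool} {d : ℕ}

/-- The number of an edge. -/
def code (A : Coding S b d) (v : ι → Bool) (j : ι) : ℕ := edgeCode (A.enc v) (A.dir j)

theorem code_flipAt (A : Coding S b d) {j : ι} (hj : j ∈ S) (v : ι → Bool) :
    A.code (flipAt j v) j = A.code v j := by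
  rw [code, A.enc_flip v j hj, edgeCode_xor, code]

theorem flipAt_base {j : ι} (hj : j ∈ S) {v : ι → Bool} (hv : ∀ i, i ∉ S → v i = b i) :
    ∀ i, i ∉ S → flipAt j v i = b i := fun i hi => by
  rw [flipAt_apply_of_ne (by rintro rfl; exact hi hj), hv i hi]

theorem touchCode_iff (A : Coding S b d) (hd : d ≤ 4) {t : Entry ι C} (ht : t.2.1 ∈ S)
    (htb : ∀ i, i ∉ S → t.1 i = b i) {w : ι → Bool} (hw : ∀ i, i ∉ S → w i = b i) :
    touchCode (A.code t.1 t.2.1) (A.enc w) = true ↔ Touch t w := by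
  rw [code, touchCode_edgeCode ((A.dir_lt _ ht).trans_le hd), ← A.enc_flip _ _ ht]
  constructor
  · rintro (h | h)
    · exact Or.inl (A.enc_inj _ _ hw htb h)
    · exact Or.inr (A.enc_inj _ _ hw (flipAt_base ht htb) h)
  · rintro (rfl | rfl)
    exacts [Or.inl rfl, Or.inr rfl]

theorem code_inj (A : Coding S b d) (hd : d ≤ 4) {v w : ι → Bool} {j k : ι} (hj : j ∈ S)
    (hk : k ∈ S) (hv : ∀ i, i ∉ S → v i = b i) (hw : ∀ i, i ∉ S → w i = b i)
    (h : A.code v j = A.code w k) : j = k ∧ (w = v ∨ w = flipAt j v) := by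
  obtain ⟨h1, h2⟩ := edgeCode_inj ((A.dir_lt _ hj).trans_le hd) ((A.dir_lt _ hk).trans_le hd) h
  refine ⟨A.dir_inj _ hj _ hk h1, ?_⟩
  rw [← A.enc_flip _ _ hj] at h2
  exact h2.imp (A.enc_inj _ _ hw hv) (A.enc_inj _ _ hw (flipAt_base hj hv))

theorem code_mem (A : Coding S b d) (hd : d ≤ 4) {v : ι → Bool} {j : ι} (hj : j ∈ S)
    (h0 : A.code v j ≠ 0) : A.code v j ∈ edgeCodes d := by
  have hj' := A.dir_lt j hj
  have h1 := A.enc_lt v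
  have h2 := A.enc_lt (flipAt j v)
  rw [A.enc_flip v j hj] at h2
  have hm : A.code v j % 4 = A.dir j := edgeCode_mod (hj'.trans_le hd)
  have hdv : A.code v j / 4 = _ := edgeCode_div (x := A.enc v) (hj'.trans_le hd)
  rw [edgeCodes, List.mem_filter, List.mem_range]
  simp only [Bool.and_eq_true, bne_iff_ne, ne_eq, Nat.blt_eq, hm, hj', h0, not_false_eq_true,
    true_and, hdv]
  constructor
  · have : A.code v j / 4 < 2 ^ d := by rw [hdv]; split_ifs <;> assumption
    omega
  · cases h : (A.enc v).testBit (A.dir j) <;> simp [h, Nat.testBit_xor]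

end Coding


variable [DecidableEq C] {S : Finset ι} {T : Finset C} {b : ι → Bool} {d : ℕ}

/-- The codes and labels of entries. -/
def codeLabel (A : Coding S b d) (lab : C → ℕ) (t : Entry ι C) : ℕ × ℕ :=
  (A.code t.1 t.2.1, lab t.2.2)

/-- The list `ls` consists of the labels of the entries in `us`. -/
def IsLabels (lab : C → ℕ) (ls : List ℕ) (us : List (Entry ι C)) : Prop :=
  ls.Nodup ∧ ∀ l, l ∈ ls ↔ ∃ u ∈ us, lab u.2.2 = l

/-- Follow the branch of the search that selects exactly the entries of `l`: `us` is the part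
already treated, `ts` the rest, and every bit of `m` belongs to a coloring with the right pattern on
`us`. By `hlab` the labels are those of the search, and by `himp` this branch is never cut off as
improper. -/
theorem search_sound (A : Coding S b d) (B : ColTable) {lab : C → ℕ} {l : List (Entry ι C)}
    (hinj : ∀ t ∈ l, ∀ u ∈ l, lab t.2.2 = lab u.2.2 → t.2.2 = u.2.2)
    (hlab : ∀ us t ts, l = us ++ t :: ts →
      (∃ u ∈ us, u.2.2 = t.2.2) ∨ lab t.2.2 = A.code t.1 t.2.1)
    (himp : ∀ us t ts, l = us ++ t :: ts →
      improperCode (A.code t.1 t.2.1) (lab t.2.2) (us.reverse.map (codeLabel A lab)) = false) :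
    ∀ (es : List ℕ) (r : ℕ) (ls : List ℕ) (us ts : List (Entry ι C)) (m : ℕ),
      search B d es r ls (us.reverse.map (codeLabel A lab)) m = true →
      (ts.map fun t => A.code t.1 t.2.1).Sublist es → ts.length = r → l = us ++ ts →
      IsLabels lab ls us →
      (∀ k, m.testBit k = true → k < B.num ∧ ∀ t ∈ us, ∀ u ∈ us,
        B.colAt k (A.code t.1 t.2.1) = B.colAt k (A.code u.1 u.2.1) ↔ t.2.2 = u.2.2) →
      (∃ k < B.num, ∀ t ∈ l, ∀ u ∈ l,
        B.colAt k (A.code t.1 t.2.1) = B.colAt k (A.code u.1 u.2.1) ↔ t.2.2 = u.2.2) ∨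
      ∃ ls, IsLabels lab ls l ∧ badCode d ls (l.reverse.map (codeLabel A lab)) = true := by
  have step : ∀ (es : List ℕ) (ls : List ℕ) (us : List (Entry ι C)) (m : ℕ),
      search B d es 0 ls (us.reverse.map (codeLabel A lab)) m = true → l = us →
      IsLabels lab ls us →
      (∀ k, m.testBit k = true → k < B.num ∧ ∀ t ∈ us, ∀ u ∈ us,
        B.colAt k (A.code t.1 t.2.1) = B.colAt k (A.code u.1 u.2.1) ↔ t.2.2 = u.2.2) →
      (∃ k < B.num, ∀ t ∈ l, ∀ u ∈ l,
        B.colAt k (A.code t.1 t.2.1) = B.colAt k (A.code u.1 u.2.1) ↔ t.2.2 = u.2.2) ∨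
      ∃ ls, IsLabels lab ls l ∧ badCode d ls (l.reverse.map (codeLabel A lab)) = true := by
    rintro es ls us m h rfl hls hm
    simp only [search] at h
    by_cases h0 : m = 0
    · subst h0
      exact Or.inr ⟨ls, hls, by simpa using h⟩
    · obtain ⟨k, hk⟩ := Nat.exists_testBit_of_ne_zero h0
      exact Or.inl ⟨k, hm k hk⟩
  intro es
  induction es with
  | nil =>
    intro r ls us ts m h hts hr hl hls hm
    have h0 : ts = [] := by simpa using hts
    subst h0
    subst hr
    exact step [] ls us m h (by simpa using hl) hls hm
  | cons p es ih =>
    intro r ls us ts m h hts hr hl hls hm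
    rcases r with _ | r
    · have h0 : ts = [] := List.length_eq_zero_iff.1 hr
      subst h0
      exact step _ ls us m h (by simpa using hl) hls hm
    simp only [search, ColTable.row_eq, Bool.and_eq_true, force_eq] at h
    obtain ⟨h1, h2, h3⟩ := h
    rcases ts with _ | ⟨t, ts⟩
    · simp at hr
    rw [List.map_cons] at hts
    rcases List.sublist_cons_iff.1 hts with hts | ⟨r', hr', hts⟩
    · exact ih _ _ _ (t :: ts) _ h1 hts hr hl hls hm
    obtain ⟨rfl, rfl⟩ := List.cons.inj hr'
    have hl' : l = (us ++ [t]) ++ ts := by simpa using hl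
    have hr1 : ts.length = r := by simpa using hr
    have hmap : (us ++ [t]).reverse.map (codeLabel A lab) =
      (A.code t.1 t.2.1, lab t.2.2) :: us.reverse.map (codeLabel A lab) := by
        simp [codeLabel]
    have hm' : ∀ k, (fit (lab t.2.2)
        (B.rowList (A.code t.1 t.2.1) (us.reverse.map (codeLabel A lab))) m).testBit k = true →
        k < B.num ∧ ∀ t' ∈ us ++ [t], ∀ u ∈ us ++ [t],
        B.colAt k (A.code t'.1 t'.2.1) = B.colAt k (A.code u.1 u.2.1) ↔ t'.2.2 = u.2.2 := by
      intro k hk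
      -- `fit` only intersects, so it creates no new bits.
      have hmk : m.testBit k = true := by
        by_contra hcon
        have : ∀ (R : List (ℕ × ℕ × ℕ)) (m : ℕ), m.testBit k = false →
            (fit (lab t.2.2) R m).testBit k = false := by
          intro R
          induction R with
          | nil => exact fun m h => h
          | cons q R ih' =>
            intro m h
            refine ih' _ ?_
            change (m &&& _ : ℕ).testBit k = false
            rw [Nat.testBit_and, h, Bool.false_and]
        rw [this _ _ (by simpa using hcon)] at hk
        exact Bool.false_ne_true hk
      obtain ⟨k1, k2⟩ := hm k hmk
      obtain ⟨-, k3⟩ := B.fit_testBit hk k1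
      have k4 : ∀ u ∈ us, B.colAt k (A.code t.1 t.2.1) = B.colAt k (A.code u.1 u.2.1) ↔
          t.2.2 = u.2.2 := fun u hu => by
        have := k3 (codeLabel A lab u) (List.mem_map_of_mem (List.mem_reverse.2 hu))
        rw [codeLabel] at this
        rw [this]
        exact ⟨fun e => (hinj u (by simp [hl, hu]) t (by simp [hl]) e).symm, fun e => by simp [e]⟩
      refine ⟨k1, fun t' ht' u hu => ?_⟩
      rcases List.mem_append.1 ht' with h5 | h5 <;> rcases List.mem_append.1 hu with h6 | h6
      · exact k2 t' h5 u h6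
      · rw [List.mem_singleton.1 h6, eq_comm, k4 t' h5, eq_comm]
      · rw [List.mem_singleton.1 h5, k4 u h6]
      · rw [List.mem_singleton.1 h5, List.mem_singleton.1 h6]
        simp
    by_cases hold : ∃ u ∈ us, u.2.2 = t.2.2
    · obtain ⟨u, hu, hut⟩ := hold
      have hmem : lab t.2.2 ∈ ls := (hls.2 _).2 ⟨u, hu, by rw [hut]⟩
      have h4 := List.all_eq_true.1 h2 _ hmem
      rw [himp us t ts hl, Bool.false_or] at h4
      refine ih _ _ (us ++ [t]) ts _ (by rw [hmap]; exact h4) hts hr1 hl' ⟨hls.1, fun x => ?_⟩ hm'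
      rw [hls.2]
      constructor
      · rintro ⟨w, hw, e⟩; exact ⟨w, by simp [hw], e⟩
      · rintro ⟨w, hw, e⟩
        rcases List.mem_append.1 hw with hw | hw
        · exact ⟨w, hw, e⟩
        · obtain rfl := List.mem_singleton.1 hw
          exact ⟨u, hu, by rw [hut, e]⟩
    · have hlt := (hlab us t ts hl).resolve_left hold
      rw [← hlt] at h3
      refine ih _ _ (us ++ [t]) ts _ (by rw [hmap, ← hlt]; exact h3) hts hr1 hl' ⟨?_, fun x => ?_⟩ hm'
      · refine List.nodup_cons.2 ⟨fun hmem => hold ?_, hls.1⟩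
        obtain ⟨u, hu, e⟩ := (hls.2 _).1 hmem
        exact ⟨u, hu, hinj u (by simp [hl, hu]) t (by simp [hl]) e⟩
      · rw [List.mem_cons, hls.2]
        constructor
        · rintro (rfl | ⟨w, hw, e⟩)
          · exact ⟨t, by simp, rfl⟩
          · exact ⟨w, by simp [hw], e⟩
        · rintro ⟨w, hw, e⟩
          rcases List.mem_append.1 hw with hw | hw
          · exact Or.inr ⟨w, hw, e⟩
          · obtain rfl := List.mem_singleton.1 hw
            exact Or.inl e.symm

end SearchSound

/-! ### Dimensions one to four -/

section SmallDimension

variable {ι C : Type*} [DecidableEq ι] [DecidableEq C] {S : Finset ι} {T : Finset C}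
  {P : Finset (Entry ι C)} {d : ℕ}

/-- Three parallel edges of different colours in dimension `3`. -/
def Parallel (d : ℕ) (P : Finset (Entry ι C)) : Prop :=
  d = 3 ∧ (∀ t ∈ P, ∀ u ∈ P, t.2.1 = u.2.1) ∧ ∀ t ∈ P, ∀ u ∈ P, t.2.2 = u.2.2 → t = u

/-- The color numbers are sent injectively into `T`. Only the pattern of equal and different colors
matters, by `IsCol.extends_of_pattern`. -/
theorem extends_of_table {b : ι → Bool} (A : Coding S b d) {B : ColTable}
    (hB : B.valid d = true) (hT : T.card = d) (hP : Good S T P) {k : ℕ} (hk : k < B.num)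
    (h : ∀ t ∈ P, ∀ u ∈ P,
      B.colAt k (A.code t.1 t.2.1) = B.colAt k (A.code u.1 u.2.1) ↔ t.2.2 = u.2.2)
    (hd : 0 < d) : Extends S T P := by
  obtain ⟨σ, hσ, hσ'⟩ : ∃ σ : ℕ → C, (∀ i < d, σ i ∈ T) ∧ ∀ i < d, ∀ j < d, σ i = σ j → i = j := by
    let e := T.equivFinOfCardEq hT
    refine ⟨fun i => if h : i < d then e.symm ⟨i, h⟩ else e.symm ⟨0, hd⟩, fun i hi => by
      simp only [hi, dif_pos]; exact Subtype.property _,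
      fun i hi j hj hij => ?_⟩
    simp only [hi, hj, dif_pos] at hij
    simpa using hij
  have hlt : ∀ v, ∀ j ∈ S, B.colAt k (A.code v j) < d := fun v j hj =>
    B.valid_colAt_lt hB (A.enc_lt v) (A.dir_lt j hj) hk
  have hf : IsCol S T fun v j => σ (B.colAt k (A.code v j)) := by
    refine ⟨fun v j hj => hσ _ (hlt v j hj), fun v j hj => by rw [A.code_flipAt hj],
      fun v j hj l hl e => ?_⟩
    exact A.dir_inj j hj l hl (B.valid_colAt_inj hB (A.enc_lt v) (A.dir_lt j hj) (A.dir_lt l hl) hk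
      (hσ' _ (hlt v j hj) _ (hlt v l hl) e))
  refine hf.extends_of_pattern hP fun t ht u hu => ?_
  rw [← h t ht u hu]
  exact ⟨hσ' _ (hlt _ _ (hP.dir t ht)) _ (hlt _ _ (hP.dir u hu)), fun e => by simp only [e]⟩

theorem obstructed_of_badCode {b : ι → Bool} (A : Coding S b d) (hd : d ≤ 4) (hT : T.card = d)
    (hP : Good S T P) (hPd : P.card ≤ d) (hb : ∀ t ∈ P, ∀ i, i ∉ S → t.1 i = b i)
    {l : List (Entry ι C)} (hl : ∀ t, t ∈ l ↔ t ∈ P) {lab : C → ℕ}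
    (hinj : ∀ t ∈ l, ∀ u ∈ l, lab t.2.2 = lab u.2.2 → t.2.2 = u.2.2) {ls : List ℕ}
    (hls : IsLabels lab ls l) (h : badCode d ls (l.reverse.map (codeLabel A lab)) = true) :
    Sat S T P ∨ Blk S T P ∨ Parallel d P := by
  have hmem : ∀ q, q ∈ l.reverse.map (codeLabel A lab) ↔ ∃ t ∈ P, codeLabel A lab t = q := by
    intro q; simp [hl]
  have hinj' : ∀ t ∈ P, ∀ u ∈ P, lab t.2.2 = lab u.2.2 → t.2.2 = u.2.2 := fun t ht u hu =>
    hinj t ((hl t).2 ht) u ((hl u).2 hu)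
  have hls' : ∀ x, x ∈ ls ↔ ∃ t ∈ P, lab t.2.2 = x := fun x => by simp [hls.2, hl]
  have touch : ∀ t ∈ P, ∀ w, (∀ i, i ∉ S → w i = b i) →
      (touchCode (A.code t.1 t.2.1) (A.enc w) = true ↔ Touch t w) := fun t ht w hw =>
    A.touchCode_iff hd (hP.dir t ht) (hb t ht) hw
  have hsame : ∀ t ∈ P, ∀ v, (∀ i, i ∉ S → v i = b i) → ∀ j ∈ S,
      (A.code t.1 t.2.1 = A.code v j ↔ t.2.1 = j ∧ Touch t v) := by
    intro t ht v hv j hj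
    constructor
    · intro e
      obtain ⟨e1, e2⟩ := A.code_inj hd (hP.dir t ht) hj (hb t ht) hv e
      exact ⟨e1, e2⟩
    · rintro ⟨rfl, rfl | rfl⟩
      · rfl
      · rw [A.code_flipAt hj]
  -- As there are at most `d` entries, `d` labels mean that every color of `T` occurs exactly once.
  have hfull : ls.length = d → (∀ c ∈ T, ∃ t ∈ P, t.2.2 = c) ∧
      ∀ t ∈ P, ∀ u ∈ P, t.2.2 = u.2.2 → t = u := by
    intro e
    have h1 : ls.toFinset = (P.image fun t => t.2.2).image lab := by
      ext x
      simp only [List.mem_toFinset, hls', Finset.mem_image]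
      constructor
      · rintro ⟨t, ht, rfl⟩; exact ⟨_, ⟨t, ht, rfl⟩, rfl⟩
      · rintro ⟨_, ⟨t, ht, rfl⟩, rfl⟩; exact ⟨t, ht, rfl⟩
    have h2 : ls.toFinset.card = d := by rw [List.toFinset_card_of_nodup hls.1, e]
    have h3 : d ≤ (P.image fun t => t.2.2).card := by
      rw [← h2, h1]; exact Finset.card_image_le
    have h4 : (P.image fun t => t.2.2) = T := by
      refine Finset.eq_of_subset_of_card_le (fun c hc => ?_) (hT.le.trans h3)
      obtain ⟨t, ht, rfl⟩ := Finset.mem_image.1 hc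
      exact hP.col t ht
    refine ⟨fun c hc => by rw [← h4] at hc; simpa using hc, ?_⟩
    have h5 : (P.image fun t => t.2.2).card = P.card :=
      le_antisymm Finset.card_image_le (hPd.trans h3)
    exact fun t ht u hu => Finset.card_image_iff.1 h5 ht hu
  simp only [badCode, Bool.or_eq_true] at h
  rcases h with (h | h) | h
  · left
    simp only [satCode, Bool.and_eq_true, beq_iff_eq, List.any_eq_true, List.mem_range,
      List.all_eq_true, bne_iff_ne, ne_eq, Bool.or_eq_true] at h
    obtain ⟨hlen, x, hx, i, hi, h1, h2⟩ := h
    obtain ⟨v, hv, rfl⟩ := A.enc_surj x hx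
    obtain ⟨j, hj, rfl⟩ := A.dir_surj i hi
    refine ⟨v, j, hj, fun c ⟨t, ht, e1, e2, e3⟩ => ?_, fun c hc => ?_⟩
    · exact h1 _ ((hmem _).2 ⟨t, ht, rfl⟩) ((hsame t ht v hv j hj).2 ⟨e1, e3⟩)
    · obtain ⟨t, ht, rfl⟩ := (hfull hlen).1 c hc
      obtain ⟨q, hq, h3, h4⟩ := h2 _ ((hls' _).2 ⟨t, ht, rfl⟩)
      obtain ⟨u, hu, rfl⟩ := (hmem q).1 hq
      rw [← A.enc_flip v j hj] at h4
      refine ⟨u.2.1, h4.imp (fun h5 => ⟨u, hu, rfl, hinj' _ hu _ ht h3, (touch u hu v hv).1 h5⟩)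
        fun h5 => ⟨u, hu, rfl, hinj' _ hu _ ht h3,
          (touch u hu _ (Coding.flipAt_base hj hv)).1 h5⟩⟩
  · right; left
    simp only [blkCode, Bool.and_eq_true, beq_iff_eq, List.any_eq_true, List.mem_range,
      List.all_eq_true, Bool.or_eq_true, Bool.not_eq_true', Bool.and_eq_false_iff,
      beq_eq_false_iff_ne, ne_eq] at h
    obtain ⟨x, hx, l₀, hl₀, h1, h2⟩ := h
    obtain ⟨v, hv, rfl⟩ := A.enc_surj x hx
    obtain ⟨t₀, ht₀, rfl⟩ := (hls' _).1 hl₀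
    refine ⟨v, t₀.2.2, hP.col t₀ ht₀, fun k ⟨t, ht, e1, e2, e3⟩ => ?_, fun j hj => ?_⟩
    · rcases h1 _ ((hmem _).2 ⟨t, ht, rfl⟩) with h3 | h3
      · exact h3 (congrArg lab e2)
      · rw [← Bool.not_eq_true] at h3
        exact h3 ((touch t ht v hv).2 e3)
    · rcases h2 _ (A.dir_lt j hj) with ⟨q, hq, h3⟩ | ⟨q, hq, h3, h4⟩
      · obtain ⟨u, hu, rfl⟩ := (hmem q).1 hq
        obtain ⟨h5, h6⟩ := (hsame u hu v hv j hj).1 h3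
        exact Or.inl ⟨u.2.2, u, hu, h5, rfl, h6⟩
      · obtain ⟨u, hu, rfl⟩ := (hmem q).1 hq
        rw [← A.enc_flip v j hj] at h4
        exact Or.inr ⟨u.2.1, u, hu, rfl, hinj' _ hu _ ht₀ h3,
          (touch u hu _ (Coding.flipAt_base hj hv)).1 h4⟩
  · right; right
    simp only [parCode, Bool.and_eq_true, beq_iff_eq, List.all_eq_true] at h
    obtain ⟨⟨h1, h2⟩, h3⟩ := h
    refine ⟨h1, fun t ht u hu => ?_, (hfull h2).2⟩
    have := h3 _ ((hmem _).2 ⟨t, ht, rfl⟩) _ ((hmem _).2 ⟨u, hu, rfl⟩)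
    have e : ∀ t ∈ P, (codeLabel A lab t).1 % 4 = A.dir t.2.1 := fun t ht =>
      edgeCode_mod ((A.dir_lt _ (hP.dir t ht)).trans_le hd)
    rw [e t ht, e u hu] at this
    exact A.dir_inj _ (hP.dir t ht) _ (hP.dir u hu) this

/-- If the search succeeds, every proper precolouring of at most `d` edges of the `d`-dimensional
hypercube extends or is obstructed. -/
theorem extends_or_obstructed {B : ColTable} (hB : searchAll B d = true) (hd : 0 < d) (hd' : d ≤ 4)
    (hS : S.card = d) (hT : T.card = d) (hP : Good S T P) (hPd : P.card ≤ d) :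
    Extends S T P ∨ Sat S T P ∨ Blk S T P ∨ Parallel d P := by
  classical
  rcases hPd.lt_or_eq with hlt | hPd'
  · exact Or.inl (extends_of_card_lt hS hT hP hlt)
  obtain ⟨t₀, ht₀⟩ : P.Nonempty := Finset.card_pos.1 (by omega)
  by_cases hb : ∀ t ∈ P, ∀ i, i ∉ S → t.1 i = t₀.1 i
  swap
  · push Not at hb
    obtain ⟨t, ht, i, hi, hne⟩ := hb
    exact Or.inl (extends_of_components hS hT hP hPd ht ht₀ hi hne)
  -- The numbering makes `t₀` the edge that is fixed in the search.
  obtain ⟨A, hA0, hA1⟩ := exists_coding hS t₀.1 (hP.dir t₀ ht₀)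
  set code : Entry ι C → ℕ := fun t => A.code t.1 t.2.1 with hcode
  have hc0 : code t₀ = 0 := by simp [hcode, Coding.code, hA0, hA1, edgeCode]
  have hsame : ∀ t ∈ P, ∀ u ∈ P, code t = code u → t.2.1 = u.2.1 ∧ Touch t u.1 := fun t ht u hu e =>
    A.code_inj hd' (hP.dir t ht) (hP.dir u hu) (hb t ht) (hb u hu) e
  -- Two entries may describe one edge from its two ends. Then one of them is redundant, and fewer
  -- than `d` remain.
  by_cases hdup : ∀ t ∈ P, ∀ u ∈ P, code t = code u → t = u
  swap
  · push Not at hdup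
    obtain ⟨t, ht, u, hu, e, hne⟩ := hdup
    obtain ⟨h1, h2⟩ := hsame t ht u hu e
    left
    obtain ⟨f, hf, hfP⟩ := extends_of_card_lt hS hT (hP.mono (Finset.erase_subset u P))
      (by rw [Finset.card_erase_of_mem hu]; omega)
    refine ⟨f, hf, fun s hs => ?_⟩
    by_cases hsu : s = u
    · rw [hsu, ← h1]
      rw [hf.eq_of_has' hfP (hP.dir t ht)
        (has_of_touch (Finset.mem_erase.2 ⟨hne, ht⟩) h2 : Has (P.erase u) u.1 t.2.1 t.2.2)]
      exact (hP.proper (has_of_touch ht h2) (has_of_mem hu)).1 h1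
    · exact hfP s (Finset.mem_erase.2 ⟨hsu, hs⟩)
  simp only [searchAll, Bool.and_eq_true] at hB
  obtain ⟨hval, hB⟩ := hB
  -- The entries must be visited in the order of `edgeCodes d`.
  set cs := (edgeCodes d).filter fun p => decide (∃ t ∈ P.erase t₀, code t = p) with hcs
  have hcsm : ∀ p, p ∈ cs ↔ ∃ t ∈ P.erase t₀, code t = p := fun p => by
    simp only [hcs, List.mem_filter, decide_eq_true_eq, and_iff_right_iff_imp]
    rintro ⟨t, ht, rfl⟩
    obtain ⟨h1, h2⟩ := Finset.mem_erase.1 ht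
    exact A.code_mem hd' (hP.dir t h2) fun e => h1 (hdup t h2 t₀ ht₀ (e.trans hc0.symm))
  have hnd : (edgeCodes d).Nodup := List.nodup_range.filter _
  have hcsnd : cs.Nodup := hnd.filter _
  have hlen : cs.length = d - 1 := by
    rw [← List.toFinset_card_of_nodup hcsnd, ← hPd', ← Finset.card_erase_of_mem ht₀,
      ← Finset.card_image_of_injOn (s := P.erase t₀) (f := code)
        (fun t ht u hu e => hdup t (Finset.mem_of_mem_erase ht) u (Finset.mem_of_mem_erase hu) e)]
    congr 1
    ext p
    simp [hcsm]
  have hinv : ∀ p, ∃ t, p ∈ cs → t ∈ P.erase t₀ ∧ code t = p := fun p => by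
    by_cases hp : p ∈ cs
    · obtain ⟨t, ht⟩ := (hcsm p).1 hp
      exact ⟨t, fun _ => ht⟩
    · exact ⟨t₀, fun h => (hp h).elim⟩
  choose inv hinv using hinv
  have hmapc : (cs.map inv).map code = cs := by
    rw [List.map_map]
    conv_rhs => rw [← List.map_id cs]
    exact List.map_congr_left fun p hp => (hinv p hp).2
  set l := t₀ :: cs.map inv with hldef
  have hl : ∀ t, t ∈ l ↔ t ∈ P := fun t => by
    simp only [hldef, List.mem_cons, List.mem_map]
    constructor
    · rintro (rfl | ⟨p, hp, rfl⟩)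
      · exact ht₀
      · exact Finset.mem_of_mem_erase (hinv p hp).1
    · intro ht
      by_cases e : t = t₀
      · exact Or.inl e
      · have h1 : code t ∈ cs := (hcsm _).2 ⟨t, Finset.mem_erase.2 ⟨e, ht⟩, rfl⟩
        have h2 := hinv _ h1
        exact Or.inr ⟨code t, h1, hdup _ (Finset.mem_of_mem_erase h2.1) t ht h2.2⟩
  -- The code of the first entry with the color, as in the search. The default `0` concerns only
  -- colors that do not occur.
  set lab : C → ℕ := fun c => ((l.find? fun t => decide (t.2.2 = c)).map code).getD 0 with hlab
  have hfind : ∀ t ∈ P, ∃ u ∈ P, u.2.2 = t.2.2 ∧ lab t.2.2 = code u := fun t ht => by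
    have h1 : (l.find? fun u => decide (u.2.2 = t.2.2)).isSome := by
      rw [List.find?_isSome]; exact ⟨t, (hl t).2 ht, by simp⟩
    obtain ⟨u, hu⟩ := Option.isSome_iff_exists.1 h1
    exact ⟨u, (hl u).1 (List.mem_of_find?_eq_some hu), by simpa using List.find?_some hu,
      by simp [hlab, hu]⟩
  have hinj : ∀ t ∈ l, ∀ u ∈ l, lab t.2.2 = lab u.2.2 → t.2.2 = u.2.2 := fun t ht u hu e => by
    obtain ⟨t', h1, h2, h3⟩ := hfind t ((hl t).1 ht)
    obtain ⟨u', h1', h2', h3'⟩ := hfind u ((hl u).1 hu)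
    rw [h3, h3'] at e
    rw [← h2, ← h2', hdup t' h1 u' h1' e]
  have hnodup : l.Nodup := by
    refine List.nodup_cons.2 ⟨fun h => ?_, ?_⟩
    · obtain ⟨p, hp, e⟩ := List.mem_map.1 h
      exact (Finset.mem_erase.1 (hinv p hp).1).1 e
    · exact List.Nodup.of_map code (by rwa [hmapc])
  have himp : ∀ us t ts, l = us ++ t :: ts →
      improperCode (A.code t.1 t.2.1) (lab t.2.2) (us.reverse.map (codeLabel A lab)) = false := by
    intro us t ts hus
    rw [← Bool.not_eq_true]
    intro h
    have ht : t ∈ P := (hl t).1 (by simp [hus])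
    have htS := hP.dir t ht
    simp only [improperCode, List.any_eq_true, List.mem_map, List.mem_reverse, Bool.and_eq_true,
      Nat.beq_eq, Bool.or_eq_true] at h
    obtain ⟨q, ⟨u, hu, rfl⟩, h1, h2⟩ := h
    have hu' : u ∈ P := (hl u).1 (by simp [hus, hu])
    have hcol : u.2.2 = t.2.2 := hinj u ((hl u).2 hu') t ((hl t).2 ht) h1
    have hne : u ≠ t := by
      rintro rfl
      rw [hus] at hnodup
      exact (List.nodup_append.1 hnodup).2.2 u hu u (by simp) rfl
    have h3 : ∃ w, Touch u w ∧ Touch t w := by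
      have e1 : Nat.div (A.code t.1 t.2.1) 4 = _ := edgeCode_div ((A.dir_lt _ htS).trans_le hd')
      have e2 : Nat.mod (A.code t.1 t.2.1) 4 = A.dir t.2.1 :=
        edgeCode_mod ((A.dir_lt _ htS).trans_le hd')
      have key : ∀ w, (∀ i, i ∉ S → w i = t₀.1 i) → ∀ x, x = A.enc w →
          touchCode (codeLabel A lab u).1 x = true → Touch u w := by
        rintro w hw _ rfl h
        exact (A.touchCode_iff hd' (hP.dir u hu') (hb u hu') hw).1 h
      have k1 := key t.1 (hb t ht)
      have k2 := key _ (Coding.flipAt_base htS (hb t ht))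
      rw [e1, e2] at h2
      have e3 := A.enc_flip t.1 _ htS
      have e4 : (A.enc t.1 ^^^ 2 ^ A.dir t.2.1 : ℕ).xor (2 ^ A.dir t.2.1) = A.enc t.1 := by
        change ((A.enc t.1 ^^^ 2 ^ A.dir t.2.1) ^^^ 2 ^ A.dir t.2.1 : ℕ) = _
        rw [Nat.xor_assoc, Nat.xor_self, Nat.xor_zero]
      split_ifs at h2 with hbit
      · rcases h2 with h2 | h2
        · exact ⟨_, k2 _ e3.symm h2, touch_flip t⟩
        · exact ⟨_, k1 _ e4 h2, touch_fst t⟩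
      · rcases h2 with h2 | h2
        · exact ⟨_, k1 _ rfl h2, touch_fst t⟩
        · exact ⟨_, k2 _ e3.symm h2, touch_flip t⟩
    obtain ⟨w, hw1, hw2⟩ := h3
    have h4 := (hP.proper (has_of_touch hu' hw1) (has_of_touch ht hw2)).2 hcol
    refine hne (hdup u hu' t ht ?_)
    rcases hw1.eq_or (touch_fst u) with h5 | h5 <;> rcases hw2.eq_or (touch_fst t) with h6 | h6 <;>
      simp only [hcode] <;> rw [h5, h6, ← h4] <;> simp only [A.code_flipAt (hP.dir u hu')]
  have hstart := search_sound (l := l) A B hinj (fun us t ts hus => by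
    by_cases hold : ∃ u ∈ us, u.2.2 = t.2.2
    · exact Or.inl hold
    · right
      have : us.find? (fun u => decide (u.2.2 = t.2.2)) = none := by
        rw [List.find?_eq_none]
        intro u hu h
        exact hold ⟨u, hu, by simpa using h⟩
      simp [hlab, hus, List.find?_append, this, hcode]) himp (edgeCodes d) (d - 1) [0] [t₀]
    (cs.map inv) B.full (by
      have : lab t₀.2.2 = 0 := by simp [hlab, hldef, hc0]
      have e : codeLabel A lab t₀ = (0, 0) := Prod.ext hc0 this
      simpa [e] using hB)
    (by change ((cs.map inv).map code).Sublist _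
        rw [hmapc]; exact List.filter_sublist) (by simp [hlen]) rfl
    ⟨by simp, fun x => by
      have : lab t₀.2.2 = 0 := by simp [hlab, hldef, hc0]
      simp [this, eq_comm]⟩
    (fun k hk => ⟨(B.full_testBit k).1 hk, by simp⟩)
  rcases hstart with ⟨k, hk, hfit⟩ | ⟨ls, hls, hbad⟩
  · exact Or.inl (extends_of_table A hval hT hP hk
      (fun t ht u hu => hfit t ((hl t).2 ht) u ((hl u).2 hu)) hd)
  · exact Or.inr (obstructed_of_badCode A hd' hT hP hPd hb hl hinj hls hbad)

theorem extends_or_obstructed_of_le_four (hd : 0 < d) (hd' : d ≤ 4) (hS : S.card = d)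
    (hT : T.card = d) (hP : Good S T P) (hPd : P.card ≤ d) :
    Extends S T P ∨ Sat S T P ∨ Blk S T P ∨ Parallel d P := by
  obtain ⟨B, hB⟩ : ∃ B, searchAll B d = true := by
    interval_cases d
    exacts [⟨_, searchAll_one⟩, ⟨_, searchAll_two⟩, ⟨_, searchAll_three⟩, ⟨_, searchAll_four⟩]
  exact extends_or_obstructed hB hd hd' hS hT hP hPd

end SmallDimension

/-! ### Exchange and crossing constructions -/

section Tools

variable {ι C : Type*} [DecidableEq ι] {S : Finset ι} {T : Finset C}
  {P : Finset (Entry ι C)}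

/-- No edge occurs in two entries. -/
def Simple (P : Finset (Entry ι C)) : Prop :=
  ∀ t ∈ P, ∀ u ∈ P, ∀ v, Touch t v → Touch u v → t.2.1 = u.2.1 → t = u

theorem Simple.eq_of_color (h : Simple P) (hP : Good S T P) {t u : Entry ι C} (ht : t ∈ P)
    (hu : u ∈ P) {v : ι → Bool} (h1 : Touch t v) (h2 : Touch u v) (hc : t.2.2 = u.2.2) : t = u :=
  h t ht u hu v h1 h2 ((hP.proper (has_of_touch ht h1) (has_of_touch hu h2)).2 hc)

/-- A second entry for the same edge is redundant, and without it `extends_of_card_lt` applies. -/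
theorem extends_of_not_simple [Fintype ι] [DecidableEq C] {n : ℕ} (hS : S.card = n) (hT : T.card = n)
    (hP : Good S T P) (hn : P.card ≤ n) (h : ¬ Simple P) : Extends S T P := by
  simp only [Simple, not_forall] at h
  obtain ⟨t, ht, u, hu, v, h1, h2, h3, hne⟩ := h
  have hlt : (P.erase u).card < n := by
    have := Finset.card_pos.2 ⟨u, hu⟩
    rw [Finset.card_erase_of_mem hu]; omega
  obtain ⟨f, hf, hfP⟩ := extends_of_card_lt hS hT (hP.mono (Finset.erase_subset u P)) hlt
  have hv : f v t.2.1 = t.2.2 :=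
    hf.eq_of_has' hfP (hP.dir t ht) (has_of_touch (Finset.mem_erase.2 ⟨hne, ht⟩) h1)
  refine ⟨f, hf, fun s hs => ?_⟩
  by_cases hsu : s = u
  · rw [hsu, ← (hP.proper (has_of_touch ht h1) (has_of_touch hu h2)).1 h3, ← hv, h3]
    rcases h2.eq_or (touch_fst u) with e | e <;> rw [e]
    rw [hf.symm _ _ (hP.dir u hu)]
  · exact hfP s (Finset.mem_erase.2 ⟨hsu, hs⟩)

/-- If all colours are different, a blocked vertex gives a saturated edge. -/
theorem sat_of_blk (hST : S.card = T.card) (hP : Good S T P) (hcard : P.card ≤ T.card)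
    (hinj : ∀ t ∈ P, ∀ u ∈ P, t.2.2 = u.2.2 → t = u) (h : Blk S T P) : Sat S T P := by
  classical
  obtain ⟨u, c, hc, h0, h1⟩ := h
  obtain ⟨a1, a2, a3⟩ := blk_struct (hST ▸ hcard) h0 h1
  have himg : P.image (fun t => t.2.2) = T := by
    refine Finset.eq_of_subset_of_card_le (fun x hx => ?_) ?_
    · obtain ⟨t, ht, rfl⟩ := Finset.mem_image.1 hx; exact hP.col t ht
    · rw [Finset.card_image_of_injOn fun t ht u hu => hinj t ht u hu, a3, hST]
  have hcol : ∀ x ∈ T, ∃ t ∈ P, t.2.2 = x := fun x hx => by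
    rw [← himg] at hx; exact Finset.mem_image.1 hx
  -- The only entry of color `c` sits at a neighbour of `u`, and all other entries are at `u`. The
  -- edge from `u` to this neighbour is saturated.
  obtain ⟨t₀, ht₀, hc₀⟩ := hcol c hc
  have hn : ¬ Touch t₀ u := fun h => h0 _ ⟨t₀, ht₀, rfl, hc₀, h⟩
  obtain ⟨j, hj, hit⟩ := a1 t₀ ht₀
  have hj' := hit.resolve_left fun h => hn h.1
  refine ⟨u, j, hj, fun x ⟨t, ht, e1, _, e3⟩ => hn ?_, fun x hx => ?_⟩
  · rwa [← a2 t ht t₀ ht₀ j hj (Or.inl ⟨e3, e1⟩) hit]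
  · obtain ⟨t, ht, rfl⟩ := hcol x hx
    by_cases e : t = t₀
    · exact ⟨t.2.1, Or.inr (has_of_touch ht (e ▸ hj'.2))⟩
    · obtain ⟨k, hk, h2⟩ := a1 t ht
      have h3 : Touch t u := h2.elim (fun h => h.1) fun h =>
        (e (hinj t ht t₀ ht₀ (h.1.trans hc₀.symm))).elim
      exact ⟨t.2.1, Or.inl (has_of_touch ht h3)⟩

/-- Two edges at `a` that are adjacent to the edge at `w` in direction `k`. -/
theorem end_of_two_adjacent {t₁ t₂ : Entry ι C} {a w : ι → Bool} {k : ι} (h : t₁.2.1 ≠ t₂.2.1)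
    (h1 : Touch t₁ a) (h2 : Touch t₂ a) (w1 : Touch t₁ w ∨ Touch t₁ (flipAt k w))
    (w2 : Touch t₂ w ∨ Touch t₂ (flipAt k w)) : a = w ∨ a = flipAt k w := by
  by_contra hcon
  push Not at hcon
  have key : ∀ t : Entry ι C, Touch t a → (Touch t w ∨ Touch t (flipAt k w)) →
      w = flipAt t.2.1 a ∨ w = flipAt k (flipAt t.2.1 a) := by
    rintro t ht (h | h)
    · exact (ht.eq_or h).elim (fun e => (hcon.1 e.symm).elim) Or.inl
    · rcases ht.eq_or h with e | e
      · exact (hcon.2 e.symm).elim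
      · exact Or.inr (by rw [← e, flipAt_flipAt])
  rcases key t₁ h1 w1 with e1 | e1 <;> rcases key t₂ h2 w2 with e2 | e2
  · exact h (flipAt_eq_flipAt.1 (e1.symm.trans e2))
  · exact flipAt_flipAt_ne _ _ _ _ (e2.symm.trans e1)
  · exact flipAt_flipAt_ne _ _ _ _ (e1.symm.trans e2)
  · exact h (flipAt_eq_flipAt.1 ((flipAt_inj k).1 (e1.symm.trans e2)))

/-- No edge joins two neighbours of a vertex. -/
theorem not_touch_flipAt_flipAt {t : Entry ι C} {z : ι → Bool} {j k : ι} (hjk : j ≠ k)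
    (h1 : Touch t (flipAt j z)) (h2 : Touch t (flipAt k z)) : False := by
  rcases h1.eq_or h2 with e | e
  · exact hjk (flipAt_eq_flipAt.1 e).symm
  · exact flipAt_flipAt_ne _ _ _ _ e.symm

theorem touch_setAt {i : ι} {t : Entry ι C} (hti : t.2.1 = i) (b : Bool) :
    Touch t (setAt i b t.1) := by
  by_cases e : t.1 i = b
  · rw [setAt_of_eq e]; exact touch_fst t
  · rw [setAt_of_ne e, ← hti]; exact touch_flip t

variable [Fintype ι] [DecidableEq C]

/-- One side of the precolouring after the exchange of the colour of the entry `g` for `x`. -/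
def exchangeSide (P : Finset (Entry ι C)) (i : ι) (g : Entry ι C) (x : C) (b : Bool) :
    Finset (Entry ι C) :=
  insert (setAt i b g.1, g.2.1, x) (P.filter fun t => t ≠ g ∧ t.2.1 ≠ i ∧ t.1 i = b)

/-- By `hadj` the color `x` is absent at the ends of `g` and of its mirror image, apart from
direction `i`. By `hc` all other entries of the deleted color lie in direction `i` and need no place
on the sides. -/
theorem good_exchangeSide {i : ι} {g : Entry ι C} {x : C} (hP : Good S T P) (hsP : Simple P)
    (hg : g ∈ P) (hgi : g.2.1 ≠ i) (hc : ∀ t ∈ P, t.2.2 = g.2.2 → t = g ∨ t.2.1 = i)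
    (hmir : ∀ y, ¬ Has P (flipAt i g.1) g.2.1 y) (hx : x ∈ T) (hxg : x ≠ g.2.2)
    (hadj : ∀ t ∈ P, t.2.1 ≠ i → t.2.2 = x → ∀ v, Touch g v → ¬ Touch t v ∧ ¬ Touch t (flipAt i v))
    (b : Bool) : Good (S.erase i) (T.erase g.2.2) (exchangeSide P i g x b) := by
  have hset : ∀ v, setAt i b v = v ∨ setAt i b v = flipAt i v := fun v => by
    by_cases e : v i = b
    · exact Or.inl (setAt_of_eq e)
    · exact Or.inr (setAt_of_ne e)
  have hadj' : ∀ v, Touch g v → ∀ k, ¬ Has (P.filter fun t => t ≠ g ∧ t.2.1 ≠ i ∧ t.1 i = b)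
      (setAt i b v) k x := by
    rintro v hv k ⟨t, ht, -, e, h⟩
    rw [Finset.mem_filter] at ht
    obtain ⟨h1, h2⟩ := hadj t ht.1 ht.2.2.1 e v hv
    rcases hset v with e' | e' <;> rw [e'] at h
    exacts [h1 h, h2 h]
  refine Good.insert (hP.filter_side fun t ht h => ⟨h.2.1, fun e => ?_⟩)
    (Finset.mem_erase.2 ⟨hgi, hP.dir g hg⟩) (Finset.mem_erase.2 ⟨hxg, hx⟩) ?_ ?_ ?_
  · exact (hc t ht e).elim h.1 h.2.1
  · rintro y ⟨t, ht, e1, -, h⟩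
    rw [Finset.mem_filter] at ht
    rcases hset g.1 with e' | e' <;> rw [e'] at h
    · exact (ht.2.1 (hsP t ht.1 g hg _ h (touch_fst g) e1)).elim
    · exact (hmir _ ⟨t, ht.1, e1, rfl, h⟩).elim
  · exact fun k h => (hadj' _ (touch_fst g) k h).elim
  · rw [← setAt_flipAt hgi]
    exact fun k h => (hadj' _ (touch_flip g) k h).elim

/-- The `i`-edges first get the color of `g`, while `g` and its mirror image get `x`. Exchanging
around their square returns to `g` its own color and moves `x` to the `i`-edges at its ends. A
precolored mirror image would be overwritten, hence `hmir`. -/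
theorem extends_of_exchange {i : ι} {g : Entry ι C} {x : C} (hP : Good S T P) (hsP : Simple P)
    (hi : i ∈ S) (hg : g ∈ P) (hgi : g.2.1 ≠ i) (hdir : ∀ t ∈ P, t.2.1 = i → t.2.2 = g.2.2)
    (hmir : ∀ y, ¬ Has P (flipAt i g.1) g.2.1 y)
    (hQ : ∀ b, Extends (S.erase i) (T.erase g.2.2) (exchangeSide P i g x b)) : Extends S T P := by
  have hgR : ∀ v, Has ({g} : Finset (Entry ι C)) v g.2.1 g.2.2 ↔ Touch g v := fun v => by
    simp [Has]
  refine extends_of_sides (R := {g}) hi (hP.col g hg) (g.1 i) hQ ?_ ?_ ?_ ?_ hP.dir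
  · exact (hP.mono (Finset.singleton_subset_iff.2 hg)).weaken (by simp [hgi, hP.dir g hg]) (by simp)
  · rintro t ht
    rw [Finset.mem_singleton] at ht
    subst ht
    exact ⟨x, fun b => has_of_mem (t := (setAt i b t.1, t.2.1, x)) (Finset.mem_insert_self _ _)⟩
  · intro t ht hti
    by_cases e : t = g
    · subst e
      exact Or.inl ⟨by rw [setAt_self]; exact (hgR _).2 (touch_fst t), rfl⟩
    · refine Or.inr ⟨?_, t, Finset.mem_insert_of_mem (Finset.mem_filter.2 ⟨ht, e, hti, rfl⟩), rfl,
        rfl, touch_fst t⟩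
      rintro ⟨u, hu, e1, -, h⟩
      rw [Finset.mem_singleton] at hu
      subst hu
      by_cases hs : t.1 i = u.1 i
      · rw [setAt_of_eq hs] at h
        exact e (hsP t ht u hg _ (touch_fst t) h e1.symm)
      · rw [setAt_of_ne hs] at h
        refine hmir t.2.2 ⟨t, ht, e1.symm, rfl, ?_⟩
        rcases h.eq_or (touch_fst u) with h' | h'
        · rw [h', flipAt_flipAt]; exact touch_fst t
        · rw [h', e1, flipAt_comm, flipAt_flipAt]; exact touch_flip t
  · intro t ht hti
    refine Or.inl ⟨hdir t ht hti, ?_⟩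
    rintro k ⟨u, hu, -, -, h⟩
    rw [Finset.mem_singleton] at hu
    subst hu
    have h1 : Touch t (setAt i (u.1 i) t.1) := by
      by_cases e : t.1 i = u.1 i
      · rw [setAt_of_eq e]; exact touch_fst t
      · rw [setAt_of_ne e, ← hti]; exact touch_flip t
    have := hsP.eq_of_color hP ht hg h1 h (hdir t ht hti)
    exact hgi (this ▸ hti)

/-- One side of the precolouring, where the entries in direction `i` are replaced by entries of
colour `x` in direction `k`. -/
def crossSide (P : Finset (Entry ι C)) (i k : ι) (x : C) (b : Bool) : Finset (Entry ι C) :=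
  (P.filter fun t => t.2.1 ≠ i ∧ t.1 i = b) ∪
    (P.filter fun t => t.2.1 = i).image fun t => (setAt i b t.1, k, x)

/-- `hfree` says that the `k`-edges at the ends of an entry in direction `i` are uncolored and have
no `x` at their far ends, so that both can take `x`. -/
theorem good_crossSide {i k : ι} {x c₀ : C} (hP : Good S T P) (hki : k ≠ i)
    (hdir : ∀ t ∈ P, t.2.1 = i → t.2.2 = x)
    (hfree : ∀ t ∈ P, t.2.1 = i → ∀ v, Touch t v →
      (∀ y, ¬ Has P v k y) ∧ ∀ j, ¬ Has P (flipAt k v) j x)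
    (hk : k ∈ S) (hx : x ∈ T) (hxc : x ≠ c₀) (hc₀ : ∀ t ∈ P, t.2.2 ≠ c₀) (b : Bool) :
    Good (S.erase i) (T.erase c₀) (crossSide P i k x b) := by
  have hA : Good (S.erase i) (T.erase c₀) (P.filter fun t => t.2.1 ≠ i ∧ t.1 i = b) :=
    hP.filter_side fun t ht h => ⟨h.1, hc₀ t ht⟩
  have himg : ∀ {v j c}, Has ((P.filter fun t => t.2.1 = i).image fun t => (setAt i b t.1, k, x))
      v j c → ∃ t ∈ P, t.2.1 = i ∧ j = k ∧ c = x ∧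
        Touch ((setAt i b t.1, k, x) : Entry ι C) v := by
    rintro v j c ⟨_, hu, rfl, rfl, h⟩
    obtain ⟨t, ht, rfl⟩ := Finset.mem_image.1 hu
    obtain ⟨h1, h2⟩ := Finset.mem_filter.1 ht
    exact ⟨t, h1, h2, rfl, rfl, h⟩
  have key : ∀ {v j c t}, Has (P.filter fun t => t.2.1 ≠ i ∧ t.1 i = b) v j c → t ∈ P →
      t.2.1 = i → Touch ((setAt i b t.1, k, x) : Entry ι C) v → j ≠ k ∧ c ≠ x := by
    intro v j c t h ht hti hv
    obtain ⟨h1, h2⟩ := hfree t ht hti _ (touch_setAt hti b)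
    have hj : j ≠ i := by
      obtain ⟨u, hu, rfl, -, -⟩ := h
      exact (Finset.mem_filter.1 hu).2.1
    have h' : Has P v j c := h.mono (Finset.filter_subset _ _)
    rcases hv with rfl | rfl
    · refine ⟨by rintro rfl; exact h1 _ h', ?_⟩
      rintro rfl
      refine hj ((hP.proper h' ?_).2 rfl)
      exact ⟨t, ht, hti, hdir t ht hti, touch_setAt hti b⟩
    · refine ⟨by rintro rfl; exact h1 _ (has_flip.1 h'), ?_⟩
      rintro rfl
      exact h2 _ h'
  refine ⟨fun t ht => ?_, fun t ht => ?_, fun {v j l c c'} h1 h2 => ?_⟩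
  · rcases Finset.mem_union.1 ht with ht | ht
    · exact hA.dir t ht
    · obtain ⟨u, -, rfl⟩ := Finset.mem_image.1 ht
      exact Finset.mem_erase.2 ⟨hki, hk⟩
  · rcases Finset.mem_union.1 ht with ht | ht
    · exact hA.col t ht
    · obtain ⟨u, -, rfl⟩ := Finset.mem_image.1 ht
      exact Finset.mem_erase.2 ⟨hxc, hx⟩
  · rw [crossSide, has_union] at h1 h2
    rcases h1 with h1 | h1 <;> rcases h2 with h2 | h2
    · exact hA.proper h1 h2
    · obtain ⟨t, ht, hti, rfl, rfl, hv⟩ := himg h2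
      obtain ⟨a, b⟩ := key h1 ht hti hv
      exact iff_of_false a b
    · obtain ⟨t, ht, hti, rfl, rfl, hv⟩ := himg h1
      obtain ⟨a, b⟩ := key h2 ht hti hv
      exact iff_of_false a.symm b.symm
    · obtain ⟨t, ht, hti, rfl, rfl, hv⟩ := himg h1
      obtain ⟨t', ht', hti', rfl, rfl, hv'⟩ := himg h2
      simp

/-- The unused color `c₀` becomes the color of direction `i`. The entries in that direction recover
`x` by exchange with `k`-edges colored `x` on both sides. -/
theorem extends_of_cross {i k : ι} {x c₀ : C} (hP : Good S T P) (hki : k ≠ i)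
    (hdir : ∀ t ∈ P, t.2.1 = i → t.2.2 = x)
    (hfree : ∀ t ∈ P, t.2.1 = i → ∀ v, Touch t v →
      (∀ y, ¬ Has P v k y) ∧ ∀ j, ¬ Has P (flipAt k v) j x)
    (hi : i ∈ S) (hk : k ∈ S) (hc : c₀ ∈ T)
    (hQ : ∀ b, Extends (S.erase i) (T.erase c₀) (crossSide P i k x b)) : Extends S T P := by
  set R : Finset (Entry ι C) := (P.filter fun t => t.2.1 = i).image fun t => (setAt i true t.1, k, c₀)
    with hR
  have memR : ∀ {u}, u ∈ R ↔ ∃ t ∈ P, t.2.1 = i ∧ (setAt i true t.1, k, c₀) = u := fun {u} => by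
    simp [hR, and_assoc]
  have memQ : ∀ {t} b, t ∈ P → t.2.1 = i →
      (setAt i b t.1, k, x) ∈ crossSide P i k x b := fun {t} b ht hti =>
    Finset.mem_union_right _ (Finset.mem_image.2 ⟨t, Finset.mem_filter.2 ⟨ht, hti⟩, rfl⟩)
  refine extends_of_sides (R := R) hi hc true hQ ⟨?_, ?_, ?_⟩ ?_ ?_ ?_ hP.dir
  · intro u hu
    obtain ⟨t, -, -, rfl⟩ := memR.1 hu
    exact Finset.mem_erase.2 ⟨hki, hk⟩
  · intro u hu
    obtain ⟨t, -, -, rfl⟩ := memR.1 hu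
    simp
  · rintro v j l c c' ⟨u, hu, rfl, rfl, -⟩ ⟨u', hu', rfl, rfl, -⟩
    obtain ⟨t, -, -, rfl⟩ := memR.1 hu
    obtain ⟨t', -, -, rfl⟩ := memR.1 hu'
    simp
  · intro u hu
    obtain ⟨t, ht, hti, rfl⟩ := memR.1 hu
    refine ⟨x, fun b => ?_⟩
    simp only [setAt_setAt]
    exact has_of_mem (memQ b ht hti)
  · intro t ht hti
    refine Or.inr ⟨?_, t, Finset.mem_union_left _ (Finset.mem_filter.2 ⟨ht, hti, rfl⟩), rfl, rfl,
      touch_fst t⟩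
    rintro ⟨u, hu, e1, -, h⟩
    obtain ⟨t', ht', hti', rfl⟩ := memR.1 hu
    simp only at e1
    have h' : Touch ((setAt i (t.1 i) t'.1, k, c₀) : Entry ι C) t.1 := by
      rcases h with h | h <;> simp only at h
      · left; have := congrArg (setAt i (t.1 i)) h; simpa using this
      · right; have := congrArg (setAt i (t.1 i)) h; simpa [setAt_flipAt hki] using this
    have h2 := (hfree t' ht' hti' _ (touch_setAt hti' (t.1 i))).1 t.2.2
    rcases h' with h' | h' <;> simp only at h'
    · rw [← h', e1] at h2
      exact h2 (has_of_mem ht)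
    · apply h2
      rw [← has_flip, ← h', e1]
      exact has_of_mem ht
  · intro t ht hti
    refine Or.inr ⟨k, has_of_mem (memR.2 ⟨t, ht, hti, rfl⟩), ?_⟩
    rw [hdir t ht hti]
    have := has_of_mem (memQ (t.1 i) ht hti)
    simpa using this

end Tools

/-! ### Counting elements outside a subset -/

section Counting

variable {α : Type*} {A P : Finset α}

theorem card_add_one_le (h : A ⊆ P) {t : α} (ht : t ∈ P) (ht' : t ∉ A) : A.card + 1 ≤ P.card :=
  Finset.card_lt_card ((Finset.ssubset_iff_of_subset h).2 ⟨t, ht, ht'⟩)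

theorem card_add_two_le (h : A ⊆ P) {t u : α} (ht : t ∈ P) (ht' : t ∉ A) (hu : u ∈ P) (hu' : u ∉ A)
    (hne : t ≠ u) : A.card + 2 ≤ P.card := by
  classical
  have h1 : insert t A ⊆ P := Finset.insert_subset ht h
  have h2 := card_add_one_le h1 hu (by simp [hu', hne.symm])
  rw [Finset.card_insert_of_notMem ht'] at h2
  omega

end Counting

/-! ### Induction step: an entry alone in its direction -/

section Step

variable {ι C : Type*} [DecidableEq ι] [DecidableEq C]

/-- Every precolouring of at most `n` edges of an `n`-dimensional hypercube that has neither a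
saturated edge nor a blocked vertex extends. -/
def ExtendsAt (ι C : Type*) [DecidableEq ι] (n : ℕ) : Prop :=
  ∀ (S : Finset ι) (T : Finset C) (P : Finset (Entry ι C)), S.card = n → T.card = n → Good S T P →
    P.card ≤ n → ¬ Sat S T P → ¬ Blk S T P → Extends S T P

variable {S : Finset ι} {T : Finset C} {P Q : Finset (Entry ι C)} {n : ℕ}

theorem ExtendsAt.erase (hB : ExtendsAt ι C n) (hS : S.card = n + 1) (hT : T.card = n + 1) {i : ι}
    (hi : i ∈ S) {c : C} (hc : c ∈ T) (hQ : Good (S.erase i) (T.erase c) Q) (hn : Q.card ≤ n)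
    (h1 : ¬ Sat (S.erase i) (T.erase c) Q) (h2 : ¬ Blk (S.erase i) (T.erase c) Q) :
    Extends (S.erase i) (T.erase c) Q :=
  hB _ _ _ (by rw [Finset.card_erase_of_mem hi, hS]; rfl)
    (by rw [Finset.card_erase_of_mem hc, hT]; rfl) hQ hn h1 h2

theorem extends_erase_of_card_lt (hS : S.card = n + 1) (hT : T.card = n + 1) {i : ι}
    (hi : i ∈ S) {c : C} (hc : c ∈ T) (hQ : Good (S.erase i) (T.erase c) Q) (hn : Q.card < n) :
    Extends (S.erase i) (T.erase c) Q :=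
  extends_of_card_lt (by rw [Finset.card_erase_of_mem hi, hS]; rfl)
    (by rw [Finset.card_erase_of_mem hc, hT]; rfl) hQ hn

variable [Fintype ι]

/-- The colour of `e` and the direction of `e` occur only once, some colour occurs twice. -/
theorem extends_of_unique_color (hS : S.card = n + 1) (hT : T.card = n + 1) (hP : Good S T P)
    (hPn : P.card ≤ n + 1) (hblk : ¬ Blk S T P) {e : Entry ι C} (he : e ∈ P)
    (hdir : ∀ t ∈ P, t.2.1 = e.2.1 → t = e) (hcol : ∀ t ∈ P, t.2.2 = e.2.2 → t = e)
    {t₁ t₂ : Entry ι C} (h1 : t₁ ∈ P) (h2 : t₂ ∈ P) (hne : t₁ ≠ t₂) (h12 : t₁.2.2 = t₂.2.2) :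
    Extends S T P := by
  obtain ⟨i, hi⟩ : ∃ i, e.2.1 = i := ⟨_, rfl⟩
  obtain ⟨x, hx⟩ : ∃ x, e.2.2 = x := ⟨_, rfl⟩
  obtain ⟨c, hc⟩ : ∃ c, t₂.2.2 = c := ⟨_, rfl⟩
  rw [hc] at h12
  have hiS : i ∈ S := hi ▸ hP.dir e he
  have hxT : x ∈ T := hx ▸ hP.col e he
  have hcT : c ∈ T := hc ▸ hP.col _ h2
  have hxc : x ≠ c := by
    rintro rfl
    exact hne ((hcol _ h1 (h12.trans hx.symm)).trans (hcol _ h2 (hc.trans hx.symm)).symm)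
  -- If the other entries occupy both sides, `x` becomes the color of direction `i`, and each side
  -- keeps at most `n - 1` entries.
  by_cases hone : ∃ s, ∀ t ∈ P, t ≠ e → t.1 i = s
  swap
  · push Not at hone
    refine extends_of_split hP hiS hxT (fun t ht hti => ?_) fun b => ?_
    · rw [hdir t ht (hti.trans hi.symm), hx]
    · refine extends_erase_of_card_lt hS hT hiS hxT (hP.filter_side fun t ht h => ⟨h.1, fun hc => ?_⟩)
        ?_
      · exact h.1 (by rw [hcol t ht (hc.trans hx.symm), hi])
      · obtain ⟨t, ht, hte, htb⟩ := hone b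
        have := card_add_two_le (Finset.filter_subset (fun t => t.2.1 ≠ i ∧ t.1 i = b) P) he
          (by simp [hi]) ht (by simp [htb]) hte.symm
        omega
  obtain ⟨s, hs⟩ := hone
  obtain ⟨y, hy⟩ : ∃ y, setAt i s e.1 = y := ⟨_, rfl⟩
  have hey : Touch e y := hy ▸ touch_setAt hi s
  -- Now `c` becomes the color of direction `i`, and `e` must get `x` by an exchange at its end `y`.
  -- The partner is the edge at `y` colored `c`, or else an uncolored edge that may take `c`; one
  -- exists because `y` is not blocked.
  obtain ⟨k, hkS, hk1, hk2, hk3⟩ : ∃ k ∈ S.erase i, (∀ z, Has P y k z → z = c) ∧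
      (∀ l, Has P y l c → l = k) ∧ ∀ l, Has P (flipAt k y) l c → l = k := by
    by_cases hyc : ∃ k, Has P y k c
    · obtain ⟨k, hk⟩ := hyc
      refine ⟨k, Finset.mem_erase.2 ⟨?_, hP.dir_mem hk⟩, fun z hz => (hP.proper hz hk).1 rfl,
        fun l hl => (hP.proper hl hk).2 rfl, fun l hl => (hP.proper hl hk.symm).2 rfl⟩
      rintro rfl
      exact hxc ((hP.proper (hx ▸ has_of_touch he hey) hk).1 hi)
    · push Not at hyc
      have : ∃ k ∈ S, (∀ z, ¬ Has P y k z) ∧ ∀ l, ¬ Has P (flipAt k y) l c := by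
        by_contra hcon
        push Not at hcon
        refine hblk ⟨y, c, hcT, hyc, fun j hj => ?_⟩
        by_cases h' : ∃ x, Has P y j x
        · exact Or.inl h'
        · push Not at h'
          exact Or.inr (hcon j hj h')
      obtain ⟨k, hk, k1, k2⟩ := this
      refine ⟨k, Finset.mem_erase.2 ⟨?_, hk⟩, fun z hz => (k1 z hz).elim,
        fun l hl => (hyc l hl).elim, fun l hl => (k2 l hl).elim⟩
      rintro rfl
      exact k1 _ (hi ▸ has_of_touch he hey)
  set K := P.filter fun t => t ≠ e ∧ t.2.2 ≠ c with hK
  have hKg : Good (S.erase i) (T.erase c) K :=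
    hP.filter_side fun t ht h => ⟨fun h' => h.1 (hdir t ht (h'.trans hi.symm)), h.2⟩
  have hMg : Good (S.erase i) {c} (P.filter fun t => t.2.2 = c) :=
    (hP.mono (Finset.filter_subset _ _)).weaken (fun t ht => by
      rw [Finset.mem_filter] at ht
      refine Finset.mem_erase.2 ⟨fun h' => hxc ?_, hP.dir t ht.1⟩
      rw [← hx, ← hdir t ht.1 (h'.trans hi.symm), ht.2]) (fun t ht => by
      rw [Finset.mem_filter] at ht; simp [ht.2])
  have hKx : ∀ {v l}, ¬ Has K v l x := by
    rintro v l ⟨t, ht, -, e2, -⟩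
    rw [Finset.mem_filter] at ht
    exact ht.2.1 (hcol t ht.1 (e2.trans hx.symm))
  have hKy : ∀ z, ¬ Has K y k z := fun z hz => by
    have h3 := hk1 z (hz.mono (Finset.filter_subset _ _))
    subst h3
    obtain ⟨t, ht, -, e2, -⟩ := hz
    exact (Finset.mem_filter.1 ht).2.2 e2
  refine extends_of_copy (R := insert (y, k, c) (P.filter fun t => t.2.2 = c))
    (Q := insert (y, k, x) K) hiS hcT s ?_ ?_ ?_ ?_ hP.dir
  · refine extends_erase_of_card_lt hS hT hiS hcT (hKg.insert hkS
      (Finset.mem_erase.2 ⟨hxc, hxT⟩) (fun z hz => (hKy z hz).elim) (fun l hl => (hKx hl).elim)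
      fun l hl => (hKx hl).elim) ?_
    refine (Finset.card_insert_le _ _).trans_lt ?_
    -- Both `t₁` and `t₂` have the deleted color, which makes room for the auxiliary entry at `y`.
    have h4 : K.card + 2 ≤ (P.erase e).card :=
      card_add_two_le (fun t ht => by
        rw [Finset.mem_filter] at ht; exact Finset.mem_erase.2 ⟨ht.2.1, ht.1⟩)
        (t := t₁) (u := t₂) (Finset.mem_erase.2 ⟨fun h => hxc (by rw [← hx, ← h, h12]), h1⟩)
        (by simp [hK, h12]) (Finset.mem_erase.2 ⟨fun h => hxc (by rw [← hx, ← h, hc]), h2⟩)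
        (by simp [hK, hc]) hne
    rw [Finset.card_erase_of_mem he] at h4
    omega
  · refine hMg.insert hkS (by simp) (fun z hz => hk1 z (hz.mono (Finset.filter_subset _ _)))
      (fun l hl => hk2 l (hl.mono (Finset.filter_subset _ _)))
      fun l hl => hk3 l (hl.mono (Finset.filter_subset _ _))
  · intro t ht hti
    have hte : t ≠ e := fun h => hti (h ▸ hi)
    rw [setAt_of_eq (hs t ht hte)]
    by_cases htc : t.2.2 = c
    · exact Or.inl ⟨⟨t, Finset.mem_insert_of_mem (Finset.mem_filter.2 ⟨ht, htc⟩), rfl, htc,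
        touch_fst t⟩, htc⟩
    · refine Or.inr ⟨fun h' => htc ?_, t, Finset.mem_insert_of_mem
        (Finset.mem_filter.2 ⟨ht, hte, htc⟩), rfl, rfl, touch_fst t⟩
      rw [has_insert] at h'
      rcases h' with ⟨e1, -, h3⟩ | h'
      · refine hk1 _ ?_
        rcases h3 with h3 | h3 <;> simp only at h3 e1
        · rw [← h3, e1]; exact has_of_mem ht
        · rw [← has_flip, ← h3, e1]; exact has_of_mem ht
      · exact ((hP.proper (h'.mono (Finset.filter_subset _ _)) (has_of_mem ht)).1 rfl).symm
  · intro t ht hti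
    obtain rfl := hdir t ht (hti.trans hi.symm)
    rw [hy, hx]
    exact Or.inr ⟨k, has_of_mem (Finset.mem_insert_self (y, k, c) _),
      has_of_mem (Finset.mem_insert_self (y, k, x) _)⟩

/-- The direction of `e` occurs only once, the colour of `e` only at `e` and `g`. -/
theorem extends_of_color_twice (hS : S.card = n + 1) (hT : T.card = n + 1) (hP : Good S T P)
    (hsP : Simple P) (hPn : P.card ≤ n + 1) {e g : Entry ι C} (he : e ∈ P) (hg : g ∈ P) (hne : e ≠ g)
    (hdir : ∀ t ∈ P, t.2.1 = e.2.1 → t = e) (hgdir : ∀ t ∈ P, t.2.1 = g.2.1 → t = g)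
    (heg : e.2.2 = g.2.2)
    (hcol : ∀ t ∈ P, t.2.2 = g.2.2 → t = g ∨ t = e) {c₀ : C} (hc₀T : c₀ ∈ T)
    (hc₀ : ∀ t ∈ P, t.2.2 ≠ c₀) : Extends S T P := by
  obtain ⟨i, hi⟩ : ∃ i, e.2.1 = i := ⟨_, rfl⟩
  have hiS : i ∈ S := hi ▸ hP.dir e he
  have hgi : g.2.1 ≠ i := fun h => hne (hdir g hg (h.trans hi.symm)).symm
  have hcol' : ∀ t ∈ P, t.2.2 = g.2.2 → t = g ∨ t.2.1 = i := fun t ht h =>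
    (hcol t ht h).imp id (by rintro rfl; exact hi)
  have hdir' : ∀ t ∈ P, t.2.1 = i → t.2.2 = g.2.2 := fun t ht h => by
    rw [hdir t ht (h.trans hi.symm), heg]
  have hmir : ∀ y, ¬ Has P (flipAt i g.1) g.2.1 y := by
    rintro y ⟨t, ht, e1, -, h⟩
    obtain rfl := hgdir t ht e1
    have := (touch_fst t).apply_eq h hgi
    simp at this
  -- The common color goes to direction `i`, which serves `e`, and `g` recovers it by an exchange.
  -- With the remaining entries on one side, copies of one coloring allow this for any color of `g`;
  -- otherwise the spare color `c₀` is prescribed on `g` and its mirror image.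
  by_cases hone : ∃ s, ∀ t ∈ P, t ≠ e → t ≠ g → t.1 i = s
  · obtain ⟨s, hs⟩ := hone
    have hKg : Good (S.erase i) (T.erase g.2.2) (P.filter fun t => t ≠ e ∧ t ≠ g) :=
      hP.filter_side fun t ht h => ⟨fun h' => h.1 (hdir t ht (h'.trans hi.symm)),
        fun h' => (hcol t ht h').elim h.2 h.1⟩
    have hgS := Finset.mem_erase.2 ⟨hgi, hP.dir g hg⟩
    have hRg : Good (S.erase i) {g.2.2} {(setAt i s g.1, g.2.1, g.2.2)} :=
      (good_empty.insert (P := ∅) hgS (Finset.mem_singleton_self _)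
        (fun _ h => (not_has_empty h).elim) (fun _ h => (not_has_empty h).elim)
        fun _ h => (not_has_empty h).elim)
    refine extends_of_copy (R := {(setAt i s g.1, g.2.1, g.2.2)})
      (Q := P.filter fun t => t ≠ e ∧ t ≠ g) hiS (hP.col g hg) s
      (extends_erase_of_card_lt hS hT hiS (hP.col g hg) hKg ?_) hRg ?_ ?_ hP.dir
    · have := card_add_two_le (Finset.filter_subset (fun t => t ≠ e ∧ t ≠ g) P) he (by simp) hg
        (by simp) hne
      omega
    · intro t ht hti
      have hte : t ≠ e := fun h => hti (h ▸ hi)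
      by_cases htg : t = g
      · rw [htg]
        exact Or.inl ⟨⟨_, Finset.mem_singleton_self _, rfl, rfl, touch_fst _⟩, rfl⟩
      · rw [setAt_of_eq (hs t ht hte htg)]
        refine Or.inr ⟨?_, t, Finset.mem_filter.2 ⟨ht, hte, htg⟩, rfl, rfl, touch_fst t⟩
        rintro ⟨u, hu, e1, -, -⟩
        rw [Finset.mem_singleton] at hu
        subst hu
        exact htg (hgdir t ht e1.symm)
    · intro t ht hti
      obtain rfl := hdir t ht (hti.trans hi.symm)
      refine Or.inl ⟨heg, ?_⟩
      rintro k ⟨u, hu, -, -, h⟩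
      rw [Finset.mem_singleton] at hu
      subst hu
      have h1 : Touch g (setAt i (g.1 i) t.1) := by
        rcases h with h | h <;> simp only at h
        · left; have := congrArg (setAt i (g.1 i)) h; simpa using this
        · right; have := congrArg (setAt i (g.1 i)) h; simpa [setAt_flipAt hgi] using this
      exact hne (hsP.eq_of_color hP ht hg (touch_setAt hti _) h1 heg)
  · push Not at hone
    refine extends_of_exchange (x := c₀) hP hsP hiS hg hgi hdir' hmir fun b => ?_
    refine extends_erase_of_card_lt hS hT hiS (hP.col g hg) (good_exchangeSide hP hsP hg hgi hcol' hmir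
      hc₀T (fun h => hc₀ g hg h.symm) (fun t ht _ h => (hc₀ t ht h).elim) b) ?_
    obtain ⟨t, ht, hte, htg, htb⟩ := hone b
    refine (Finset.card_insert_le _ _).trans_lt ?_
    have := card_add_two_le (A := P.filter fun t => t ≠ g ∧ t.2.1 ≠ i ∧ t.1 i = b) (P := P.erase g)
      (fun t ht => by rw [Finset.mem_filter] at ht; exact Finset.mem_erase.2 ⟨ht.2.1, ht.1⟩)
      (Finset.mem_erase.2 ⟨hne, he⟩) (by simp [hi]) (Finset.mem_erase.2 ⟨htg, ht⟩) (by simp [htb])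
      hte.symm
    rw [Finset.card_erase_of_mem hg] at this
    omega

end Step

/-! ### Repeated colors, with every direction used once -/

section AllDirections

variable {ι C : Type*} [DecidableEq ι] {S : Finset ι} {T : Finset C} {P Q : Finset (Entry ι C)}
  {n : ℕ}

theorem Blk.exists_touch (hcard : P.card ≤ S.card) (h : Blk S T P) :
    ∃ u, ∃ c ∈ T, (∀ k, ¬ Has P u k c) ∧ (∀ t ∈ P, t.2.2 ≠ c → Touch t u) ∧
      ∀ t ∈ P, ∃ j ∈ S, Hits u c t j := by
  obtain ⟨u, c, hc, h0, h1⟩ := h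
  obtain ⟨a1, a2, a3⟩ := blk_struct hcard h0 h1
  refine ⟨u, c, hc, h0, fun t ht hne => ?_, a1⟩
  obtain ⟨j, -, h | h⟩ := a1 t ht
  exacts [h.1, (hne h.1).elim]

theorem Sat.color_injective (hcard : P.card ≤ T.card) (h : Sat S T P) :
    ∀ t ∈ P, ∀ u ∈ P, t.2.2 = u.2.2 → t = u := by
  obtain ⟨v, j, hj, h0, h1⟩ := h
  exact (sat_struct hcard h0 h1).2.1

variable [Fintype ι] [DecidableEq C]

/-- The spare color goes to the direction of `e`, and `e` obtains its own by crossing in a direction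
`a`. A side with `n` entries still shows every occurring color twice, so it is unobstructed. If no
`a` works, the `n` other entries must spoil `n` directions, so each of them spoils one, and an entry
of another color can do so only by touching `e`. -/
theorem extends_or_adjacent (hB : ExtendsAt ι C n) (hS : S.card = n + 1)
    (hT : T.card = n + 1) (hP : Good S T P) (hsP : Simple P) (hPn : P.card = n + 1)
    {e : Entry ι C} (he : e ∈ P) (hdir : ∀ t ∈ P, t.2.1 = e.2.1 → t = e)
    (h3 : ∀ e ∈ P, ∃ t ∈ P, ∃ t' ∈ P, t ≠ e ∧ t' ≠ e ∧ t ≠ t' ∧ t.2.2 = e.2.2 ∧ t'.2.2 = e.2.2)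
    {c₀ : C} (hc₀T : c₀ ∈ T) (hc₀ : ∀ t ∈ P, t.2.2 ≠ c₀) {t₀ : Entry ι C} (ht₀ : t₀ ∈ P)
    (ht₀e : t₀.2.2 ≠ e.2.2) :
    Extends S T P ∨ ∀ t ∈ P, t.2.2 ≠ e.2.2 → Touch t e.1 ∨ Touch t (flipAt e.2.1 e.1) := by
  obtain ⟨i, hi⟩ : ∃ i, e.2.1 = i := ⟨_, rfl⟩
  obtain ⟨x, hx⟩ : ∃ x, e.2.2 = x := ⟨_, rfl⟩
  rw [hx] at ht₀e ⊢
  rw [hi] at hdir ⊢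
  have hiS : i ∈ S := hi ▸ hP.dir e he
  have hxT : x ∈ T := hx ▸ hP.col e he
  have hdirx : ∀ t ∈ P, t.2.1 = i → t.2.2 = x := fun t ht h => by rw [hdir t ht h, hx]
  by_cases hone : ∃ s, ∀ t ∈ P, t.2.1 ≠ i → t.1 i = s
  · obtain ⟨s, hs⟩ := hone
    refine Or.inl (extends_of_oneSided hP hiS hxT s hdirx hs
      (extends_erase_of_card_lt hS hT hiS hxT (hP.filter_side fun t _ h => h) ?_))
    obtain ⟨t, ht, -, -, hte, -, -, h, -⟩ := h3 e he
    have := card_add_two_le (Finset.filter_subset (fun t => t.2.1 ≠ i ∧ t.2.2 ≠ x) P) he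
      (by simp [hx]) ht (by simp [h, hx]) hte.symm
    omega
  push Not at hone
  by_cases hfree : ∃ a ∈ S.erase i, ∀ v, Touch e v →
      (∀ y, ¬ Has P v a y) ∧ ∀ j, ¬ Has P (flipAt a v) j x
  · left
    obtain ⟨a, haS, ha⟩ := hfree
    obtain ⟨hai, haS⟩ := Finset.mem_erase.1 haS
    have ha' : ∀ t ∈ P, t.2.1 = i → ∀ v, Touch t v →
        (∀ y, ¬ Has P v a y) ∧ ∀ j, ¬ Has P (flipAt a v) j x := fun t ht hti => by
      rw [hdir t ht hti]; exact ha
    have hg := good_crossSide hP hai hdirx ha' haS hxT (fun h => hc₀ e he (hx.trans h)) hc₀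
    refine extends_of_cross hP hai hdirx ha' hiS haS hc₀T fun b => ?_
    set F := P.filter fun t => t.2.1 ≠ i ∧ t.1 i = b with hF
    have hFP : F ⊆ P := Finset.filter_subset _ _
    have heF : e ∉ F := by simp [hF, hi]
    have himg : ((P.filter fun t => t.2.1 = i).image fun t => (setAt i b t.1, a, x)).card ≤ 1 := by
      refine Finset.card_image_le.trans (Finset.card_le_one.2 fun t ht u hu => ?_)
      rw [Finset.mem_filter] at ht hu
      rw [hdir t ht.1 ht.2, hdir u hu.1 hu.2]
    have hcard : (crossSide P i a x b).card ≤ F.card + 1 :=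
      (Finset.card_union_le _ _).trans (Nat.add_le_add_left himg _)
    obtain ⟨f, hf, hfi, hfb⟩ := hone b
    have hfF : f ∉ F := by simp [hF, hfb]
    have hef : e ≠ f := by rintro rfl; exact hfi hi
    have hcF := card_add_two_le hFP he heF hf hfF hef
    rcases Nat.lt_or_ge (crossSide P i a x b).card n with hlt | hge
    · exact extends_erase_of_card_lt hS hT hiS hc₀T (hg b) hlt
    have hFall : ∀ t ∈ P, t ≠ e → t ≠ f → t ∈ F := by
      intro t ht hte htf
      by_contra h
      have := card_add_two_le (A := insert t F) (Finset.insert_subset ht hFP) he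
        (by simp [heF, hte.symm]) hf (by simp [hfF, htf.symm]) hef
      rw [Finset.card_insert_of_notMem h] at this
      omega
    -- Besides `e` only `f` is missing on this side, and each color occurs three times in `P`.
    have htwo : ∀ t ∈ P, t.2.2 ≠ x → ∃ u ∈ F, ∃ u' ∈ F, u ≠ u' ∧ u.2.2 = t.2.2 ∧ u'.2.2 = t.2.2 := by
      intro t ht htx
      obtain ⟨u, hu, u', hu', h1, h2, h4, h5, h6⟩ := h3 t ht
      have hne : ∀ w, w.2.2 = t.2.2 → w ≠ e := by
        rintro w hw rfl; exact htx (hw.symm.trans hx)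
      by_cases e1 : u = f
      · exact ⟨t, hFall t ht (hne t rfl) (fun h => h1 (e1.trans h.symm)), u', hFall u' hu' (hne u' h6)
          (fun h => h4 (e1.trans h.symm)), h2.symm, rfl, h6⟩
      by_cases e2 : u' = f
      · exact ⟨t, hFall t ht (hne t rfl) (fun h => h2 (e2.trans h.symm)), u, hFall u hu (hne u h5) e1,
          h1.symm, rfl, h5⟩
      · exact ⟨u, hFall u hu (hne u h5) e1, u', hFall u' hu' (hne u' h6) e2, h4, h5, h6⟩
    have hSi : (S.erase i).card = n := by rw [Finset.card_erase_of_mem hiS, hS]; rfl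
    have hTc : (T.erase c₀).card = n := by rw [Finset.card_erase_of_mem hc₀T, hT]; rfl
    have hQn : (crossSide P i a x b).card ≤ n := by omega
    have hFQ : ∀ t ∈ F, t ∈ crossSide P i a x b := fun t ht => Finset.mem_union_left _ ht
    obtain ⟨u, hu, u', hu', huu, hut, hut'⟩ := htwo t₀ ht₀ ht₀e
    refine hB.erase hS hT hiS hc₀T (hg b) hQn (fun hsat => huu ?_) fun hblk => ?_
    · exact hsat.color_injective (by omega) u (hFQ u hu) u' (hFQ u' hu') (hut.trans hut'.symm)
    · obtain ⟨w, c, -, -, hw, -⟩ := hblk.exists_touch (by omega)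
      by_cases hc : t₀.2.2 = c
      · obtain ⟨v, hv, v', hv', h1, h2, h4, h5, h6⟩ := h3 e he
        obtain ⟨v, hv, hve, hvx, hvf⟩ : ∃ v ∈ P, v ≠ e ∧ v.2.2 = x ∧ v ≠ f := by
          by_cases e1 : v = f
          · exact ⟨v', hv', h2, h6.trans hx, fun h => h4 (e1.trans h.symm)⟩
          · exact ⟨v, hv, h1, h5.trans hx, e1⟩
        have hvF := hFall v hv hve hvf
        have hxc : x ≠ c := fun h => ht₀e (hc.trans h.symm)
        have hq : (setAt i b e.1, a, x) ∈ crossSide P i a x b :=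
          Finset.mem_union_right _ (Finset.mem_image.2 ⟨e, Finset.mem_filter.2 ⟨he, hi⟩, rfl⟩)
        have k1 := hw v (hFQ v hvF) (by rw [hvx]; exact hxc)
        have k2 := hw _ hq hxc
        have k3 : v.2.1 = a := ((hg b).proper (has_of_touch (hFQ v hvF) k1) (has_of_touch hq k2)).2 hvx
        have k4 := (ha _ (touch_setAt hi b)).1 v.2.2
        rcases k2 with rfl | rfl
        · exact k4 (k3 ▸ has_of_touch hv k1)
        · have k5 : Has P (flipAt a (setAt i b e.1)) v.2.1 v.2.2 := has_of_touch hv k1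
          rw [k3] at k5
          exact k4 (has_flip.1 k5)
      · exact huu (hsP.eq_of_color hP (hFP hu) (hFP hu') (hw u (hFQ u hu) (by rwa [hut]))
          (hw u' (hFQ u' hu') (by rwa [hut'])) (hut.trans hut'.symm))
  · right
    push Not at hfree
    have hend : ∀ v, Touch e v → ∀ v', Touch e v' → v' = v ∨ v' = flipAt i v := fun v hv v' hv' =>
      hi ▸ hv.eq_or hv'
    obtain ⟨a1, -, -⟩ := rel_bijective (P := P.erase e) (S := S.erase i)
      (r := fun t a => ∃ v, Touch e v ∧ ((Touch t v ∧ t.2.1 = a) ∨ (t.2.2 = x ∧ Touch t (flipAt a v))))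
      (fun a ha => by
        have hai := (Finset.mem_erase.1 ha).1
        obtain ⟨v, hv, h⟩ := hfree a ha
        by_cases h' : ∃ y, Has P v a y
        · obtain ⟨y, t, ht, e1, -, h1⟩ := h'
          exact ⟨t, Finset.mem_erase.2 ⟨by rintro rfl; exact hai (e1.symm.trans hi), ht⟩, v, hv,
            Or.inl ⟨h1, e1⟩⟩
        · push Not at h'
          obtain ⟨j, t, ht, -, e2, h1⟩ := h h'
          refine ⟨t, Finset.mem_erase.2 ⟨?_, ht⟩, v, hv, Or.inr ⟨e2, h1⟩⟩
          rintro rfl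
          rcases hend v hv _ h1 with h2 | h2
          · exact flipAt_ne _ _ h2
          · exact hai (flipAt_eq_flipAt.1 h2))
      (fun t ht a ha a' ha' h1 h2 => by
        obtain ⟨hte, ht⟩ := Finset.mem_erase.1 ht
        have hai := (Finset.mem_erase.1 ha).1
        have hai' := (Finset.mem_erase.1 ha').1
        obtain ⟨v, hv, h1⟩ := h1
        obtain ⟨v', hv', h2⟩ := h2
        have hno : ∀ v, Touch e v → t.2.2 = x → ¬ Touch t v := fun v hv hc h =>
          hte (hsP.eq_of_color hP ht he h hv (hc.trans hx.symm))
        rcases h1 with ⟨h1, e1⟩ | ⟨e1, h1⟩ <;> rcases h2 with ⟨h2, e2⟩ | ⟨e2, h2⟩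
        · exact e1.symm.trans e2
        · exact (hno v hv e2 h1).elim
        · exact (hno v' hv' e1 h2).elim
        · by_contra hne
          rcases hend v hv v' hv' with rfl | rfl
          · exact not_touch_flipAt_flipAt hne h1 h2
          · rcases h1.eq_or h2 with h4 | h4
            · exact flipAt_flipAt_ne _ _ _ _ h4
            · have hti : t.2.1 ≠ i := fun h => hte (hdir t ht h)
              rcases flipAt_flipAt_eq hai' h4 with ⟨-, h5⟩ | ⟨-, h5⟩
              · exact hai h5.symm
              · exact hti h5.symm)
      (by rw [Finset.card_erase_of_mem he, Finset.card_erase_of_mem hiS]; omega)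
    intro t ht htx
    obtain ⟨a, -, v, hv, h | h⟩ := a1 t (Finset.mem_erase.2
      ⟨by rintro rfl; exact htx hx, ht⟩)
    · rcases hv with rfl | rfl
      · exact Or.inl h.1
      · right; rw [← hi]; exact h.1
    · exact (htx h.1).elim

/-- The case where every direction occurs exactly once and some colour does not occur. -/
theorem extends_of_all_directions (hn : 4 ≤ n) (hB : ExtendsAt ι C n) (hS : S.card = n + 1)
    (hT : T.card = n + 1) (hP : Good S T P) (hsP : Simple P) (hPn : P.card = n + 1)
    (hblk : ¬ Blk S T P) (hdir : ∀ t ∈ P, ∀ u ∈ P, t.2.1 = u.2.1 → t = u) {c₀ : C} (hc₀T : c₀ ∈ T)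
    (hc₀ : ∀ t ∈ P, t.2.2 ≠ c₀) : Extends S T P := by
  have hdir' : ∀ e ∈ P, ∀ t ∈ P, t.2.1 = e.2.1 → t = e := fun e he t ht h => hdir t ht e he h
  by_cases hun : ∃ e ∈ P, ∀ t ∈ P, t.2.2 = e.2.2 → t = e
  · obtain ⟨e, he, h⟩ := hun
    obtain ⟨t₁, h1, t₂, h2, hne, h12⟩ := Finset.exists_ne_map_eq_of_card_lt_of_maps_to
      (s := P) (t := T.erase c₀) (by rw [Finset.card_erase_of_mem hc₀T]; omega)
      (f := fun t => t.2.2) (fun t ht => Finset.mem_coe.2 (Finset.mem_erase.2 ⟨hc₀ t ht, hP.col t ht⟩))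
    exact extends_of_unique_color hS hT hP hPn.le hblk he (hdir' e he) h h1 h2 hne h12
  push Not at hun
  by_cases htw : ∃ e ∈ P, ∃ g ∈ P, e ≠ g ∧ e.2.2 = g.2.2 ∧ ∀ t ∈ P, t.2.2 = g.2.2 → t = g ∨ t = e
  · obtain ⟨e, he, g, hg, hne, heg, h⟩ := htw
    exact extends_of_color_twice hS hT hP hsP hPn.le he hg hne (hdir' e he) (hdir' g hg) heg h hc₀T hc₀
  push Not at htw
  have h3 : ∀ e ∈ P, ∃ t ∈ P, ∃ t' ∈ P, t ≠ e ∧ t' ≠ e ∧ t ≠ t' ∧ t.2.2 = e.2.2 ∧ t'.2.2 = e.2.2 := by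
    intro e he
    obtain ⟨g, hg, h1, h2⟩ := hun e he
    obtain ⟨t, ht, h4, h5, h6⟩ := htw e he g hg h2.symm h1.symm
    exact ⟨g, hg, t, ht, h2, h6, h5.symm, h1, h4.trans h1⟩
  obtain ⟨e, he⟩ : P.Nonempty := Finset.card_pos.1 (by omega)
  by_cases hmono : ∀ t ∈ P, t.2.2 = e.2.2
  · exact extends_of_star (u := e.1) (c := e.2.2) (by omega) hS hT hP hPn.le hblk
      fun t ht => Or.inr (hmono t ht)
  push Not at hmono
  obtain ⟨t₀, ht₀, ht₀e⟩ := hmono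
  obtain ⟨e', he', -, -, hee, -, -, hec, -⟩ := h3 e he
  rcases extends_or_adjacent hB hS hT hP hsP hPn he (hdir' e he) h3 hc₀T hc₀ ht₀ ht₀e with h | h
  · exact h
  rcases extends_or_adjacent hB hS hT hP hsP hPn he' (hdir' e' he') h3 hc₀T hc₀ ht₀
    (by rwa [hec]) with h' | h'
  · exact h'
  exfalso
  obtain ⟨t₁, ht₁, t₂, ht₂, k1, k2, k3, k4, k5⟩ := h3 t₀ ht₀
  -- Two entries of the color of `t₀` at an end `a` of `e` are both adjacent to `e'`, which forces
  -- `a` to be an end of `e'` too, although `e` and `e'` have the same color. Of three such entries,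
  -- two meet at one end of `e`.
  have key : ∀ a, Touch e a → ∀ t ∈ P, ∀ u ∈ P, t ≠ u → t.2.2 = t₀.2.2 → u.2.2 = t₀.2.2 →
      Touch t a → Touch u a → False := by
    intro a ha t ht u hu hne htc huc hta hua
    have := end_of_two_adjacent (fun h => hne (hdir t ht u hu h)) hta hua
      (h' t ht (by rwa [htc, hec])) (h' u hu (by rwa [huc, hec]))
    refine hee (hsP.eq_of_color hP he' he this ha hec)
  have hf := touch_fst e
  have hf' := touch_flip e
  rcases h t₀ ht₀ ht₀e with m0 | m0 <;> rcases h t₁ ht₁ (by rwa [k4]) with m1 | m1 <;>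
    rcases h t₂ ht₂ (by rwa [k5]) with m2 | m2
  · exact key _ hf _ ht₀ _ ht₁ k1.symm rfl k4 m0 m1
  · exact key _ hf _ ht₀ _ ht₁ k1.symm rfl k4 m0 m1
  · exact key _ hf _ ht₀ _ ht₂ k2.symm rfl k5 m0 m2
  · exact key _ hf' _ ht₁ _ ht₂ k3 k4 k5 m1 m2
  · exact key _ hf _ ht₁ _ ht₂ k3 k4 k5 m1 m2
  · exact key _ hf' _ ht₀ _ ht₂ k2.symm rfl k5 m0 m2
  · exact key _ hf' _ ht₀ _ ht₁ k1.symm rfl k4 m0 m1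
  · exact key _ hf' _ ht₀ _ ht₁ k1.symm rfl k4 m0 m1

end AllDirections

/-! ### All colors different: mirror images and double stars -/

section Rainbow

variable {ι C : Type*} [DecidableEq ι] {S : Finset ι} {T : Finset C} {P Q : Finset (Entry ι C)}
  {n : ℕ}

theorem exists_color {P : Finset (Entry ι C)} (hP : Good S T P) (hcard : T.card ≤ P.card)
    (hinj : ∀ t ∈ P, ∀ u ∈ P, t.2.2 = u.2.2 → t = u) {c : C} (hc : c ∈ T) :
    ∃ t ∈ P, t.2.2 = c := by
  classical
  have : P.image (fun t => t.2.2) = T := by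
    refine Finset.eq_of_subset_of_card_le (fun x hx => ?_) ?_
    · obtain ⟨t, ht, rfl⟩ := Finset.mem_image.1 hx; exact hP.col t ht
    · rwa [Finset.card_image_of_injOn fun t ht u hu => hinj t ht u hu]
  rw [← this] at hc
  exact Finset.mem_image.1 hc

/-- A sufficient condition for a saturated edge. -/
theorem sat_of_forall_touch (hP : Good S T P) (hcard : T.card ≤ P.card)
    (hinj : ∀ t ∈ P, ∀ u ∈ P, t.2.2 = u.2.2 → t = u) {z : ι → Bool} {j : ι} (hj : j ∈ S)
    (hz : ∀ t ∈ P, (Touch t z ∨ Touch t (flipAt j z)) ∧ t.2.1 ≠ j) : Sat S T P := by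
  refine ⟨z, j, hj, fun c ⟨t, ht, e, _, _⟩ => (hz t ht).2 e, fun c hc => ?_⟩
  obtain ⟨t, ht, rfl⟩ := exists_color hP hcard hinj hc
  exact ⟨t.2.1, (hz t ht).1.imp (has_of_touch ht) (has_of_touch ht)⟩

theorem dir_ne_of_not_touch {t : Entry ι C} {z : ι → Bool} {j : ι} (h : Touch t z)
    (h' : ¬ Touch t (flipAt j z)) : t.2.1 ≠ j := fun e => h' (e ▸ touch_flipAt_iff.2 h)

/-- The edge of `t` has a mirror image in direction `i` in `P`. -/
def Mirrored (P : Finset (Entry ι C)) (i : ι) (t : Entry ι C) : Prop :=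
  ∃ u ∈ P, u.2.1 = t.2.1 ∧ Touch u (flipAt i t.1)

theorem Mirrored.has {i : ι} {t : Entry ι C} : Mirrored P i t ↔
    ∃ y, Has P (flipAt i t.1) t.2.1 y :=
  ⟨fun ⟨u, hu, e, h⟩ => ⟨u.2.2, u, hu, e, rfl, h⟩, fun ⟨_, u, hu, e, _, h⟩ => ⟨u, hu, e, h⟩⟩

theorem touch_mirror {i : ι} {t u : Entry ι C} (e : u.2.1 = t.2.1) (h : Touch u (flipAt i t.1))
    {v : ι → Bool} (hv : Touch t v) : Touch u (flipAt i v) := by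
  rcases hv with rfl | rfl
  · exact h
  · rw [flipAt_comm, ← e]; exact touch_flipAt_iff.2 h

theorem touch_mirror' {i : ι} {t u : Entry ι C} (e : u.2.1 = t.2.1) (h : Touch u (flipAt i t.1))
    {v : ι → Bool} (hv : Touch u v) : Touch t (flipAt i v) := by
  rcases h.eq_or hv with rfl | rfl
  · rw [flipAt_flipAt]; exact touch_fst t
  · rw [flipAt_comm, flipAt_flipAt, e]; exact touch_flip t

theorem touch_side {i : ι} {t : Entry ι C} (hti : t.2.1 ≠ i) {v : ι → Bool} (hv : Touch t v) :
    v i = t.1 i := (touch_fst t).apply_eq hv hti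

variable [Fintype ι] [DecidableEq C]

/-- All edges but one are incident with `p` or its neighbour `p'`, and their colours are
different; `g` and `h` are edges at different ends. -/
theorem extends_of_double_star (hn : 4 ≤ n) (hB : ExtendsAt ι C n) (hS : S.card = n + 1)
    (hT : T.card = n + 1) (hP : Good S T P) (hsP : Simple P) (hPn : P.card = n + 1)
    {i : ι} (hi : i ∈ S) (hdir : ∀ t ∈ P, t.2.1 ≠ i) {e : Entry ι C} (he : e ∈ P) {s : Bool}
    (hes : e.1 i ≠ s) (hs : ∀ t ∈ P, t ≠ e → t.1 i = s)
    (hinj : ∀ t ∈ P, ∀ u ∈ P, t ≠ e → u ≠ e → t.2.2 = u.2.2 → t = u) {p : ι → Bool} {a : ι}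
    (hp : ∀ t ∈ P, t ≠ e → Touch t p ∨ Touch t (flipAt a p)) {g h : Entry ι C} (hg : g ∈ P)
    (hh : h ∈ P) (hgp : Touch g p) (hga : g.2.1 ≠ a) (hhp : Touch h (flipAt a p)) (hha : h.2.1 ≠ a)
    (hge : g.2.2 ≠ e.2.2) (hhe : h.2.2 ≠ e.2.2) (hmir : ¬ Mirrored P i g) : Extends S T P := by
  have hge' : g ≠ e := fun h => hge (by rw [h])
  have hhe' : h ≠ e := fun h => hhe (by rw [h])
  have hdisj : ∀ v, Touch g v → ¬ Touch h v := by
    intro v hv hv'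
    rcases hgp.eq_or hv with rfl | rfl <;> rcases hhp.eq_or hv' with e1 | e1
    · exact flipAt_ne _ _ e1.symm
    · exact hha (flipAt_eq_flipAt.1 (eq_flipAt_comm.1 e1)).symm
    · exact hga (flipAt_eq_flipAt.1 e1)
    · exact flipAt_flipAt_ne _ _ _ _ e1.symm
  have hgh : g ≠ h := fun e1 => hdisj _ (touch_fst g) (e1 ▸ touch_fst g)
  have hadj : ∀ t ∈ P, t.2.1 ≠ i → t.2.2 = h.2.2 → ∀ v, Touch g v →
      ¬ Touch t v ∧ ¬ Touch t (flipAt i v) := by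
    intro t ht hti htc v hv
    have hte : t ≠ e := fun h => hhe (by rw [← htc, h])
    obtain rfl := hinj t ht h hh hte hhe' htc
    refine ⟨hdisj v hv, fun hv' => ?_⟩
    have h1 := touch_side (hdir g hg) hv
    have h2 := touch_side hti hv'
    rw [flipAt_apply_self, hs t ht hte, h1, hs g hg hge'] at h2
    cases s <;> simp at h2
  have hgi := hdir g hg
  have hx : h.2.2 ≠ g.2.2 := fun h' => hgh (hinj g hg h hh hge' hhe' h'.symm)
  have hmir' : ∀ y, ¬ Has P (flipAt i g.1) g.2.1 y := fun y hy => hmir (Mirrored.has.2 ⟨y, hy⟩)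
  have hgood := good_exchangeSide hP hsP hg hgi (fun t ht h' => Or.inl (hinj t ht g hg
    (fun h'' => hge (by rw [← h', h''])) hge' h')) hmir' (hP.col h hh) hx hadj
  -- On the side `s`, the entry `g` takes the color of the disjoint entry `h`. The repetition
  -- excludes a saturated edge, and the positions of `g` and `h` at different ends exclude a blocked
  -- vertex.
  refine extends_of_exchange (x := h.2.2) hP hsP hi hg hgi (fun t ht hti => (hdir t ht hti).elim)
    hmir' fun b => ?_
  have hcT := hP.col g hg
  set F := P.filter fun t => t ≠ g ∧ t.2.1 ≠ i ∧ t.1 i = b with hF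
  have hcard : (exchangeSide P i g h.2.2 b).card ≤ F.card + 1 := Finset.card_insert_le _ _
  have hmem : ∀ t ∈ P, t ≠ e → t ≠ g → b = s → t ∈ exchangeSide P i g h.2.2 b :=
    fun t ht hte htg hbs => Finset.mem_insert_of_mem
      (Finset.mem_filter.2 ⟨ht, htg, hdir t ht, (hs t ht hte).trans hbs.symm⟩)
  by_cases hlt : (exchangeSide P i g h.2.2 b).card < n
  · exact extends_erase_of_card_lt hS hT hi hcT (hgood b) hlt
  have hFP : F ⊆ P.erase g := fun t ht => by
    rw [Finset.mem_filter] at ht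
    exact Finset.mem_erase.2 ⟨ht.2.1, ht.1⟩
  have hPg : (P.erase g).card = n := by rw [Finset.card_erase_of_mem hg, hPn]; rfl
  have hbs : b = s := by
    by_contra hbs
    have hF1 : F ⊆ {e} := fun t ht => by
      rw [Finset.mem_filter] at ht
      rw [Finset.mem_singleton]
      by_contra hte
      exact hbs (ht.2.2.2.symm.trans (hs t ht.1 hte))
    have := Finset.card_le_card hF1
    rw [Finset.card_singleton] at this
    omega
  subst hbs
  have hGm : (setAt i b g.1, g.2.1, h.2.2) ∈ exchangeSide P i g h.2.2 b :=
    Finset.mem_insert_self _ _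
  rw [setAt_of_eq (hs g hg hge')] at hGm
  have hhm := hmem h hh hhe' hgh.symm rfl
  have hSi : (S.erase i).card = n := by rw [Finset.card_erase_of_mem hi, hS]; rfl
  have hTc : (T.erase g.2.2).card = n := by rw [Finset.card_erase_of_mem hcT, hT]; rfl
  have hQn : (exchangeSide P i g h.2.2 b).card ≤ n := by
    have := card_add_one_le hFP (Finset.mem_erase.2 ⟨hge'.symm, he⟩)
      fun heF => hes (Finset.mem_filter.1 heF).2.2.2
    omega
  refine hB.erase hS hT hi hcT (hgood b) hQn (fun hsat => ?_) fun hblk => ?_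
  · exact hdisj _ (touch_fst g)
      (hsat.color_injective (by omega) h hhm _ hGm rfl ▸ touch_fst _)
  obtain ⟨w, c, -, h0, hw, -⟩ := hblk.exists_touch (by omega)
  by_cases hc : h.2.2 = c
  -- By `4 ≤ n` two entries remain besides `e`, `g` and `h`. They meet at `w`, so `w` is an end of
  -- the central edge, where `g` or `h` now shows the color `c`.
  · obtain ⟨t₁, ht₁, t₂, ht₂, h12⟩ := Finset.one_lt_card.1
      (show 1 < (((P.erase e).erase g).erase h).card by
        rw [Finset.card_erase_of_mem (by simp [hgh.symm, hhe', hh]),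
          Finset.card_erase_of_mem (by simp [hge', hg]), Finset.card_erase_of_mem he]
        omega)
    simp only [Finset.mem_erase] at ht₁ ht₂
    have key : ∀ t, t ≠ h ∧ t ≠ g ∧ t ≠ e ∧ t ∈ P → Touch t w := fun t ht =>
      hw t (hmem t ht.2.2.2 ht.2.2.1 ht.2.1 rfl) fun h' =>
        ht.1 (hinj t ht.2.2.2 h hh ht.2.2.1 hhe' (h'.trans hc.symm))
    have hd : t₁.2.1 ≠ t₂.2.1 := fun h' =>
      h12 (hsP t₁ ht₁.2.2.2 t₂ ht₂.2.2.2 w (key _ ht₁) (key _ ht₂) h')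
    rcases end_of_two_adjacent hd (key _ ht₁) (key _ ht₂) (hp _ ht₁.2.2.2 ht₁.2.2.1)
      (hp _ ht₂.2.2.2 ht₂.2.2.1) with rfl | rfl
    · exact h0 g.2.1 ⟨_, hGm, rfl, hc, hgp⟩
    · exact h0 h.2.1 ⟨h, hhm, rfl, hc, hhp⟩
  · exact hdisj w (show Touch g w from hw (g.1, g.2.1, h.2.2) hGm hc) (hw h hhm hc)

end Rainbow

/-! ### All colors different: directions with at most one entry on a side -/

section RainbowCases

variable {ι C : Type*} [DecidableEq ι] {S : Finset ι} {T : Finset C} {P Q : Finset (Entry ι C)}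
  {n : ℕ}

theorem dir_eq_of_touch {t : Entry ι C} {z : ι → Bool} {j : ι} (h : Touch t z)
    (h' : Touch t (flipAt j z)) : t.2.1 = j := by
  by_contra hne
  rcases h.eq_or h' with e | e
  · exact flipAt_ne _ _ e
  · exact hne (flipAt_eq_flipAt.1 e).symm

variable [Fintype ι] [DecidableEq C]

/-- A set `Q` of `n` entries is all of `P` except `g` and is rainbow. By `sat_of_blk` its only
possible obstruction is a saturated edge, to which all its entries are adjacent. -/
theorem extends_erase_or_adjacent (hB : ExtendsAt ι C n) (hS : S.card = n + 1) (hT : T.card = n + 1)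
    (hP : Good S T P) (hPn : P.card = n + 1) (hinj : ∀ t ∈ P, ∀ u ∈ P, t.2.2 = u.2.2 → t = u)
    {i : ι} (hi : i ∈ S) {g : Entry ι C} (hg : g ∈ P) (hQ : Good (S.erase i) (T.erase g.2.2) Q)
    (hsub : Q ⊆ P.erase g) : Extends (S.erase i) (T.erase g.2.2) Q ∨ P.erase g ⊆ Q ∧
      ∃ z, ∃ j ∈ S.erase i, ∀ t ∈ P, t ≠ g → (Touch t z ∨ Touch t (flipAt j z)) ∧ t.2.1 ≠ j := by
  have hcT := hP.col g hg
  have hPg : (P.erase g).card = n := by rw [Finset.card_erase_of_mem hg, hPn]; rfl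
  have hSi : (S.erase i).card = n := by rw [Finset.card_erase_of_mem hi, hS]; rfl
  have hTc : (T.erase g.2.2).card = n := by rw [Finset.card_erase_of_mem hcT, hT]; rfl
  rcases Nat.lt_or_ge Q.card n with hlt | hge
  · exact Or.inl (extends_of_card_lt hSi hTc hQ hlt)
  obtain rfl : Q = P.erase g := Finset.eq_of_subset_of_card_le hsub (by omega)
  by_cases hsat : Sat (S.erase i) (T.erase g.2.2) (P.erase g)
  · obtain ⟨z, j, hj, h0, h1⟩ := hsat
    have := (sat_struct (by omega) h0 h1).1
    exact Or.inr ⟨subset_rfl, z, j, hj, fun t ht htg => this t (Finset.mem_erase.2 ⟨htg, ht⟩)⟩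
  · refine Or.inl (hB.erase hS hT hi hcT hQ (by omega) hsat fun hblk => hsat ?_)
    exact sat_of_blk (by omega) hQ (by omega) (fun t ht u hu => hinj t (Finset.mem_of_mem_erase ht) u
      (Finset.mem_of_mem_erase hu)) hblk

/-- The color of `e` is given to its direction, so neither side contains `e`. Failure means that
some side carries all other entries and has a saturated edge. -/
theorem extends_of_rainbow_of_dir (hB : ExtendsAt ι C n) (hS : S.card = n + 1)
    (hT : T.card = n + 1) (hP : Good S T P) (hPn : P.card = n + 1)
    (hinj : ∀ t ∈ P, ∀ u ∈ P, t.2.2 = u.2.2 → t = u) {e : Entry ι C} (he : e ∈ P)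
    (hdir : ∀ t ∈ P, t.2.1 = e.2.1 → t = e) :
    Extends S T P ∨ ∃ b, (∀ t ∈ P, t ≠ e → t.1 e.2.1 = b) ∧ ∃ z, ∃ j ∈ S.erase e.2.1,
      ∀ t ∈ P, t ≠ e → (Touch t z ∨ Touch t (flipAt j z)) ∧ t.2.1 ≠ j := by
  by_contra hcon
  push Not at hcon
  refine hcon.1 (extends_of_split hP (hP.dir e he) (hP.col e he) (fun t ht h => by
    rw [hdir t ht h]) fun b => ?_)
  refine (extends_erase_or_adjacent hB hS hT hP hPn hinj (hP.dir e he) he (hP.filter_side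
    fun t ht h => ⟨h.1, fun h' => h.1 (by rw [hinj t ht e he h'])⟩) fun t ht => ?_).resolve_right ?_
  · rw [Finset.mem_filter] at ht
    exact Finset.mem_erase.2 ⟨fun h => ht.2.1 (by rw [h]), ht.1⟩
  · rintro ⟨hsub, z, j, hj, h⟩
    obtain ⟨t, ht, hte, h'⟩ := hcon.2 b (fun t ht hte =>
      (Finset.mem_filter.1 (hsub (Finset.mem_erase.2 ⟨hte, ht⟩))).2.2) z j hj
    exact (h t ht hte).2 (h' (h t ht hte).1)

/-- A saturated edge left over by `extends_of_rainbow_of_dir` would have a direction that no other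
entry uses, but all directions are used. -/
theorem extends_of_rainbow_of_all_directions (hB : ExtendsAt ι C n) (hS : S.card = n + 1)
    (hT : T.card = n + 1) (hP : Good S T P) (hPn : P.card = n + 1)
    (hinj : ∀ t ∈ P, ∀ u ∈ P, t.2.2 = u.2.2 → t = u) (hW : ∀ j ∈ S, ∃ t ∈ P, t.2.1 = j) :
    Extends S T P := by
  have hd := (rel_bijective (r := fun (t : Entry ι C) j => t.2.1 = j) hW
    (fun t _ j _ k _ h1 h2 => h1.symm.trans h2) (by omega)).2.1
  obtain ⟨e, he⟩ := Finset.card_pos.1 (show 0 < P.card by omega)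
  refine (extends_of_rainbow_of_dir hB hS hT hP hPn hinj he fun t ht h => hd t ht e he _
    (hP.dir e he) h rfl).resolve_right ?_
  rintro ⟨-, -, z, j, hj, h⟩
  obtain ⟨hji, hjS⟩ := Finset.mem_erase.1 hj
  obtain ⟨t, ht, rfl⟩ := hW j hjS
  exact (h t ht (fun h' => hji (by rw [h']))).2 rfl

/-- Any entry `g` may give its color to direction `i`, and if this fails the others are adjacent to
one edge. Comparing the edges obtained for two choices of `g` yields a star, a saturated edge of
`P`, or more entries at a vertex than directions available. -/
theorem extends_of_rainbow_of_oneSided (hn : 4 ≤ n) (hB : ExtendsAt ι C n) (hS : S.card = n + 1)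
    (hT : T.card = n + 1) (hP : Good S T P) (hsP : Simple P) (hPn : P.card = n + 1)
    (hinj : ∀ t ∈ P, ∀ u ∈ P, t.2.2 = u.2.2 → t = u) (hsat : ¬ Sat S T P) (hblk : ¬ Blk S T P)
    {i : ι} (hi : i ∈ S) (hdir : ∀ t ∈ P, t.2.1 ≠ i) {s : Bool} (hs : ∀ t ∈ P, t.1 i = s) :
    Extends S T P := by
  by_contra hext
  have key : ∀ g ∈ P, ∃ z, ∃ j ∈ S.erase i,
      ∀ t ∈ P, t ≠ g → (Touch t z ∨ Touch t (flipAt j z)) ∧ t.2.1 ≠ j := by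
    intro g hg
    by_contra hcon
    refine hext (extends_of_oneSided hP hi (hP.col g hg) s (fun t ht h => (hdir t ht h).elim)
      (fun t ht _ => hs t ht) ?_)
    refine (extends_erase_or_adjacent hB hS hT hP hPn hinj hi hg (hP.filter_side fun t _ h => h)
      fun t ht => ?_).resolve_right fun h => hcon h.2
    rw [Finset.mem_filter] at ht
    exact Finset.mem_erase.2 ⟨fun h => ht.2.2 (by rw [h]), ht.1⟩
  have main : ∀ z, ∀ j ∈ S.erase i, ∀ g ∈ P,
      (∀ t ∈ P, t ≠ g → (Touch t z ∨ Touch t (flipAt j z)) ∧ t.2.1 ≠ j) →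
      ∀ t₁ ∈ P, ∀ t₂ ∈ P, t₁ ≠ g → t₂ ≠ g → t₁ ≠ t₂ → Touch t₁ z → Touch t₂ z → False := by
    intro z j hj g hg hz t₁ ht₁ t₂ ht₂ h1g h2g h12 h1 h2
    by_cases hstar : ∀ t ∈ P, t ≠ g → Touch t z
    · exact hext (extends_of_star (u := z) (c := g.2.2) (by omega) hS hT hP hPn.le hblk fun t ht => by
        by_cases htg : t = g
        · exact Or.inr (by rw [htg])
        · exact Or.inl (hstar t ht htg))
    push Not at hstar
    obtain ⟨g', hg', hgg, hg'z⟩ := hstar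
    obtain ⟨w, k, hk, hw⟩ := key g' hg'
    have hne : ∀ t, Touch t z → t ≠ g' := by rintro t h rfl; exact hg'z h
    have hw1 := hw t₁ ht₁ (hne _ h1)
    have hw2 := hw t₂ ht₂ (hne _ h2)
    have hwz : ∀ t ∈ P, t ≠ g' → (Touch t z ∨ Touch t (flipAt k z)) ∧ t.2.1 ≠ k := by
      intro t ht htg
      refine ⟨?_, (hw t ht htg).2⟩
      rcases end_of_two_adjacent (fun h => h12 (hsP t₁ ht₁ t₂ ht₂ z h1 h2 h)) h1 h2 hw1.1 hw2.1
        with rfl | rfl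
      · exact (hw t ht htg).1
      · rw [flipAt_flipAt]; exact (hw t ht htg).1.symm
    -- If the two edges coincided, all of `P` would be adjacent to that edge.
    have hkj : k ≠ j := by
      rintro rfl
      refine hsat (sat_of_forall_touch hP (by omega) hinj (Finset.mem_of_mem_erase hk) (z := z)
        fun t ht => ?_)
      by_cases htg : t = g
      · subst htg; exact hwz t ht hgg.symm
      · exact hz t ht htg
    -- All entries except `g` and `g'` are at `z` and avoid the directions `i`, `j`, `k`: there are
    -- `n - 1` entries for `n - 2` directions.
    have hcard : ((P.erase g).erase g').card ≤ (((S.erase i).erase j).erase k).card := by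
      refine Finset.card_le_card_of_injOn (fun t => t.2.1) (fun t ht => ?_) fun t ht u hu h => ?_
      · simp only [Finset.coe_erase, Set.mem_sdiff, Finset.mem_coe, Set.mem_singleton_iff] at ht ⊢
        exact ⟨⟨⟨hP.dir t ht.1.1, hdir t ht.1.1⟩, (hz t ht.1.1 ht.1.2).2⟩, (hwz t ht.1.1 ht.2).2⟩
      · have hall : ∀ t ∈ (P.erase g).erase g', t ∈ P ∧ Touch t z := fun t ht => by
          simp only [Finset.mem_erase] at ht
          refine ⟨ht.2.2, ?_⟩
          by_contra htz
          exact not_touch_flipAt_flipAt hkj (((hwz t ht.2.2 ht.1).1.resolve_left htz))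
            ((hz t ht.2.2 ht.2.1).1.resolve_left htz)
        exact hsP t (hall t ht).1 u (hall u hu).1 z (hall t ht).2 (hall u hu).2 h
    rw [Finset.card_erase_of_mem (Finset.mem_erase.2 ⟨hgg, hg'⟩), Finset.card_erase_of_mem hg,
      Finset.card_erase_of_mem (Finset.mem_erase.2 ⟨hkj, hk⟩), Finset.card_erase_of_mem hj,
      Finset.card_erase_of_mem hi] at hcard
    omega
  obtain ⟨g, hg⟩ := Finset.card_pos.1 (show 0 < P.card by omega)
  obtain ⟨z, j, hj, hz⟩ := key g hg
  by_cases h1 : 1 < ((P.erase g).filter fun t => z = t.1 ∨ z = flipAt t.2.1 t.1).card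
  · obtain ⟨t₁, h1, t₂, h2, h12⟩ := Finset.one_lt_card.1 h1
    simp only [Finset.mem_filter, Finset.mem_erase] at h1 h2
    exact main z j hj g hg hz t₁ h1.1.2 t₂ h2.1.2 h1.1.1 h2.1.1 h12 h1.2 h2.2
  · have h2 := Finset.card_filter_add_card_filter_not (s := P.erase g)
      (fun t => z = t.1 ∨ z = flipAt t.2.1 t.1)
    rw [Finset.card_erase_of_mem hg] at h2
    obtain ⟨t₁, h1, t₂, h2, h12⟩ := Finset.one_lt_card.1 (show 1 < ((P.erase g).filter
      fun t => ¬ (z = t.1 ∨ z = flipAt t.2.1 t.1)).card by omega)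
    simp only [Finset.mem_filter, Finset.mem_erase] at h1 h2
    refine main (flipAt j z) j hj g hg (fun t ht htg => ?_) t₁ h1.1.2 t₂ h2.1.2 h1.1.1 h2.1.1 h12
      ((hz _ h1.1.2 h1.1.1).1.resolve_left h1.2) ((hz _ h2.1.2 h2.1.1).1.resolve_left h2.2)
    rw [flipAt_flipAt]
    exact (hz t ht htg).imp Or.symm id

/-- The far side contains only `e`, so only `e` can be the mirror image. -/
theorem Mirrored.touch_of_lone {i : ι} {s : Bool} {e : Entry ι C} (hdir : ∀ t ∈ P, t.2.1 ≠ i)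
    (hs : ∀ t ∈ P, t ≠ e → t.1 i = s) {g : Entry ι C} (hg : g ∈ P) (hge : g ≠ e)
    (h : Mirrored P i g) : Touch g (flipAt i e.1) ∧ g.2.1 = e.2.1 := by
  obtain ⟨u, hu, h1, h2⟩ := h
  obtain rfl : u = e := by
    by_contra hne
    have h3 := touch_side (hdir u hu) h2
    rw [flipAt_apply_self, hs u hu hne, hs g hg hge] at h3
    cases s <;> simp at h3
  exact ⟨touch_mirror' h1 h2 (touch_fst u), h1.symm⟩

/-- All edges but one are incident with `p` or its neighbour in direction `a`. -/
theorem extends_of_adjacent (hn : 4 ≤ n) (hB : ExtendsAt ι C n) (hS : S.card = n + 1)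
    (hT : T.card = n + 1) (hP : Good S T P) (hsP : Simple P) (hPn : P.card = n + 1)
    (hblk : ¬ Blk S T P) {i : ι} (hi : i ∈ S)
    (hdir : ∀ t ∈ P, t.2.1 ≠ i) {e : Entry ι C} (he : e ∈ P) {s : Bool} (hes : e.1 i ≠ s)
    (hs : ∀ t ∈ P, t ≠ e → t.1 i = s)
    (hinj : ∀ t ∈ P, ∀ u ∈ P, t ≠ e → u ≠ e → t.2.2 = u.2.2 → t = u) {p : ι → Bool} {a : ι}
    (hp : ∀ t ∈ P, t ≠ e → Touch t p ∨ Touch t (flipAt a p)) : Extends S T P := by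
  have hstar : ∀ v, (∀ t ∈ P, t.2.2 ≠ e.2.2 → Touch t v) → Extends S T P := fun v hv =>
    extends_of_star (u := v) (c := e.2.2) (by omega) hS hT hP hPn.le hblk fun t ht => by
      by_cases hte : t.2.2 = e.2.2
      · exact Or.inr hte
      · exact Or.inl (hv t ht hte)
  by_cases h1 : ∀ t ∈ P, t.2.2 ≠ e.2.2 → Touch t p
  · exact hstar _ h1
  by_cases h2 : ∀ t ∈ P, t.2.2 ≠ e.2.2 → Touch t (flipAt a p)
  · exact hstar _ h2
  push Not at h1 h2
  obtain ⟨h, hh, hhe', hhp⟩ := h1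
  obtain ⟨g, hg, hge', hgp⟩ := h2
  have hge : g ≠ e := fun h => hge' (by rw [h])
  have hhe : h ≠ e := fun h => hhe' (by rw [h])
  have hgp' := (hp g hg hge).resolve_right hgp
  have hhp' := (hp h hh hhe).resolve_left hhp
  have hga : g.2.1 ≠ a := dir_ne_of_not_touch hgp' hgp
  have hha : h.2.1 ≠ a := dir_ne_of_not_touch hhp' (by rwa [flipAt_flipAt])
  -- At most one of `g` and `h` is the mirror image of `e`; the roles are exchanged if it is `g`.
  by_cases hgm : Mirrored P i g
  · refine extends_of_double_star hn hB hS hT hP hsP hPn hi hdir he hes hs hinj (p := flipAt a p)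
      (a := a) (fun t ht hte => by rw [flipAt_flipAt]; exact (hp t ht hte).symm) hh hg hhp' hha
      (by rwa [flipAt_flipAt]) hga hhe' hge' fun hhm => hhp ?_
    have m1 := hgm.touch_of_lone hdir hs hg hge
    have m2 := hhm.touch_of_lone hdir hs hh hhe
    exact hsP h hh g hg _ m2.1 m1.1 (m2.2.trans m1.2.symm) ▸ hgp'
  · exact extends_of_double_star hn hB hS hT hP hsP hPn hi hdir he hes hs hinj hp hg hh hgp' hga
      hhp' hha hge' hhe' hgm

/-- An unmirrored entry `g` that does not meet the mirror image of `e` can take the color of `e` on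
both sides. The side `s` stays rainbow, so failure produces a saturated edge adjacent to all entries
but `e`. If no such `g` exists, all entries but `e` touch the mirror image of `e`. Both cases end in
`extends_of_adjacent`. -/
theorem extends_of_rainbow_of_lone (hn : 4 ≤ n) (hB : ExtendsAt ι C n) (hS : S.card = n + 1)
    (hT : T.card = n + 1) (hP : Good S T P) (hsP : Simple P) (hPn : P.card = n + 1)
    (hinj : ∀ t ∈ P, ∀ u ∈ P, t.2.2 = u.2.2 → t = u) (hblk : ¬ Blk S T P) {i : ι} (hi : i ∈ S)
    (hdir : ∀ t ∈ P, t.2.1 ≠ i) {e : Entry ι C} (he : e ∈ P) {s : Bool} (hes : e.1 i ≠ s)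
    (hs : ∀ t ∈ P, t ≠ e → t.1 i = s) : Extends S T P := by
  have hadj : ∀ {p a}, (∀ t ∈ P, t ≠ e → Touch t p ∨ Touch t (flipAt a p)) → Extends S T P :=
    extends_of_adjacent hn hB hS hT hP hsP hPn hblk hi hdir he hes hs
      fun t ht u hu _ _ => hinj t ht u hu
  by_cases hfar : ∃ g ∈ P, g ≠ e ∧ ¬ Mirrored P i g ∧ ∀ v, Touch g v → ¬ Touch e (flipAt i v)
  swap
  · refine hadj (p := flipAt i e.1) (a := e.2.1) fun t ht hte => ?_
    by_cases hm : Mirrored P i t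
    · exact Or.inl (hm.touch_of_lone hdir hs ht hte).1
    · by_contra hcon
      push Not at hcon
      refine hfar ⟨t, ht, hte, hm, fun v hv hv' => ?_⟩
      rcases hv' with h | h
      · exact hcon.1 (by rwa [← h, flipAt_flipAt])
      · refine hcon.2 ?_
        rw [flipAt_comm, ← h, flipAt_flipAt]; exact hv
  obtain ⟨g, hg, hge, hgm, hfar⟩ := hfar
  by_contra hext
  have hmir' : ∀ y, ¬ Has P (flipAt i g.1) g.2.1 y := fun y hy => hgm (Mirrored.has.2 ⟨y, hy⟩)
  have hx : e.2.2 ≠ g.2.2 := fun h => hge (hinj g hg e he h.symm)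
  have hcT := hP.col g hg
  have hgi := hdir g hg
  have hgood := good_exchangeSide hP hsP hg hgi (fun t ht h' => Or.inl (hinj t ht g hg h')) hmir'
    (hP.col e he) hx (fun t ht hti htc v hv => by
      obtain rfl := hinj t ht e he htc
      refine ⟨fun hv' => hes ?_, hfar v hv⟩
      rw [← touch_side hti hv', touch_side hgi hv, hs g hg hge])
  refine hext (extends_of_exchange (x := e.2.2) hP hsP hi hg hgi
    (fun t ht hti => (hdir t ht hti).elim) hmir' fun b => ?_)
  set F := P.filter fun t => t ≠ g ∧ t.2.1 ≠ i ∧ t.1 i = b with hF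
  have hcard : (exchangeSide P i g e.2.2 b).card ≤ F.card + 1 := Finset.card_insert_le _ _
  rcases Nat.lt_or_ge (exchangeSide P i g e.2.2 b).card n with hlt | hge'
  · exact extends_erase_of_card_lt hS hT hi hcT (hgood b) hlt
  have hbs : b = s := by
    by_contra hbs
    have hF1 : F ⊆ {e} := fun t ht => by
      rw [Finset.mem_filter] at ht
      rw [Finset.mem_singleton]
      by_contra hte
      exact hbs (ht.2.2.2.symm.trans (hs t ht.1 hte))
    have := Finset.card_le_card hF1
    rw [Finset.card_singleton] at this
    omega
  subst hbs
  have heF : e ∉ F := fun h => hes (Finset.mem_filter.1 h).2.2.2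
  have hFP : F ⊆ P.erase g := fun t ht => by
    rw [Finset.mem_filter] at ht
    exact Finset.mem_erase.2 ⟨ht.2.1, ht.1⟩
  have hPg : (P.erase g).card = n := by rw [Finset.card_erase_of_mem hg, hPn]; rfl
  have hSi : (S.erase i).card = n := by rw [Finset.card_erase_of_mem hi, hS]; rfl
  have hTc : (T.erase g.2.2).card = n := by rw [Finset.card_erase_of_mem hcT, hT]; rfl
  have hQn : (exchangeSide P i g e.2.2 b).card ≤ n := by
    have := card_add_one_le hFP (Finset.mem_erase.2 ⟨hge.symm, he⟩) heF
    omega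
  have hsat : ¬ Sat (S.erase i) (T.erase g.2.2) (exchangeSide P i g e.2.2 b) := by
    rintro ⟨z, j, hj, h0, h1⟩
    have hz := (sat_struct (by omega) h0 h1).1
    refine hext (hadj (p := z) (a := j) fun t ht hte => ?_)
    by_cases htg : t = g
    · subst htg
      have := (hz _ (Finset.mem_insert_self _ _)).1
      rwa [setAt_of_eq (hs t ht hte)] at this
    · exact (hz t (Finset.mem_insert_of_mem
        (Finset.mem_filter.2 ⟨ht, htg, hdir t ht, hs t ht hte⟩))).1
  refine hB.erase hS hT hi hcT (hgood b) hQn hsat fun hb => hsat ?_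
  have hFe : ∀ t ∈ F, t.2.2 ≠ e.2.2 := fun t ht h =>
    heF (hinj t (Finset.mem_filter.1 ht).1 e he h ▸ ht)
  refine sat_of_blk (by omega) (hgood b) (by omega) (fun t ht u hu htu => ?_) hb
  rcases Finset.mem_insert.1 ht with rfl | ht <;> rcases Finset.mem_insert.1 hu with rfl | hu
  · rfl
  · exact (hFe u hu htu.symm).elim
  · exact (hFe t ht htu).elim
  · exact hinj t (Finset.mem_filter.1 ht).1 u (Finset.mem_filter.1 hu).1 htu

end RainbowCases

/-! ### All colors different: conclusion -/

section RainbowStep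

variable {ι C : Type*} [DecidableEq ι] {S : Finset ι} {T : Finset C} {P Q : Finset (Entry ι C)}
  {n : ℕ}

theorem touch_setAt_of_adjacent {i : ι} {t : Entry ι C} (hti : t.2.1 ≠ i) {z : ι → Bool}
    (h : Touch t z ∨ Touch t (flipAt i z)) (b : Bool) :
    Touch (setAt i b t.1, t.2.1, t.2.2) (setAt i b z) := by
  rcases h with (h | h) | (h | h)
  · left; rw [h]
  · right; rw [h, setAt_flipAt hti]
  · left; rw [← setAt_flipAt_self, h]
  · right; rw [← setAt_flipAt_self, h, setAt_flipAt hti]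

/-- A set of `|S|` edges with an unused direction is not invariant under the reflections in all of
its unused directions. -/
theorem exists_not_mirrored (hP : Good S T P) (hPS : P.card = S.card) (hS : 3 ≤ S.card)
    (hW : ∃ i ∈ S, ∀ t ∈ P, t.2.1 ≠ i) :
    ∃ i ∈ S, (∀ t ∈ P, t.2.1 ≠ i) ∧ ∃ g ∈ P, ¬ Mirrored P i g := by
  by_contra hcon
  push Not at hcon
  obtain ⟨g, hg⟩ := Finset.card_pos.1 (show 0 < P.card by omega)
  -- A used direction is assigned an entry in it (its own direction being assigned `g`), an unused
  -- direction the mirror image of `g`. No entry serves two directions, so these are all the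
  -- entries.
  have hbij := rel_bijective (P := P) (S := S)
    (r := fun t j => (t.2.1 = j ∧ (j = g.2.1 → t = g)) ∨
      (t.2.1 = g.2.1 ∧ Touch t (flipAt j g.1) ∧ j ≠ g.2.1))
    (fun j hj => by
      by_cases hjg : j = g.2.1
      · exact ⟨g, hg, Or.inl ⟨hjg.symm, fun _ => rfl⟩⟩
      by_cases hju : ∀ t ∈ P, t.2.1 ≠ j
      · obtain ⟨u, hu, h1, h2⟩ := hcon j hj hju g hg
        exact ⟨u, hu, Or.inr ⟨h1, h2, hjg⟩⟩
      · push Not at hju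
        obtain ⟨t, ht, h⟩ := hju
        exact ⟨t, ht, Or.inl ⟨h, fun h => (hjg h).elim⟩⟩)
    (fun t ht j hj k hk h1 h2 => by
      have hmix : ∀ {j k : ι}, (t.2.1 = j ∧ (j = g.2.1 → t = g)) →
          (t.2.1 = g.2.1 ∧ Touch t (flipAt k g.1) ∧ k ≠ g.2.1) → j = k := by
        rintro j k ⟨rfl, h⟩ ⟨h1, h2, h3⟩
        obtain rfl := h h1
        exact (h3 (dir_eq_of_touch (touch_fst t) h2).symm).elim
      rcases h1 with h1 | h1 <;> rcases h2 with h2 | h2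
      · exact h1.1.symm.trans h2.1
      · exact hmix h1 h2
      · exact (hmix h2 h1).symm
      · by_contra hjk
        exact not_touch_flipAt_flipAt hjk h1.2.1 h2.2.1) hPS.le
  -- If all entries are parallel, reflecting `g` in two unused directions gives an entry outside
  -- this list. Otherwise some entry is alone in its direction, yet its mirror image shares that
  -- direction.
  by_cases hall : ∀ t ∈ P, t.2.1 = g.2.1
  · obtain ⟨i, hi, l, hl, hil⟩ := Finset.one_lt_card.1
      (show 1 < (S.erase g.2.1).card by rw [Finset.card_erase_of_mem (hP.dir g hg)]; omega)
    rw [Finset.mem_erase] at hi hl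
    obtain ⟨u, hu, u1, u2⟩ := hcon i hi.2 (fun t ht => by rw [hall t ht]; exact hi.1.symm) g hg
    obtain ⟨v, hv, v1, v2⟩ := hcon l hl.2 (fun t ht => by rw [hall t ht]; exact hl.1.symm) u hu
    have hvd : v.2.1 = g.2.1 := v1.trans u1
    have hv' : Touch v (flipAt l (flipAt i g.1)) :=
      touch_mirror v1 v2 u2
    obtain ⟨j, hj, ⟨h1, h2⟩ | ⟨-, h2, h3⟩⟩ := hbij.1 v hv
    · have := (touch_fst g).apply_eq (h2 (h1.symm.trans hvd) ▸ hv') hi.1.symm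
      rw [flipAt_apply_of_ne hil, flipAt_apply_self] at this
      simp at this
    · by_cases hji : j = i
      · have := h2.apply_eq hv' (i := l) (hvd ▸ hl.1.symm)
        rw [flipAt_apply_self, flipAt_apply_of_ne (Ne.symm hil),
          flipAt_apply_of_ne (hji ▸ hil.symm)] at this
        simp at this
      · have := h2.apply_eq hv' (i := i) (hvd ▸ hi.1.symm)
        rw [flipAt_apply_of_ne hil, flipAt_apply_self, flipAt_apply_of_ne (Ne.symm hji)] at this
        simp at this
  · push Not at hall
    obtain ⟨h, hh, hhg⟩ := hall
    obtain ⟨i, hi, hiu⟩ := hW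
    obtain ⟨u, hu, u1, u2⟩ := hcon i hi hiu h hh
    have : u = h := hbij.2.1 u hu h hh h.2.1 (hP.dir h hh) (Or.inl ⟨u1, fun h => (hhg h).elim⟩)
      (Or.inl ⟨rfl, fun h => (hhg h).elim⟩)
    subst this
    exact hiu u hu (dir_eq_of_touch (touch_fst u) u2)

variable [Fintype ι] [DecidableEq C]

/-- Exactly one direction is unused. -/
theorem extends_of_rainbow_of_unused_direction (hn : 4 ≤ n) (hB : ExtendsAt ι C n)
    (hS : S.card = n + 1) (hT : T.card = n + 1) (hP : Good S T P) (hPn : P.card = n + 1)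
    (hinj : ∀ t ∈ P, ∀ u ∈ P, t.2.2 = u.2.2 → t = u) (hsat : ¬ Sat S T P) {i : ι} (hi : i ∈ S)
    (hdir : ∀ t ∈ P, t.2.1 ≠ i) (hW : ∀ j ∈ S, j ≠ i → ∃ t ∈ P, t.2.1 = j) : Extends S T P := by
  by_contra hext
  obtain ⟨e, -⟩ := Finset.card_pos.1 (show 0 < P.card by omega)
  have : Nonempty (Entry ι C) := ⟨e⟩
  choose! r hrP hr using fun j (hj : j ∈ S.erase i) =>
    hW j (Finset.mem_of_mem_erase hj) (Finset.ne_of_mem_erase hj)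
  have hSi : (S.erase i).card = n := by rw [Finset.card_erase_of_mem hi, hS]; rfl
  -- As `n + 1` entries use `n` directions, only one direction `x` occurs twice.
  obtain ⟨x, hx⟩ : ∃ x, ∀ t ∈ P, t.2.1 ≠ x → t = r t.2.1 := by
    have hcard : (P \ (S.erase i).image r).card = 1 := by
      rw [Finset.card_sdiff_of_subset, Finset.card_image_of_injOn, hSi, hPn]
      · omega
      · intro j hj k hk h
        rw [← hr j hj, ← hr k hk]; exact congrArg (fun t : Entry ι C => t.2.1) h
      · intro t ht
        obtain ⟨j, hj, rfl⟩ := Finset.mem_image.1 ht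
        exact hrP j hj
    obtain ⟨x, hx⟩ := Finset.card_eq_one.1 hcard
    refine ⟨x.2.1, fun t ht htx => ?_⟩
    by_contra hne
    have : t ∈ P \ (S.erase i).image r := by
      refine Finset.mem_sdiff.2 ⟨ht, fun h => hne ?_⟩
      obtain ⟨j, hj, rfl⟩ := Finset.mem_image.1 h
      rw [hr j hj]
    rw [hx, Finset.mem_singleton] at this
    exact htx (by rw [this])
  have key : ∀ l ∈ S.erase i, l ≠ x → ∃ z, ∀ t ∈ P, t.2.1 ≠ l → Touch t z ∨ Touch t (flipAt i z) := by
    intro l hl hlx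
    have hu : ∀ t ∈ P, t.2.1 = l → t = r l := fun t ht h => by
      rw [hx t ht (by rwa [h]), h]
    obtain ⟨b, -, z, j, hj, h⟩ := (extends_of_rainbow_of_dir hB hS hT hP hPn hinj (hrP l hl)
      (by rw [hr l hl]; exact hu)).resolve_left hext
    rw [hr l hl, Finset.mem_erase] at hj
    -- The saturated edge avoids the directions of the other entries, and only `i` is left.
    obtain rfl : j = i := by
      by_contra hji
      have hj' : j ∈ S.erase i := Finset.mem_erase.2 ⟨hji, hj.2⟩
      exact (h (r j) (hrP j hj') (fun e => hj.1 (by rw [← hr j hj', e, hr l hl]))).2 (hr j hj')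
    exact ⟨z, fun t ht htl => (h t ht (fun e => htl (by rw [e, hr l hl]))).1⟩
  have hc : n - 1 ≤ ((S.erase i).erase x).card := hSi ▸ Finset.pred_card_le_card_erase
  obtain ⟨l, hl, l', hl', hll⟩ := Finset.one_lt_card.1 (show 1 < ((S.erase i).erase x).card by omega)
  obtain ⟨hlx, hl⟩ := Finset.mem_erase.1 hl
  obtain ⟨hlx', hl'⟩ := Finset.mem_erase.1 hl'
  obtain ⟨z, hz⟩ := key l hl hlx
  obtain ⟨z', hz'⟩ := key l' hl' hlx'
  obtain ⟨m, hm, m', hm', hmm⟩ := Finset.one_lt_card.1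
    (show 1 < (((S.erase i).erase l).erase l').card by
      rw [Finset.card_erase_of_mem (Finset.mem_erase.2 ⟨hll.symm, hl'⟩),
        Finset.card_erase_of_mem hl, hSi]
      omega)
  -- By `4 ≤ n` two directions remain besides `l` and `l'`. Projected along `i`, the entries in them
  -- touch both vertices; if these differed, they would be neighbours in two directions.
  have hzz : setAt i true z' = setAt i true z := by
    by_contra hne
    have : ∀ m ∈ ((S.erase i).erase l).erase l',
        setAt i true z' = flipAt m (setAt i true z) := by
      intro m hm
      simp only [Finset.mem_erase] at hm
      have hm' : m ∈ S.erase i := Finset.mem_erase.2 hm.2.2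
      have ht := hrP m hm'
      have hd := hr m hm'
      have := (touch_setAt_of_adjacent (hdir _ ht) (hz _ ht (by rw [hd]; exact hm.2.1)) true).eq_or
        (touch_setAt_of_adjacent (hdir _ ht) (hz' _ ht (by rw [hd]; exact hm.1)) true)
      simp only [hd] at this
      exact this.resolve_left hne
    exact hmm (flipAt_eq_flipAt.1 ((this m hm).symm.trans (this m' hm')))
  refine hsat (sat_of_forall_touch hP (by omega) hinj hi (z := z) fun t ht => ⟨?_, hdir t ht⟩)
  by_cases htl : t.2.1 = l
  · have h1 := hz' t ht (htl ▸ hll)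
    have : z' = z ∨ z' = flipAt i z := by
      by_cases h : z' i = z i
      · left
        rw [← setAt_self i z', ← setAt_setAt i _ true, hzz, setAt_setAt, h, setAt_self]
      · right
        rw [← setAt_self i z', ← setAt_setAt i _ true, hzz, setAt_setAt,
          setAt_of_ne (fun h' => h h'.symm)]
    rcases this with rfl | rfl
    · exact h1
    · rw [flipAt_flipAt] at h1; exact h1.symm
  · exact hz t ht htl

/-- Choose an unused direction `i` in which `P` is not symmetric. Sides with at most one entry are
already settled. On a side with at least three, every entry must be mirrored: otherwise it can be
exchanged with a distant entry, or all entries crowd around it. Comparing sizes, both sides have at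
least three entries, and `P` is symmetric after all. -/
theorem extends_of_rainbow (hn : 4 ≤ n) (hB : ExtendsAt ι C n) (hS : S.card = n + 1)
    (hT : T.card = n + 1) (hP : Good S T P) (hsP : Simple P) (hPn : P.card = n + 1)
    (hinj : ∀ t ∈ P, ∀ u ∈ P, t.2.2 = u.2.2 → t = u) (hsat : ¬ Sat S T P) (hblk : ¬ Blk S T P) :
    Extends S T P := by
  by_cases hW : ∀ j ∈ S, ∃ t ∈ P, t.2.1 = j
  · exact extends_of_rainbow_of_all_directions hB hS hT hP hPn hinj hW
  push Not at hW
  obtain ⟨i, hi, hdir, g₀, hg₀, hm₀⟩ := exists_not_mirrored hP (by omega) (by omega) hW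
  by_contra hext
  have hcard : ∀ b, 2 ≤ (P.filter fun t => t.1 i = b).card := by
    intro b
    by_contra hlt
    rcases Nat.eq_zero_or_pos (P.filter fun t => t.1 i = b).card with h0 | h0
    · rw [Finset.card_eq_zero, Finset.filter_eq_empty_iff] at h0
      refine hext (extends_of_rainbow_of_oneSided hn hB hS hT hP hsP hPn hinj hsat hblk hi hdir
        (s := !b) fun t ht => ?_)
      have := h0 ht
      cases b <;> simpa using this
    · obtain ⟨e, he⟩ := Finset.card_eq_one.1 (show (P.filter fun t => t.1 i = b).card = 1 by omega)
      have he' : e ∈ P.filter fun t => t.1 i = b := he ▸ Finset.mem_singleton_self _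
      rw [Finset.mem_filter] at he'
      refine hext (extends_of_rainbow_of_lone hn hB hS hT hP hsP hPn hinj hblk hi hdir he'.1
        (s := !b) (by rw [he'.2]; cases b <;> simp) fun t ht hte => ?_)
      have : ¬ t.1 i = b := fun h => hte (by
        have : t ∈ P.filter fun t => t.1 i = b := Finset.mem_filter.2 ⟨ht, h⟩
        rwa [he, Finset.mem_singleton] at this)
      cases b <;> simpa using this
  have hsum : ∀ b, (P.filter fun t => t.1 i = b).card + (P.filter fun t => t.1 i = !b).card
      = n + 1 := by
    intro b
    rw [← hPn, ← Finset.card_filter_add_card_filter_not (s := P) (fun t => t.1 i = b)]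
    congr 2
    refine Finset.filter_congr fun t _ => ?_
    cases t.1 i <;> cases b <;> simp
  have hmir : ∀ b, 3 ≤ (P.filter fun t => t.1 i = b).card → ∀ g ∈ P, g.1 i = b → Mirrored P i g := by
    intro s hs g hg hgs
    by_contra hgm
    have hmir' : ∀ y, ¬ Has P (flipAt i g.1) g.2.1 y := fun y hy => hgm (Mirrored.has.2 ⟨y, hy⟩)
    have hgi := hdir g hg
    by_cases hfar : ∃ h ∈ P, h ≠ g ∧ ∀ v, Touch g v → ¬ Touch h v ∧ ¬ Touch h (flipAt i v)
    · obtain ⟨h, hh, hhg, hfar⟩ := hfar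
      have hcT := hP.col g hg
      refine hext (extends_of_exchange (x := h.2.2) hP hsP hi hg hgi
        (fun t ht hti => (hdir t ht hti).elim) hmir' fun b => extends_erase_of_card_lt hS hT hi hcT
        (good_exchangeSide hP hsP hg hgi (fun t ht h' => Or.inl (hinj t ht g hg h')) hmir'
          (hP.col h hh) (fun h' => hhg (hinj h hh g hg h')) (fun t ht hti htc => by
            rw [hinj t ht h hh htc]; exact hfar) b) ?_)
      refine (Finset.card_insert_le _ _).trans_lt ?_
      have h1 : (P.filter fun t => t ≠ g ∧ t.2.1 ≠ i ∧ t.1 i = b) ⊆ P.filter fun t => t.1 i = b :=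
        fun t ht => by
          rw [Finset.mem_filter] at ht ⊢
          exact ⟨ht.1, ht.2.2.2⟩
      have h2 := hsum b
      have h3 := hcard (!b)
      by_cases hbs : b = s
      · subst hbs
        have := card_add_one_le h1 (Finset.mem_filter.2 ⟨hg, hgs⟩) (by simp)
        omega
      · have h4 : (!b) = s := by cases b <;> cases s <;> simp_all
        rw [h4] at h2
        have := Finset.card_le_card h1
        omega
    -- All entries meet `g` or its mirror image, so in any second unused direction `l` they lie on
    -- one side. Without such an `l`, only `i` is unused.
    · push Not at hfar
      by_cases hl : ∃ l ∈ S, l ≠ i ∧ ∀ t ∈ P, t.2.1 ≠ l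
      · obtain ⟨l, hl, hli, hld⟩ := hl
        refine hext (extends_of_rainbow_of_oneSided hn hB hS hT hP hsP hPn hinj hsat hblk hl hld
          (s := g.1 l) fun t ht => ?_)
        by_cases htg : t = g
        · rw [htg]
        obtain ⟨v, hv, h⟩ := hfar t ht htg
        rw [← touch_side (hld g hg) hv]
        by_cases htv : Touch t v
        · rw [touch_side (hld t ht) htv]
        · rw [← touch_side (hld t ht) (h htv), flipAt_apply_of_ne hli]
      · push Not at hl
        exact hext (extends_of_rainbow_of_unused_direction hn hB hS hT hP hPn hinj hsat hi hdir hl)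
  -- A side with two entries cannot contain mirror images of the at least three entries opposite.
  have h3 : ∀ b, 3 ≤ (P.filter fun t => t.1 i = b).card := by
    by_contra hcon
    push Not at hcon
    obtain ⟨b, hb⟩ := hcon
    have hb' := hsum b
    have hm := hmir (!b) (by omega)
    choose! m hmP hmd hmt using hm
    have : (P.filter fun t => t.1 i = !b).card ≤ (P.filter fun t => t.1 i = b).card := by
      refine Finset.card_le_card_of_injOn m (fun t ht => ?_) fun t ht u hu htu => ?_
      · simp only [Finset.coe_filter, Set.mem_ofPred_eq] at ht ⊢
        refine ⟨hmP t ht.1 ht.2, ?_⟩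
        have := touch_side (hdir _ (hmP t ht.1 ht.2)) (hmt t ht.1 ht.2)
        rw [← this, flipAt_apply_self, ht.2, Bool.not_not]
      · simp only [Finset.coe_filter, Set.mem_ofPred_eq] at ht hu
        refine hsP t ht.1 u hu.1 (flipAt i (m t).1) (touch_mirror' (hmd t ht.1 ht.2)
          (hmt t ht.1 ht.2) (touch_fst _)) ?_ ?_
        · rw [htu]
          exact touch_mirror' (hmd u hu.1 hu.2) (hmt u hu.1 hu.2) (touch_fst _)
        · rw [← hmd t ht.1 ht.2, htu, hmd u hu.1 hu.2]
    omega
  exact hm₀ (hmir _ (h3 _) g₀ hg₀ rfl)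

end RainbowStep

/-! ### Repeated colors: an entry alone on its side -/

section Recolor

variable {ι C : Type*} [DecidableEq ι] {S : Finset ι} {T : Finset C} {P Q : Finset (Entry ι C)}
  {n : ℕ}

theorem touch_of_touch_setAt {i : ι} {t : Entry ι C} {s b : Bool} (hti : t.2.1 ≠ i) (hts : t.1 i = s)
    {y : C} {v : ι → Bool} (h : Touch (setAt i b t.1, t.2.1, y) v) : Touch t (setAt i s v) := by
  rcases h with h | h <;> simp only at h <;> subst h
  · rw [setAt_setAt, setAt_of_eq hts]; exact touch_fst t
  · rw [setAt_flipAt hti, setAt_setAt, setAt_of_eq hts]; exact touch_flip t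

variable [Fintype ι] [DecidableEq C]

/-- The spare color `c₀` goes to direction `i`. The side of `e` carries one entry at most, so
everything depends on the other side. -/
theorem extends_of_erase_lone (hn : 4 ≤ n) (hS : S.card = n + 1) (hT : T.card = n + 1)
    (hP : Good S T P) {i : ι} (hi : i ∈ S) (hdir : ∀ t ∈ P, t.2.1 ≠ i) {e : Entry ι C} {s : Bool}
    (hes : e.1 i ≠ s) (hs : ∀ t ∈ P, t ≠ e → t.1 i = s) {c₀ : C} (hc₀T : c₀ ∈ T)
    (hc₀ : ∀ t ∈ P, t.2.2 ≠ c₀)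
    (h : Good (S.erase i) (T.erase c₀) (P.erase e) → Extends (S.erase i) (T.erase c₀) (P.erase e)) :
    Extends S T P := by
  refine extends_of_split hP hi hc₀T (fun t ht hti => (hdir t ht hti).elim) fun b => ?_
  have hQ : Good (S.erase i) (T.erase c₀) (P.filter fun t => t.2.1 ≠ i ∧ t.1 i = b) :=
    hP.filter_side fun t ht h => ⟨h.1, hc₀ t ht⟩
  by_cases hbs : b = s
  · subst hbs
    have hQe : (P.filter fun t => t.2.1 ≠ i ∧ t.1 i = b) = P.erase e := by
      ext t
      rw [Finset.mem_filter, Finset.mem_erase]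
      exact ⟨fun h => ⟨fun h' => hes (h' ▸ h.2.2), h.1⟩, fun h => ⟨h.2, hdir t h.2, hs t h.2 h.1⟩⟩
    rw [hQe] at hQ ⊢
    exact h hQ
  · refine extends_erase_of_card_lt hS hT hi hc₀T hQ ?_
    have hF1 : (P.filter fun t => t.2.1 ≠ i ∧ t.1 i = b) ⊆ {e} := fun t ht => by
      rw [Finset.mem_filter] at ht
      rw [Finset.mem_singleton]
      by_contra hte
      exact hbs (ht.2.2.symm.trans (hs t ht.1 hte))
    have := Finset.card_le_card hF1
    rw [Finset.card_singleton] at this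
    omega

/-- The edge `e` is alone on its side of `i` and its colour occurs at least twice on the other
side. -/
theorem extends_of_lone_color (hn : 4 ≤ n) (hB : ExtendsAt ι C n) (hS : S.card = n + 1)
    (hT : T.card = n + 1) (hP : Good S T P) (hsP : Simple P) (hPn : P.card = n + 1)
    (hblk : ¬ Blk S T P) {i : ι} (hi : i ∈ S) (hdir : ∀ t ∈ P, t.2.1 ≠ i) {e : Entry ι C}
    (he : e ∈ P) {s : Bool} (hes : e.1 i ≠ s) (hs : ∀ t ∈ P, t ≠ e → t.1 i = s) {c₀ : C}
    (hc₀T : c₀ ∈ T) (hc₀ : ∀ t ∈ P, t.2.2 ≠ c₀) {t₁ t₂ : Entry ι C} (h1 : t₁ ∈ P) (h2 : t₂ ∈ P)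
    (h1e : t₁ ≠ e) (h2e : t₂ ≠ e) (h12 : t₁ ≠ t₂) (hc1 : t₁.2.2 = e.2.2) (hc2 : t₂.2.2 = e.2.2) :
    Extends S T P := by
  by_contra hext
  refine hext (extends_of_erase_lone hn hS hT hP hi hdir hes hs hc₀T hc₀ fun hQ => ?_)
  have hSi : (S.erase i).card = n := by rw [Finset.card_erase_of_mem hi, hS]; rfl
  have hTc : (T.erase c₀).card = n := by rw [Finset.card_erase_of_mem hc₀T, hT]; rfl
  have hPe : (P.erase e).card = n := by rw [Finset.card_erase_of_mem he, hPn]; rfl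
  have m1 := Finset.mem_erase.2 ⟨h1e, h1⟩
  have m2 := Finset.mem_erase.2 ⟨h2e, h2⟩
  refine hB.erase hS hT hi hc₀T hQ (by omega) (fun h => h12 ?_) fun h => ?_
  · exact h.color_injective (by omega) t₁ m1 t₂ m2 (hc1.trans hc2.symm)
  -- `t₁` and `t₂` cannot both be at `w`, so the blocked color is theirs. It is also the color of
  -- `e`, which leaves a star at `w`.
  · obtain ⟨w, c, -, -, hw, -⟩ := h.exists_touch (by omega)
    by_cases hc : e.2.2 = c
    · refine hext (extends_of_star (u := w) (c := c) (by omega) hS hT hP hPn.le hblk fun t ht => ?_)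
      by_cases hte : t = e
      · exact Or.inr (by rw [hte, hc])
      · by_cases htc : t.2.2 = c
        · exact Or.inr htc
        · exact Or.inl (hw t (Finset.mem_erase.2 ⟨hte, ht⟩) htc)
    · exact h12 (hsP.eq_of_color hP h1 h2 (hw t₁ m1 (hc1 ▸ hc)) (hw t₂ m2 (hc2 ▸ hc))
        (hc1.trans hc2.symm))

/-- Use the edges of colour `c` as the edges where both sides agree. -/
theorem extends_of_recolor (hB : ExtendsAt ι C n) (hS : S.card = n + 1)
    (hT : T.card = n + 1) (hP : Good S T P) (hsP : Simple P) (hPn : P.card = n + 1)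
    {i : ι} (hi : i ∈ S) (hdir : ∀ t ∈ P, t.2.1 ≠ i) {e : Entry ι C}
    (he : e ∈ P) {s : Bool} (hes : e.1 i ≠ s) (hs : ∀ t ∈ P, t ≠ e → t.1 i = s) {c₀ : C}
    (hc₀T : c₀ ∈ T) (hc₀ : ∀ t ∈ P, t.2.2 ≠ c₀) {c : C} (hcT : c ∈ T) (hc₀c : c₀ ≠ c)
    (hec : e.2.2 ≠ c) (hmir : ¬ Has P (flipAt i e.1) e.2.1 c)
    (hdisj : ∀ f ∈ P, f ≠ e → f.2.2 ≠ c → ∀ t ∈ P, t.2.2 = c → ∀ v, Touch f v → ¬ Touch t v)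
    {f h₂ h₃ : Entry ι C} (hf : f ∈ P) (hfe : f ≠ e) (hfc : f.2.2 ≠ c) (h2 : h₂ ∈ P)
    (h2c : h₂.2.2 = c) (h3 : h₃ ∈ P) (h3c : h₃.2.2 = c) (h32 : h₃ ≠ h₂)
    (hcase : (f.2.2 ≠ e.2.2 ∧ ∃ f' ∈ P, f' ≠ e ∧ f'.2.2 ≠ c ∧ f'.2.2 ≠ f.2.2) ∨
      ((∀ v, Touch e v → ¬ Touch h₂ (flipAt i v)) ∧ ∃ h₄ ∈ P, h₄.2.2 = c ∧ h₄ ≠ h₂ ∧ h₄ ≠ h₃)) :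
    Extends S T P := by
  classical
  have hsc : ∀ t ∈ P, t.2.2 = c → t.1 i = s := fun t ht htc =>
    hs t ht fun h => hec (by rw [← h, htc])
  set R := P.filter fun t => t.2.2 = c with hR
  -- All edges of color `c` will be exchanged with `i`-edges. Before that they carry the spare color
  -- `c₀`, except `h₂`, which carries the color of `f`; the mixture keeps both sides unobstructed.
  let m : Bool → Entry ι C → Entry ι C := fun b t =>
    (setAt i b t.1, t.2.1, if t = h₂ then f.2.2 else c₀)
  let Q : Bool → Finset (Entry ι C) := fun b =>
    (P.filter fun t => t.2.2 ≠ c ∧ t.1 i = b) ∪ R.image (m b)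
  have hmQ : ∀ {b t}, t ∈ P → t.2.2 = c → m b t ∈ Q b := fun ht htc =>
    Finset.mem_union_right _ (Finset.mem_image_of_mem _ (Finset.mem_filter.2 ⟨ht, htc⟩))
  have hfQ : ∀ {b t}, t ∈ P → t.2.2 ≠ c → t.1 i = b → t ∈ Q b := fun ht htc htb =>
    Finset.mem_union_left _ (Finset.mem_filter.2 ⟨ht, htc, htb⟩)
  have hmt : ∀ {b t v}, t ∈ P → t.2.2 = c → Touch (m b t) v → Touch t (setAt i s v) :=
    fun ht htc h => touch_of_touch_setAt (hdir _ ht) (hsc _ ht htc) h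
  have hmm : ∀ {b t t' v}, t ∈ P → t.2.2 = c → t' ∈ P → t'.2.2 = c → Touch (m b t) v →
      Touch (m b t') v → t = t' := fun ht htc ht' htc' h h' =>
    hsP.eq_of_color hP ht ht' (hmt ht htc h) (hmt ht' htc' h') (htc.trans htc'.symm)
  have hfm : ∀ {b g t v}, g ∈ P → g ≠ e → g.2.2 ≠ c → t ∈ P → t.2.2 = c → Touch g v →
      ¬ Touch (m b t) v := fun {b g t v} hg hge hgc ht htc hgv h => by
    have h1 := hmt ht htc h
    rw [setAt_of_eq ((touch_side (hdir g hg) hgv).trans (hs g hg hge))] at h1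
    exact hdisj g hg hge hgc t ht htc v hgv h1
  have hem : ∀ {b t v}, t ∈ P → t.2.2 = c → Touch e v → Touch (m b t) v → Touch t (flipAt i v) :=
    fun {b t v} ht htc hev h => by
      have h1 := hmt ht htc h
      rwa [setAt_of_ne (fun h' => hes ((touch_side (hdir e he) hev).symm.trans h'))] at h1
  have hfar : f.2.2 ≠ e.2.2 ∨ ∀ v, Touch e v → ¬ Touch h₂ (flipAt i v) := hcase.imp And.left And.left
  have hgood : ∀ b, Good (S.erase i) (T.erase c) (Q b) := by
    intro b
    have hmix : ∀ {g t v}, g ∈ P → g.2.2 ≠ c → t ∈ P → t.2.2 = c → Touch g v → Touch (m b t) v →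
        g.2.1 ≠ t.2.1 ∧ g.2.2 ≠ (m b t).2.2 := by
      intro g t v hg hgc ht htc hgv htv
      obtain rfl : g = e := by
        by_contra hge; exact hfm hg hge hgc ht htc hgv htv
      have htv' := hem ht htc hgv htv
      refine ⟨fun hd => hmir ?_, ?_⟩
      · refine ⟨t, ht, hd.symm, htc, ?_⟩
        rcases hgv with rfl | rfl
        · exact htv'
        · rw [flipAt_comm, hd] at htv'; exact touch_flipAt_iff.1 htv'
      · simp only [m]
        split_ifs with h
        · subst h
          exact (hfar.resolve_right fun h => h v hgv htv').symm
        · exact hc₀ _ hg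
    refine ⟨fun t ht => ?_, fun t ht => ?_, ?_⟩
    · rcases Finset.mem_union.1 ht with ht | ht
      · exact Finset.mem_erase.2 ⟨hdir t (Finset.mem_filter.1 ht).1, hP.dir t (Finset.mem_filter.1 ht).1⟩
      · obtain ⟨u, hu, rfl⟩ := Finset.mem_image.1 ht
        exact Finset.mem_erase.2 ⟨hdir u (Finset.mem_filter.1 hu).1, hP.dir u (Finset.mem_filter.1 hu).1⟩
    · rcases Finset.mem_union.1 ht with ht | ht
      · rw [Finset.mem_filter] at ht
        exact Finset.mem_erase.2 ⟨ht.2.1, hP.col t ht.1⟩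
      · obtain ⟨u, hu, rfl⟩ := Finset.mem_image.1 ht
        simp only [m]
        split_ifs
        · exact Finset.mem_erase.2 ⟨hfc, hP.col f hf⟩
        · exact Finset.mem_erase.2 ⟨hc₀c, hc₀T⟩
    · rintro v _ _ _ _ ⟨t, ht, rfl, rfl, htv⟩ ⟨t', ht', rfl, rfl, htv'⟩
      rcases Finset.mem_union.1 ht with ht | ht <;> rcases Finset.mem_union.1 ht' with ht' | ht'
      · rw [Finset.mem_filter] at ht ht'
        exact hP.proper (has_of_touch ht.1 htv) (has_of_touch ht'.1 htv')
      · obtain ⟨u, hu, rfl⟩ := Finset.mem_image.1 ht'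
        rw [Finset.mem_filter] at ht hu
        obtain ⟨a, b⟩ := hmix ht.1 ht.2.1 hu.1 hu.2 htv htv'
        exact iff_of_false a b
      · obtain ⟨u, hu, rfl⟩ := Finset.mem_image.1 ht
        rw [Finset.mem_filter] at ht' hu
        obtain ⟨a, b⟩ := hmix ht'.1 ht'.2.1 hu.1 hu.2 htv' htv
        exact iff_of_false a.symm b.symm
      · obtain ⟨u, hu, rfl⟩ := Finset.mem_image.1 ht
        obtain ⟨u', hu', rfl⟩ := Finset.mem_image.1 ht'
        rw [Finset.mem_filter] at hu hu'
        rw [hmm hu.1 hu.2 hu'.1 hu'.2 htv htv']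
        simp
  have hSi : (S.erase i).card = n := by rw [Finset.card_erase_of_mem hi, hS]; rfl
  have hTc : (T.erase c).card = n := by rw [Finset.card_erase_of_mem hcT, hT]; rfl
  have hsum : R.card + (P.filter fun t => ¬ t.2.2 = c).card = n + 1 :=
    hPn ▸ Finset.card_filter_add_card_filter_not _
  have hQcard : ∀ b, (Q b).card ≤ (P.filter fun t => t.2.2 ≠ c ∧ t.1 i = b).card + R.card :=
    fun b => (Finset.card_union_le _ _).trans (Nat.add_le_add_left Finset.card_image_le _)
  have hfar3 : ∀ b, ∀ t ∈ P, t.2.2 = c → t ≠ h₂ → (m b t).2.2 = c₀ := fun b t _ _ h => if_neg h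
  have hm2 : ∀ b, (m b h₂).2.2 = f.2.2 := fun b => if_pos rfl
  refine extends_of_sides (R := R) hi hcT s (Q := Q) (fun b => ?_) ?_ ?_ ?_
    (fun t ht hti => (hdir t ht hti).elim) hP.dir
  -- On the side of `f`, the common color of `f` and `h₂` excludes a saturated edge. A blocked
  -- vertex would lie on both members of a disjoint pair: `f` and `h₂`, or `h₃` together with `f'`
  -- or `h₄`.
  · by_cases hbs : b = s
    · subst hbs
      have hfb := hs f hf hfe
      have hcard : (Q b).card ≤ n := by
        have h1 := hQcard b
        have h2 : (P.filter fun t => t.2.2 ≠ c ∧ t.1 i = b).card + 1 ≤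
            (P.filter fun t => ¬ t.2.2 = c).card :=
          card_add_one_le (fun t ht => by
            rw [Finset.mem_filter] at ht ⊢; exact ⟨ht.1, ht.2.1⟩)
            (Finset.mem_filter.2 ⟨he, hec⟩) (by simp [hes])
        omega
      refine hB.erase hS hT hi hcT (hgood b) hcard (fun h => ?_) fun h => ?_
      · have := h.color_injective (by omega) f (hfQ hf hfc hfb) _ (hmQ h2 h2c) (hm2 b).symm
        exact hfm (b := b) hf hfe hfc h2 h2c (touch_fst f) (by rw [← this]; exact touch_fst f)
      · obtain ⟨w, x, -, -, hw, -⟩ := h.exists_touch (by omega)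
        by_cases hx : f.2.2 = x
        · have hc₀x : c₀ ≠ x := fun h => hc₀ f hf (hx.trans h.symm)
          have h3w := hw _ (hmQ h3 h3c) (by rwa [hfar3 b h₃ h3 h3c h32])
          rcases hcase with ⟨hfe', f', hf', hfe'', hfc', hff⟩ | ⟨-, h₄, h4, h4c, h42, h43⟩
          · exact hfm hf' hfe'' hfc' h3 h3c (hw f' (hfQ hf' hfc' (hs f' hf' hfe'')) (hx ▸ hff)) h3w
          · exact h43 (hmm h4 h4c h3 h3c (hw _ (hmQ h4 h4c) (by rwa [hfar3 b h₄ h4 h4c h42])) h3w)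
        · exact hfm hf hfe hfc h2 h2c (hw f (hfQ hf hfc hfb) hx) (hw _ (hmQ h2 h2c) (by rwa [hm2]))
    · have hFe : (P.filter fun t => t.2.2 ≠ c ∧ t.1 i = b) ⊆ {e} := fun t ht => by
        rw [Finset.mem_filter] at ht
        rw [Finset.mem_singleton]
        by_contra hte
        exact hbs (ht.2.2.symm.trans (hs t ht.1 hte))
      have hF1 := Finset.card_le_card hFe
      rw [Finset.card_singleton] at hF1
      have hQb := hQcard b
      have hE : ∀ {x y : Entry ι C}, x ∈ P → x.2.2 ≠ c → y ∈ P → y.2.2 ≠ c → x ≠ y →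
          ({x, y} : Finset (Entry ι C)) ⊆ P.filter fun t => ¬ t.2.2 = c := by
        intro x y hx hxc hy hyc _
        exact Finset.insert_subset (Finset.mem_filter.2 ⟨hx, hxc⟩)
          (Finset.singleton_subset_iff.2 (Finset.mem_filter.2 ⟨hy, hyc⟩))
      have hE1 := hE he hec hf hfc hfe.symm
      -- On the side of `e`, the entries `f` and `f'` are absent in the first case, which leaves
      -- fewer than `n`. In the second, `h₃` and `h₄` repeat `c₀`, and `h₂` does not meet `e`.
      rcases hcase with ⟨hfe', f', hf', hfe'', hfc', hff⟩ | ⟨hfar, h₄, h4, h4c, h42, h43⟩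
      · refine extends_erase_of_card_lt hS hT hi hcT (hgood b) ?_
        have := card_add_one_le hE1 (Finset.mem_filter.2 ⟨hf', hfc'⟩) (by
          simp only [Finset.mem_insert, Finset.mem_singleton, hfe'', false_or]
          exact fun h => hff (by rw [h]))
        rw [Finset.card_pair hfe.symm] at this
        omega
      · have := Finset.card_le_card hE1
        rw [Finset.card_pair hfe.symm] at this
        have heb : e.1 i = b := by
          rw [Bool.eq_not.2 hes, Bool.eq_not.2 hbs]
        refine hB.erase hS hT hi hcT (hgood b) (by omega) (fun h => h43 ?_) fun h => ?_
        · have := h.color_injective (by omega) _ (hmQ h4 h4c) _ (hmQ h3 h3c)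
            ((hfar3 b h₄ h4 h4c h42).trans (hfar3 b h₃ h3 h3c h32).symm)
          exact hmm h4 h4c h3 h3c (touch_fst (m b h₄)) (this ▸ touch_fst _)
        · obtain ⟨w, x, -, -, hw, -⟩ := h.exists_touch (by omega)
          by_cases hx : c₀ = x
          · have hew := hw e (hfQ he hec heb) (hx ▸ hc₀ e he)
            exact hfar w hew (hem h2 h2c hew (hw _ (hmQ h2 h2c) (by
              rw [hm2, ← hx]; exact hc₀ f hf)))
          · exact h43 (hmm h4 h4c h3 h3c (hw _ (hmQ h4 h4c) (by rwa [hfar3 b h₄ h4 h4c h42]))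
              (hw _ (hmQ h3 h3c) (by rwa [hfar3 b h₃ h3 h3c h32])))
  · exact (hP.mono (Finset.filter_subset _ _)).weaken (fun t ht => Finset.mem_erase.2
      ⟨hdir t (Finset.mem_filter.1 ht).1, hP.dir t (Finset.mem_filter.1 ht).1⟩) fun t ht =>
      Finset.mem_singleton.2 (Finset.mem_filter.1 ht).2
  · intro t ht
    rw [hR, Finset.mem_filter] at ht
    exact ⟨(m true t).2.2, fun b => has_of_mem (hmQ (b := b) ht.1 ht.2)⟩
  · intro t ht hti
    by_cases htc : t.2.2 = c
    · left
      rw [setAt_of_eq (hsc t ht htc)]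
      exact ⟨⟨t, Finset.mem_filter.2 ⟨ht, htc⟩, rfl, htc, touch_fst t⟩, htc⟩
    · refine Or.inr ⟨fun h => ?_, has_of_mem (hfQ ht htc rfl)⟩
      have h' := h.mono (Finset.filter_subset _ _)
      by_cases hte : t = e
      · subst hte
        rw [setAt_of_ne hes] at h'
        exact hmir h'
      · rw [setAt_of_eq (hs t ht hte)] at h'
        exact htc ((hP.proper (has_of_mem ht) h').1 rfl)

end Recolor

/-! ### Repeated colors: conclusion, and the induction -/

section Step

variable {ι C : Type*} [DecidableEq ι] {S : Finset ι} {T : Finset C} {P Q : Finset (Entry ι C)}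
  {n : ℕ}

variable [Fintype ι] [DecidableEq C]

/-- All edges but `e` block `(u, c)`, and `e` is the mirror image of an edge of colour `c`. -/
theorem extends_of_blocked_of_mirror (hn : 4 ≤ n) (hB : ExtendsAt ι C n) (hS : S.card = n + 1)
    (hT : T.card = n + 1) (hP : Good S T P) (hsP : Simple P) (hPn : P.card = n + 1)
    (hblk : ¬ Blk S T P) {i : ι} (hi : i ∈ S) (hdir : ∀ t ∈ P, t.2.1 ≠ i) {e : Entry ι C}
    (he : e ∈ P) {s : Bool} (hs : ∀ t ∈ P, t ≠ e → t.1 i = s) {c₀ : C}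
    (hc₀T : c₀ ∈ T) (hc₀ : ∀ t ∈ P, t.2.2 ≠ c₀) {u : ι → Bool} {c : C}
    (hu : ∀ t ∈ P, t ≠ e → t.2.2 = c → ¬ Touch t u)
    (hhit : ∀ t ∈ P, t ≠ e → ∃ j ∈ S.erase i, Hits u c t j)
    (huniq : ∀ t ∈ P, t ≠ e → ∀ t' ∈ P, t' ≠ e → ∀ j ∈ S.erase i, Hits u c t j → Hits u c t' j →
      t = t') (hec : e.2.2 ≠ c) {g h : Entry ι C} (hg : g ∈ P) (hge : g ≠ e)
    (hgc : g.2.2 ≠ c) (hh : h ∈ P) (hhc : h.2.2 = c) (hhd : h.2.1 = e.2.1)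
    (hhm : Touch h (flipAt i e.1)) : Extends S T P := by
  have hne : ∀ {t : Entry ι C}, t.2.2 = c → t ≠ e := fun htc h => hec (by rw [← h, htc])
  have hK : ∀ t ∈ P, t ≠ e → t.2.2 ≠ c → Touch t u := fun t ht hte htc => by
    obtain ⟨j, -, h | h⟩ := hhit t ht hte
    exacts [h.1, (htc h.1).elim]
  have hJ : ∀ t ∈ P, t.2.2 = c → ∃ j ∈ S.erase i, Touch t (flipAt j u) := fun t ht htc => by
    obtain ⟨j, hj, h | h⟩ := hhit t ht (hne htc)
    exacts [(hu t ht (hne htc) htc h.1).elim, ⟨j, hj, h.2⟩]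
  obtain ⟨a, ha, hha⟩ := hJ h hh hhc
  obtain ⟨hai, haS⟩ := Finset.mem_erase.1 ha
  have hhda : h.2.1 ≠ a := fun h' => hu h hh (hne hhc) hhc (touch_flipAt_iff.1 (h' ▸ hha))
  have hKd : ∀ t ∈ P, t ≠ e → t.2.2 ≠ c → ∀ k ∈ P, k.2.2 = c → ∀ j ∈ S.erase i,
      Touch k (flipAt j u) → t.2.1 ≠ j := fun t ht hte htc k hk hkc j hj hkj htj =>
    htc (huniq t ht hte k hk (hne hkc) j hj (Or.inl ⟨hK t ht hte htc, htj⟩) (Or.inr ⟨hkc, hkj⟩) ▸ hkc)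
  have hJu : ∀ t ∈ P, t.2.2 = c → ∀ k ∈ P, k.2.2 = c → t ≠ k → ∀ j ∈ S.erase i,
      Touch t (flipAt j u) → ¬ Touch k (flipAt j u) := fun t ht htc k hk hkc htk j hj h1 h2 =>
    htk (huniq t ht (hne htc) k hk (hne hkc) j hj (Or.inr ⟨htc, h1⟩) (Or.inr ⟨hkc, h2⟩))
  have hem : Touch e (flipAt i (flipAt a u)) := touch_mirror' hhd hhm hha
  have heu : ∀ j, j ≠ i → e.2.1 ≠ j → e.1 j = flipAt a u j := fun j hji hej => by
    rw [← touch_side hej hem, flipAt_apply_of_ne hji]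
  have hua : ¬ flipAt a u a = u a := by simp
  -- Both `e` and `h` lie on the side of `a` away from `u`. If two entries lie on the side of `u`,
  -- the cube is divided along `a` instead, and entries in direction `a` cross in the unused
  -- direction `i`. Each side then loses two entries.
  by_cases hA : ∃ x ∈ P, ∃ y ∈ P, x ≠ y ∧ (x.2.1 ≠ a ∧ x.1 a = u a) ∧ (y.2.1 ≠ a ∧ y.1 a = u a)
  · obtain ⟨x, hx, y, hy, hxy, ⟨hxa, hxu⟩, hya, hyu⟩ := hA
    have hda : ∀ t ∈ P, t.2.1 = a → t.2.2 = c := fun t ht hta => by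
      by_contra htc
      by_cases hte : t = e
      · exact hhda (by rw [hhd, ← hte, hta])
      · exact hKd t ht hte htc h hh hhc a ha hha hta
    have hfree : ∀ t ∈ P, t.2.1 = a → ∀ v, Touch t v →
        (∀ y, ¬ Has P v i y) ∧ ∀ j, ¬ Has P (flipAt i v) j c := by
      intro t ht hta v hv
      refine ⟨fun y ⟨k, hk, hki, _⟩ => hdir k hk hki, fun j ⟨k, hk, _, hkc, hkv⟩ => ?_⟩
      have h1 := touch_side (hdir k hk) hkv
      have h2 := touch_side (hdir t ht) hv
      rw [hs k hk (hne hkc), flipAt_apply_self, h2, hs t ht (hne (hda t ht hta))] at h1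
      simp at h1
    have hcc₀ : c ≠ c₀ := fun h' => hc₀ h hh (hhc.trans h')
    refine extends_of_cross hP hai.symm hda hfree haS hi hc₀T fun b =>
      extends_erase_of_card_lt hS hT haS hc₀T
      (good_crossSide hP hai.symm hda hfree hi (hhc ▸ hP.col h hh) hcc₀ hc₀ b) ?_
    refine (Finset.card_union_le _ _).trans_lt ?_
    refine (Nat.add_le_add_left Finset.card_image_le _).trans_lt ?_
    rw [← Finset.card_union_of_disjoint (Finset.disjoint_filter.2 fun t _ h1 h2 => h1.1 h2)]
    have hsub : (P.filter fun t => t.2.1 ≠ a ∧ t.1 a = b) ∪ (P.filter fun t => t.2.1 = a) ⊆ P :=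
      Finset.union_subset (Finset.filter_subset _ _) (Finset.filter_subset _ _)
    have hout : ∀ t, t.2.1 ≠ a → t.1 a ≠ b →
        t ∉ (P.filter fun t => t.2.1 ≠ a ∧ t.1 a = b) ∪ (P.filter fun t => t.2.1 = a) := by
      intro t h1 h2 h3
      simp [h1, h2] at h3
    by_cases hb : b = u a
    · have := card_add_two_le hsub hh
        (hout h hhda (by rw [hb, ← touch_side hhda hha]; exact hua)) he
        (hout e (hhd ▸ hhda) (by rw [hb, heu a hai (hhd ▸ hhda)]; exact hua)) (hne hhc)
      omega
    · have := card_add_two_le hsub hx (hout x hxa (hxu ▸ Ne.symm hb)) hy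
        (hout y hya (hyu ▸ Ne.symm hb)) hxy
      omega
  -- Among entries not in direction `a`, only `g` is on the side of `u`. Hence all entries except
  -- `e` and `g` have color `c`, and those other than `h` have direction `a`.
  · push Not at hA
    have hgu := hK g hg hge hgc
    have hga : g.2.1 ≠ a := hKd g hg hge hgc h hh hhc a ha hha
    have hone : ∀ t ∈ P, t ≠ g → t.2.1 ≠ a → t.1 a ≠ u a := fun t ht htg hta htu =>
      hA t ht g hg htg ⟨hta, htu⟩ hga (touch_side hga hgu).symm
    have hall : ∀ t ∈ P, t ≠ e → t ≠ g → t.2.2 = c := fun t ht hte htg => by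
      by_contra htc
      have hta : t.2.1 ≠ a := hKd t ht hte htc h hh hhc a ha hha
      exact hone t ht htg hta (touch_side hta (hK t ht hte htc)).symm
    have hcross : ∀ t ∈ P, t.2.2 = c → t ≠ h → t.2.1 = a := fun t ht htc hth => by
      by_contra hta
      obtain ⟨j, hj, htj⟩ := hJ t ht htc
      have hja : j ≠ a := fun h' => hJu t ht htc h hh hhc hth j hj htj (h' ▸ hha)
      refine hone t ht (fun h' => hgc (h' ▸ htc)) hta ?_
      rw [← touch_side hta htj, flipAt_apply_of_ne hja.symm]
    -- `t` is at the neighbour of `u` in a direction `j` used by no entry, and all others share the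
    -- coordinate `j` of `u`. So `t` is alone on its side of `j`, while `h` and `t'` repeat its
    -- color.
    have main : ∀ t ∈ P, ∀ t' ∈ P, t.2.2 = c → t'.2.2 = c → t ≠ h → t' ≠ h → t ≠ t' →
        ¬ Touch t (flipAt h.2.1 u) → Extends S T P := by
      intro t ht t' ht' htc htc' hth hth' htt hthd
      obtain ⟨j, hj, htj⟩ := hJ t ht htc
      obtain ⟨hji, hjS⟩ := Finset.mem_erase.1 hj
      have hja : j ≠ a := fun h' => hJu t ht htc h hh hhc hth j hj htj (h' ▸ hha)
      have hjh : h.2.1 ≠ j := fun h' => hthd (h' ▸ htj)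
      have hgj := hKd g hg hge hgc t ht htc j hj htj
      have hjd : ∀ k ∈ P, k.2.1 ≠ j := by
        intro k hk
        by_cases hke : k = e
        · rw [hke, ← hhd]; exact hjh
        by_cases hkg : k = g
        · rwa [hkg]
        by_cases hkh : k = h
        · rwa [hkh]
        rw [hcross k hk (hall k hk hke hkg) hkh]; exact hja.symm
      refine extends_of_lone_color hn hB hS hT hP hsP hPn hblk hjS hjd ht (s := u j) ?_ ?_ hc₀T hc₀
        hh ht' hth.symm htt.symm hth'.symm (hhc.trans htc.symm) (htc'.trans htc.symm)
      · rw [← touch_side (hjd t ht) htj]; simp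
      · intro k hk hkt
        by_cases hke : k = e
        · rw [hke, heu j hji (hhd ▸ hjh), flipAt_apply_of_ne hja]
        by_cases hkg : k = g
        · rw [hkg, ← touch_side hgj hgu]
        have hkc := hall k hk hke hkg
        obtain ⟨l, hl, hkl⟩ := hJ k hk hkc
        have hjl : j ≠ l := fun h' => hJu k hk hkc t ht htc hkt l hl hkl (h' ▸ htj)
        rw [← touch_side (hjd k hk) hkl, flipAt_apply_of_ne hjl]
    have hgh : g ≠ h := fun h' => hgc (h' ▸ hhc)
    obtain ⟨t₁, ht₁, t₂, ht₂, h12⟩ := Finset.one_lt_card.1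
      (show 1 < (((P.erase e).erase g).erase h).card by
        rw [Finset.card_erase_of_mem (by simp [hgh.symm, hne hhc, hh]),
          Finset.card_erase_of_mem (by simp [hge, hg]), Finset.card_erase_of_mem he]
        omega)
    simp only [Finset.mem_erase] at ht₁ ht₂
    have c1 := hall t₁ ht₁.2.2.2 ht₁.2.2.1 ht₁.2.1
    have c2 := hall t₂ ht₂.2.2.2 ht₂.2.2.1 ht₂.2.1
    by_cases h1 : Touch t₁ (flipAt h.2.1 u)
    · exact main t₂ ht₂.2.2.2 t₁ ht₁.2.2.2 c2 c1 ht₂.1 ht₁.1 h12.symm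
        (hJu t₁ ht₁.2.2.2 c1 t₂ ht₂.2.2.2 c2 h12 _
          (Finset.mem_erase.2 ⟨hdir h hh, hP.dir h hh⟩) h1)
    · exact main t₁ ht₁.2.2.2 t₂ ht₂.2.2.2 c1 c2 ht₁.1 ht₂.1 h12 h1

/-- The edge `e` is alone on its side of `i`, and the colour `c₀` does not occur. -/
theorem extends_of_lone (hn : 4 ≤ n) (hB : ExtendsAt ι C n) (hS : S.card = n + 1)
    (hT : T.card = n + 1) (hP : Good S T P) (hsP : Simple P) (hPn : P.card = n + 1)
    (hblk : ¬ Blk S T P) {i : ι} (hi : i ∈ S) (hdir : ∀ t ∈ P, t.2.1 ≠ i) {e : Entry ι C}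
    (he : e ∈ P) {s : Bool} (hes : e.1 i ≠ s) (hs : ∀ t ∈ P, t ≠ e → t.1 i = s) {c₀ : C}
    (hc₀T : c₀ ∈ T) (hc₀ : ∀ t ∈ P, t.2.2 ≠ c₀) : Extends S T P := by
  by_contra hext
  refine hext (extends_of_erase_lone hn hS hT hP hi hdir hes hs hc₀T hc₀ fun hQ => ?_)
  have hSi : (S.erase i).card = n := by rw [Finset.card_erase_of_mem hi, hS]; rfl
  have hTc : (T.erase c₀).card = n := by rw [Finset.card_erase_of_mem hc₀T, hT]; rfl
  have hPe : (P.erase e).card = n := by rw [Finset.card_erase_of_mem he, hPn]; rfl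
  have hmem : ∀ {t}, t ∈ P → t ≠ e → t ∈ P.erase e := fun ht hte => Finset.mem_erase.2 ⟨hte, ht⟩
  have hsat : ¬ Sat (S.erase i) (T.erase c₀) (P.erase e) := by
    intro hsat
    obtain ⟨z, j, hj, h0, h1⟩ := id hsat
    have hz := (sat_struct (by omega) h0 h1).1
    refine hext (extends_of_adjacent hn hB hS hT hP hsP hPn hblk hi hdir he hes hs
      (fun t ht t' ht' hte hte' h => hsat.color_injective (by omega) t (hmem ht hte) t'
        (hmem ht' hte') h) (p := z) (a := j) fun t ht hte => (hz t (hmem ht hte)).1)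
  refine hB.erase hS hT hi hc₀T hQ (by omega) hsat fun hb => hext ?_
  obtain ⟨u, c, hc, h0, h1⟩ := id hb
  obtain ⟨hcc₀, hcT⟩ := Finset.mem_erase.1 hc
  obtain ⟨a1, a2, -⟩ := blk_struct (by omega) h0 h1
  have hu : ∀ t ∈ P, t ≠ e → t.2.2 = c → ¬ Touch t u := fun t ht hte htc h =>
    h0 _ ⟨t, hmem ht hte, rfl, htc, h⟩
  have hK : ∀ t ∈ P, t ≠ e → t.2.2 ≠ c → Touch t u := fun t ht hte htc => by
    obtain ⟨j, -, h | h⟩ := a1 t (hmem ht hte)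
    exacts [h.1, (htc h.1).elim]
  -- If `c` did not occur twice besides `e`, the entries other than `e` would be rainbow, those of
  -- other colors being at `u`, and `sat_of_blk` would give a saturated edge.
  obtain ⟨x, hx, y, hy, hxe, hye, hxy, hxc, hyc⟩ : ∃ x ∈ P, ∃ y ∈ P, x ≠ e ∧ y ≠ e ∧ x ≠ y ∧
      x.2.2 = c ∧ y.2.2 = c := by
    by_contra hcon
    push Not at hcon
    refine hsat (sat_of_blk (by omega) hQ (by omega) (fun t ht t' ht' h => ?_) hb)
    obtain ⟨hte, ht⟩ := Finset.mem_erase.1 ht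
    obtain ⟨hte', ht'⟩ := Finset.mem_erase.1 ht'
    by_contra htt
    by_cases htc : t.2.2 = c
    · exact hcon t ht t' ht' hte hte' htt htc (h ▸ htc)
    · exact htt (hsP.eq_of_color hP ht ht' (hK t ht hte htc) (hK t' ht' hte' (h ▸ htc)) h)
  by_cases hec : e.2.2 = c
  · exact extends_of_lone_color hn hB hS hT hP hsP hPn hblk hi hdir he hes hs hc₀T hc₀ hx hy hxe hye
      hxy (hxc.trans hec.symm) (hyc.trans hec.symm)
  have hne : ∀ {t : Entry ι C}, t.2.2 = c → t ≠ e := fun htc h => hec (by rw [← h, htc])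
  by_cases hKe : ∀ t ∈ P, t ≠ e → t.2.2 = c
  · refine extends_of_star (u := e.1) (c := c) (by omega) hS hT hP hPn.le hblk fun t ht => ?_
    by_cases hte : t = e
    · exact Or.inl (hte ▸ touch_fst t)
    · exact Or.inr (hKe t ht hte)
  push Not at hKe
  obtain ⟨g, hg, hge, hgc⟩ := hKe
  by_cases hmir : Has P (flipAt i e.1) e.2.1 c
  · obtain ⟨h, hh, hhd, hhc, hhm⟩ := hmir
    exact extends_of_blocked_of_mirror hn hB hS hT hP hsP hPn hblk hi hdir he hs hc₀T hc₀ hu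
      (fun t ht hte => a1 t (hmem ht hte)) (fun t ht hte t' ht' hte' =>
        a2 t (hmem ht hte) t' (hmem ht' hte')) hec hg hge hgc hh hhc hhd hhm
  -- An entry of color `c` at the far end of an entry `f` at `u` would hit the same direction as
  -- `f`, against the rigidity of a blocked vertex.
  have hdisj : ∀ f ∈ P, f ≠ e → f.2.2 ≠ c → ∀ t ∈ P, t.2.2 = c → ∀ v, Touch f v → ¬ Touch t v := by
    intro f hf hfe hfc t ht htc v hfv htv
    have hfu := hK f hf hfe hfc
    rcases hfu.eq_or hfv with rfl | rfl
    · exact hu t ht (hne htc) htc htv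
    · exact hfc (a2 f (hmem hf hfe) t (hmem ht (hne htc)) _
        (Finset.mem_erase.2 ⟨hdir f hf, hP.dir f hf⟩) (Or.inl ⟨hfu, rfl⟩) (Or.inr ⟨htc, htv⟩) ▸ htc)
  have main := fun {f h₂ h₃ : Entry ι C} => extends_of_recolor (f := f) (h₂ := h₂) (h₃ := h₃)
    hB hS hT hP hsP hPn hi hdir he hes hs hc₀T hc₀ hcT hcc₀.symm hec hmir hdisj
  -- Two entries of other colors at `u` have different colors, so one differs from `e`. If `g` is
  -- the only one, then `c` occurs at least three times.
  by_cases hK2 : ∃ f ∈ P, f ≠ e ∧ f.2.2 ≠ c ∧ f ≠ g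
  · obtain ⟨f, hf, hfe, hfc, hfg⟩ := hK2
    have hcol : f.2.2 ≠ g.2.2 := fun h => hfg
      (hsP.eq_of_color hP hf hg (hK f hf hfe hfc) (hK g hg hge hgc) h)
    by_cases hce : f.2.2 = e.2.2
    · exact main hg hge hgc hx hxc hy hyc hxy.symm
        (Or.inl ⟨fun h => hcol (hce.trans h.symm), f, hf, hfe, hfc, hcol⟩)
    · exact main hf hfe hfc hx hxc hy hyc hxy.symm (Or.inl ⟨hce, g, hg, hge, hgc, hcol.symm⟩)
  · push Not at hK2
    have hall : ∀ t ∈ (P.erase e).erase g, t ∈ P ∧ t.2.2 = c := fun t ht => by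
      simp only [Finset.mem_erase] at ht
      refine ⟨ht.2.2, ?_⟩
      by_contra htc
      exact ht.1 (hK2 t ht.2.2 ht.2.1 htc)
    obtain ⟨t₁, m1, t₂, m2, t₃, m3, h12, h13, h23⟩ := Finset.two_lt_card.1
      (show 2 < ((P.erase e).erase g).card by
        rw [Finset.card_erase_of_mem (Finset.mem_erase.2 ⟨hge, hg⟩), hPe]; omega)
    obtain ⟨p1, c1⟩ := hall _ m1
    obtain ⟨p2, c2⟩ := hall _ m2
    obtain ⟨p3, c3⟩ := hall _ m3
    -- The mirror image of `e` has only two ends, so among three entries of one color some entry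
    -- misses it.
    by_cases f1 : ∀ v, Touch e v → ¬ Touch t₁ (flipAt i v)
    · exact main hg hge hgc p1 c1 p2 c2 h12.symm (Or.inr ⟨f1, t₃, p3, c3, h13.symm, h23.symm⟩)
    by_cases f2 : ∀ v, Touch e v → ¬ Touch t₂ (flipAt i v)
    · exact main hg hge hgc p2 c2 p1 c1 h12 (Or.inr ⟨f2, t₃, p3, c3, h23.symm, h13.symm⟩)
    by_cases f3 : ∀ v, Touch e v → ¬ Touch t₃ (flipAt i v)
    · exact main hg hge hgc p3 c3 p1 c1 h13 (Or.inr ⟨f3, t₂, p2, c2, h23, h12.symm⟩)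
    push Not at f1 f2 f3
    obtain ⟨v₁, hv₁, w1⟩ := f1
    obtain ⟨v₂, hv₂, w2⟩ := f2
    obtain ⟨v₃, hv₃, w3⟩ := f3
    have heq : ∀ {t t' v}, t ∈ P → t' ∈ P → t.2.2 = c → t'.2.2 = c → Touch t v → Touch t' v → t = t' :=
      fun ht ht' htc htc' h h' => hsP.eq_of_color hP ht ht' h h' (htc.trans htc'.symm)
    exfalso
    rcases hv₁ with rfl | rfl <;> rcases hv₂ with rfl | rfl <;> rcases hv₃ with rfl | rfl
    all_goals first
      | exact h12 (heq p1 p2 c1 c2 w1 w2)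
      | exact h13 (heq p1 p3 c1 c3 w1 w3)
      | exact h23 (heq p2 p3 c2 c3 w2 w3)

/-- A repetition leaves a color `c₀` unused. Given to an unused direction, it makes both sides small
unless all entries, or all but one, lie on one side. -/
theorem extends_of_repeated_color (hn : 4 ≤ n) (hB : ExtendsAt ι C n) (hS : S.card = n + 1)
    (hT : T.card = n + 1) (hP : Good S T P) (hsP : Simple P) (hPn : P.card = n + 1)
    (hblk : ¬ Blk S T P) {t₁ t₂ : Entry ι C} (h1 : t₁ ∈ P) (h2 : t₂ ∈ P) (hne : t₁ ≠ t₂)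
    (h12 : t₁.2.2 = t₂.2.2) : Extends S T P := by
  obtain ⟨c₀, hc₀T, hc₀⟩ : ∃ c₀ ∈ T, ∀ t ∈ P, t.2.2 ≠ c₀ := by
    obtain ⟨c₀, hc₀T, h⟩ := exists_notMem_image (P := P.erase t₂) (S := T) (fun t => t.2.2)
      (by rw [Finset.card_erase_of_mem h2]; omega)
    refine ⟨c₀, hc₀T, fun t ht => ?_⟩
    by_cases htt : t = t₂
    · rw [htt, ← h12]; exact h t₁ (Finset.mem_erase.2 ⟨hne, h1⟩)
    · exact h t (Finset.mem_erase.2 ⟨htt, ht⟩)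
  by_cases hW : ∀ j ∈ S, ∃ t ∈ P, t.2.1 = j
  · have hd := (rel_bijective (r := fun (t : Entry ι C) j => t.2.1 = j) hW
      (fun t _ j _ k _ h1 h2 => h1.symm.trans h2) (by omega)).2.1
    exact extends_of_all_directions hn hB hS hT hP hsP hPn hblk
      (fun t ht u hu h => hd t ht u hu _ (hP.dir u hu) h rfl) hc₀T hc₀
  push Not at hW
  obtain ⟨i, hi, hdir⟩ := hW
  by_cases hlarge : ∀ b, 1 < (P.filter fun t => t.1 i ≠ b).card
  · refine extends_of_split hP hi hc₀T (fun t ht hti => (hdir t ht hti).elim) fun b =>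
      extends_erase_of_card_lt hS hT hi hc₀T (hP.filter_side fun t ht h => ⟨h.1, hc₀ t ht⟩) ?_
    obtain ⟨x, hx, y, hy, hxy⟩ := Finset.one_lt_card.1 (hlarge b)
    rw [Finset.mem_filter] at hx hy
    have := card_add_two_le (Finset.filter_subset (fun t => t.2.1 ≠ i ∧ t.1 i = b) P) hx.1
      (by simp [hx.2]) hy.1 (by simp [hy.2]) hxy
    omega
  push Not at hlarge
  obtain ⟨s, hs⟩ := hlarge
  by_cases hone : ∀ t ∈ P, t.1 i = s
  · refine extends_of_oneSided hP hi (hP.col _ h2) s (fun t ht h => (hdir t ht h).elim)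
      (fun t ht _ => hone t ht) (extends_erase_of_card_lt hS hT hi (hP.col _ h2)
        (hP.filter_side fun t _ h => h) ?_)
    have := card_add_two_le (Finset.filter_subset (fun t => t.2.1 ≠ i ∧ t.2.2 ≠ t₂.2.2) P) h1
      (by simp [h12]) h2 (by simp) hne
    omega
  push Not at hone
  obtain ⟨e, he, hes⟩ := hone
  refine extends_of_lone hn hB hS hT hP hsP hPn hblk hi hdir he hes (fun t ht hte => ?_) hc₀T hc₀
  by_contra hts
  exact hte (Finset.card_le_one.1 hs t (Finset.mem_filter.2 ⟨ht, hts⟩) e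
    (Finset.mem_filter.2 ⟨he, hes⟩))

theorem extendsAt_succ (hn : 4 ≤ n) (hB : ExtendsAt ι C n) : ExtendsAt ι C (n + 1) := by
  intro S T P hS hT hP hPn hsat hblk
  rcases Nat.lt_or_ge P.card (n + 1) with hlt | hge
  · exact extends_of_card_lt hS hT hP hlt
  by_cases hsP : Simple P
  swap
  · exact extends_of_not_simple hS hT hP hPn hsP
  have hPn : P.card = n + 1 := by omega
  by_cases hinj : ∀ t ∈ P, ∀ u ∈ P, t.2.2 = u.2.2 → t = u
  · exact extends_of_rainbow hn hB hS hT hP hsP hPn hinj hsat hblk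
  · push Not at hinj
    obtain ⟨t, ht, u, hu, h, hne⟩ := hinj
    exact extends_of_repeated_color hn hB hS hT hP hsP hPn hblk ht hu hne h

theorem extendsAt (hn : 4 ≤ n) : ExtendsAt ι C n := by
  induction n, hn using Nat.le_induction with
  | base =>
    intro S T P hS hT hP hPn hsat hblk
    rcases extends_or_obstructed_of_le_four (d := 4) (by omega) le_rfl hS hT hP hPn with
      h | h | h | h
    · exact h
    · exact (hsat h).elim
    · exact (hblk h).elim
    -- The parallel triple exists only in dimension `3`, so the induction hypothesis holds without
    -- this exception from dimension `4` on.
    · exact absurd h.1 (by omega)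
  | succ n hn ih => exact extendsAt_succ hn ih

end Step

/-! ### Obstructions -/

section Necessity

variable {ι C : Type*} [DecidableEq ι] {S : Finset ι} {T : Finset C} {P : Finset (Entry ι C)}

/-- Whatever color the uncolored edge received, that color is already on a precolored edge at one of
its ends. -/
theorem Sat.not_extends (hP : Good S T P) (h : Sat S T P) : ¬ Extends S T P := by
  rintro ⟨f, hf, hfP⟩
  obtain ⟨v, j, hj, h0, h1⟩ := h
  obtain ⟨k, hk | hk⟩ := h1 _ (hf.mem v j hj)
  · obtain rfl := hf.inj v k (hP.dir_mem hk) j hj (hf.eq_of_has hP hfP hk)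
    exact h0 _ hk
  · obtain rfl := hf.inj (flipAt j v) k (hP.dir_mem hk) j hj
      ((hf.eq_of_has hP hfP hk).trans (hf.symm v j hj).symm)
    exact h0 _ (has_flip.1 hk)

/-- With at least as many directions as colors, all colors occur at `u`. The edge of color `c` at
`u` would be precolored differently or meet an edge of color `c` at its other end. -/
theorem Blk.not_extends (hP : Good S T P) (hST : T.card ≤ S.card) (h : Blk S T P) :
    ¬ Extends S T P := by
  classical
  rintro ⟨f, hf, hfP⟩
  obtain ⟨u, c, hc, h0, h1⟩ := h
  have himg : S.image (f u) = T := by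
    refine Finset.eq_of_subset_of_card_le (fun x hx => ?_) ?_
    · obtain ⟨j, hj, rfl⟩ := Finset.mem_image.1 hx; exact hf.mem u j hj
    · rwa [Finset.card_image_of_injOn fun j hj k hk => hf.inj u j hj k hk]
  rw [← himg] at hc
  obtain ⟨j, hj, hjc⟩ := Finset.mem_image.1 hc
  rcases h1 j hj with ⟨x, hx⟩ | ⟨k, hk⟩
  · exact h0 j (((hf.eq_of_has hP hfP hx).symm.trans hjc) ▸ hx)
  · obtain rfl := hf.inj (flipAt j u) k (hP.dir_mem hk) j hj
      ((hf.eq_of_has hP hfP hk).trans ((hf.symm u j hj).trans hjc).symm)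
    exact h0 _ (has_flip.1 hk)

theorem fin_three_eq_of_ne {x y z p : Fin 3} (h1 : x ≠ y) (h2 : x ≠ z) (h3 : y ≠ z) (h4 : p ≠ x)
    (h5 : p ≠ y) : p = z := by
  omega

/-- With three colors, an edge between two differently colored `i`-edges must take the third color.
This determines the square at `w`, and its two edges at the vertex opposite to `w` receive the same
color. -/
theorem IsCol.false_of_corner {f : (Fin 3 → Bool) → Fin 3 → Fin 3}
    (hf : IsCol Finset.univ Finset.univ f) {w : Fin 3 → Bool} {i j k : Fin 3} (hij : i ≠ j)
    (hik : i ≠ k) (hjk : j ≠ k) (h1 : f w i ≠ f (flipAt j w) i) (h2 : f w i ≠ f (flipAt k w) i)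
    (h3 : f (flipAt j w) i ≠ f (flipAt k w) i) : False := by
  have hs : ∀ v l, f (flipAt l v) l = f v l := fun v l => hf.symm v l (Finset.mem_univ l)
  have hi : ∀ v {l m}, l ≠ m → f v l ≠ f v m := fun v l m h h' =>
    h (hf.inj v l (Finset.mem_univ l) m (Finset.mem_univ m) h')
  have a1 : f w j = f (flipAt k w) i := fin_three_eq_of_ne h1 h2 h3 (hi w hij.symm)
    (by rw [← hs]; exact hi _ hij.symm)
  have a2 : f w k = f (flipAt j w) i := fin_three_eq_of_ne h2 h1 h3.symm (hi w hik.symm)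
    (by rw [← hs]; exact hi _ hik.symm)
  have a3 : f (flipAt j w) k = f w i := fin_three_eq_of_ne h3 h1.symm h2.symm (hi _ hik.symm)
    (by rw [← a1, ← hs w j]; exact hi _ hjk.symm)
  have a4 : f (flipAt k w) j = f w i := fin_three_eq_of_ne h3.symm h2.symm h1.symm (hi _ hij.symm)
    (by rw [← a2, ← hs w k]; exact hi _ hjk)
  refine hi (flipAt j (flipAt k w)) hjk ?_
  rw [hs, a4, flipAt_comm, hs, a3]

/-- Among three vertices of a square one is adjacent to the other two, and it serves as the corner
in `IsCol.false_of_corner`. -/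
theorem not_extends_of_parallel {P : Finset (Entry (Fin 3) (Fin 3))} {i : Fin 3} {t₁ t₂ t₃ : Entry (Fin 3) (Fin 3)}
    (m1 : t₁ ∈ P) (m2 : t₂ ∈ P) (m3 : t₃ ∈ P) (d1 : t₁.2.1 = i) (d2 : t₂.2.1 = i)
    (d3 : t₃.2.1 = i) (h12 : t₁.2.2 ≠ t₂.2.2) (h13 : t₁.2.2 ≠ t₃.2.2) (h23 : t₂.2.2 ≠ t₃.2.2) :
    ¬ Extends Finset.univ Finset.univ P := by
  rintro ⟨f, hf, hfP⟩
  obtain ⟨j, k, hij, hik, hjk, hall⟩ : ∃ j k, i ≠ j ∧ i ≠ k ∧ j ≠ k ∧ ∀ l, l = i ∨ l = j ∨ l = k := by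
    clear d1 d2 d3
    decide +revert
  have hset : ∀ v b, f (setAt i b v) i = f v i := fun v b => by
    by_cases h : v i = b
    · rw [setAt_of_eq h]
    · rw [setAt_of_ne h, hf.symm _ _ (Finset.mem_univ i)]
  obtain ⟨v₁, hv₁⟩ : ∃ v, setAt i false t₁.1 = v := ⟨_, rfl⟩
  obtain ⟨v₂, hv₂⟩ : ∃ v, setAt i false t₂.1 = v := ⟨_, rfl⟩
  obtain ⟨v₃, hv₃⟩ : ∃ v, setAt i false t₃.1 = v := ⟨_, rfl⟩
  have e1 : f v₁ i = t₁.2.2 := by rw [← hv₁, hset, ← hfP t₁ m1, d1]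
  have e2 : f v₂ i = t₂.2.2 := by rw [← hv₂, hset, ← hfP t₂ m2, d2]
  have e3 : f v₃ i = t₃.2.2 := by rw [← hv₃, hset, ← hfP t₃ m3, d3]
  have z1 : v₁ i = false := by rw [← hv₁, setAt_apply_self]
  have z2 : v₂ i = false := by rw [← hv₂, setAt_apply_self]
  have z3 : v₃ i = false := by rw [← hv₃, setAt_apply_self]
  rw [← e1, ← e2] at h12
  rw [← e1, ← e3] at h13
  rw [← e2, ← e3] at h23
  have hsq : ∀ v w : Fin 3 → Bool, v i = w i → f v i ≠ f w i →
      w = flipAt j v ∨ w = flipAt k v ∨ w = flipAt j (flipAt k v) := by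
    intro v w hvw hne
    have key : ∀ w', w' i = w i → w' j = w j → w' k = w k → w = w' := fun w' h1 h2 h3 => by
      funext l
      rcases hall l with rfl | rfl | rfl
      exacts [h1.symm, h2.symm, h3.symm]
    by_cases hj : v j = w j <;> by_cases hk : v k = w k
    · exact (hne (by rw [key v hvw hj hk])).elim
    · refine Or.inr (Or.inl (key _ ?_ ?_ ?_))
      · rwa [flipAt_apply_of_ne hik]
      · rwa [flipAt_apply_of_ne hjk]
      · rw [flipAt_apply_self]; exact (Bool.eq_not.2 (Ne.symm hk)).symm
    · refine Or.inl (key _ ?_ ?_ ?_)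
      · rwa [flipAt_apply_of_ne hij]
      · rw [flipAt_apply_self]; exact (Bool.eq_not.2 (Ne.symm hj)).symm
      · rwa [flipAt_apply_of_ne hjk.symm]
    · refine Or.inr (Or.inr (key _ ?_ ?_ ?_))
      · rwa [flipAt_apply_of_ne hij, flipAt_apply_of_ne hik]
      · rw [flipAt_apply_self, flipAt_apply_of_ne hjk]
        exact (Bool.eq_not.2 (Ne.symm hj)).symm
      · rw [flipAt_apply_of_ne hjk.symm, flipAt_apply_self]
        exact (Bool.eq_not.2 (Ne.symm hk)).symm
  rcases hsq v₁ v₂ (z1.trans z2.symm) h12 with rfl | rfl | rfl <;>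
    rcases hsq v₁ v₃ (z1.trans z3.symm) h13 with rfl | rfl | rfl
  · exact h23 rfl
  · exact hf.false_of_corner hij hik hjk h12 h13 h23
  · exact hf.false_of_corner (w := flipAt j v₁) hij hik hjk (by rw [flipAt_flipAt]; exact h12.symm)
      (by rw [flipAt_comm]; exact h23) (by rw [flipAt_flipAt, flipAt_comm]; exact h13)
  · exact hf.false_of_corner hij hik hjk h13 h12 h23.symm
  · exact h23 rfl
  · exact hf.false_of_corner (w := flipAt k v₁) hij hik hjk h23
      (by rw [flipAt_flipAt]; exact h12.symm) (by rw [flipAt_flipAt]; exact h13.symm)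
  · exact hf.false_of_corner (w := flipAt j v₁) hij hik hjk (by rw [flipAt_flipAt]; exact h13.symm)
      (by rw [flipAt_comm]; exact h23.symm) (by rw [flipAt_flipAt, flipAt_comm]; exact h12)
  · exact hf.false_of_corner (w := flipAt k v₁) hij hik hjk h23.symm
      (by rw [flipAt_flipAt]; exact h13.symm) (by rw [flipAt_flipAt]; exact h12.symm)
  · exact h23 rfl

end Necessity

/-! ### Precolourings of the hypercube as sets of entries -/

section Translation

variable {d : ℕ}

theorem hypercube_adj_iff {u v : Fin d → Bool} : (hypercube d).Adj u v ↔ ∃ j, v = flipAt j u := by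
  constructor
  · rintro ⟨j, hj, h⟩
    refine ⟨j, funext fun i => ?_⟩
    rw [flipAt_apply]
    split_ifs with hi
    · subst hi; exact Bool.eq_not.2 hj.symm
    · by_contra hne
      exact hi (h i (Ne.symm hne))
  · rintro ⟨j, rfl⟩
    refine ⟨j, by simp, fun i hi => ?_⟩
    by_contra hne
    exact hi (flipAt_apply_of_ne hne u).symm

theorem hypercube_adj_flipAt (j : Fin d) (v : Fin d → Bool) : (hypercube d).Adj v (flipAt j v) :=
  hypercube_adj_iff.2 ⟨j, rfl⟩

/-- The edge at `v` in direction `j`. -/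
def cubeEdge (v : Fin d → Bool) (j : Fin d) : (hypercube d).edgeSet :=
  ⟨s(v, flipAt j v), hypercube_adj_flipAt j v⟩

theorem mem_cubeEdge {v w : Fin d → Bool} {j : Fin d} :
    w ∈ (cubeEdge v j : Sym2 (Fin d → Bool)) ↔ w = v ∨ w = flipAt j v := Sym2.mem_iff

theorem exists_cubeEdge_of_mem {e : (hypercube d).edgeSet} {v : Fin d → Bool}
    (h : v ∈ (e : Sym2 (Fin d → Bool))) : ∃ j, cubeEdge v j = e := by
  obtain ⟨e, he⟩ := e
  obtain ⟨w, rfl⟩ := Sym2.mem_iff_exists.1 h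
  obtain ⟨j, hj⟩ := hypercube_adj_iff.1 he
  obtain rfl : w = flipAt j v := hj
  exact ⟨j, rfl⟩

theorem exists_cubeEdge (e : (hypercube d).edgeSet) : ∃ v j, cubeEdge v j = e := by
  obtain ⟨v, hv⟩ : ∃ v, v ∈ (e : Sym2 (Fin d → Bool)) := ⟨_, Sym2.out_fst_mem _⟩
  exact ⟨v, exists_cubeEdge_of_mem hv⟩

theorem cubeEdge_flipAt (v : Fin d → Bool) (j : Fin d) : cubeEdge (flipAt j v) j = cubeEdge v j := by
  refine Subtype.ext ?_
  simp only [cubeEdge, flipAt_flipAt]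
  exact Sym2.eq_swap

theorem cubeEdge_eq_iff {v w : Fin d → Bool} {j k : Fin d} :
    cubeEdge v j = cubeEdge w k ↔ j = k ∧ (v = w ∨ v = flipAt k w) := by
  constructor
  · intro h
    have h' : s(v, flipAt j v) = s(w, flipAt k w) := congrArg Subtype.val h
    rcases Sym2.eq_iff.1 h' with ⟨rfl, h2⟩ | ⟨rfl, h2⟩
    · exact ⟨flipAt_eq_flipAt.1 h2, Or.inl rfl⟩
    · exact ⟨flipAt_eq_flipAt.1 (h2.trans (flipAt_flipAt k w).symm), Or.inr rfl⟩
  · rintro ⟨rfl, rfl | rfl⟩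
    · rfl
    · exact cubeEdge_flipAt w j

theorem lineGraph_adj_cubeEdge (v : Fin d → Bool) {j k : Fin d} (h : j ≠ k) :
    (hypercube d).lineGraph.Adj (cubeEdge v j) (cubeEdge v k) :=
  ⟨fun e => h (cubeEdge_eq_iff.1 e).1, v, mem_cubeEdge.2 (Or.inl rfl), mem_cubeEdge.2 (Or.inl rfl)⟩

namespace EdgePrecoloring

variable (φ : EdgePrecoloring (hypercube d) d)

/-- The entries of the precoloured edges. -/
def entries : Finset (Entry (Fin d) (Fin d)) :=
  -- Each edge is recorded once, from its end where the coordinate in its own direction is `false`.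
  Finset.univ.filter fun t => t.1 t.2.1 = false ∧ φ.color (cubeEdge t.1 t.2.1) = some t.2.2

variable {φ}

theorem mem_entries {t : Entry (Fin d) (Fin d)} :
    t ∈ φ.entries ↔ t.1 t.2.1 = false ∧ φ.color (cubeEdge t.1 t.2.1) = some t.2.2 := by
  simp [entries]

theorem has_entries {v : Fin d → Bool} {j c : Fin d} :
    Has φ.entries v j c ↔ φ.color (cubeEdge v j) = some c := by
  constructor
  · rintro ⟨t, ht, rfl, rfl, rfl | rfl⟩
    · exact (mem_entries.1 ht).2
    · rw [cubeEdge_flipAt]; exact (mem_entries.1 ht).2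
  · intro h
    by_cases hv : v j = false
    · exact has_of_mem (t := (v, j, c)) (mem_entries.2 ⟨hv, h⟩)
    · refine has_flip.1 (has_of_mem (t := (flipAt j v, j, c)) (mem_entries.2 ⟨?_, ?_⟩))
      · simpa using hv
      · rw [cubeEdge_flipAt]; exact h

theorem mem_colorsAt {v : Fin d → Bool} {c : Fin d} :
    c ∈ φ.colorsAt v ↔ ∃ k, Has φ.entries v k c := by
  simp only [has_entries]
  constructor
  · rintro ⟨e, he, h⟩
    obtain ⟨j, rfl⟩ := exists_cubeEdge_of_mem he
    exact ⟨j, h⟩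
  · rintro ⟨j, h⟩
    exact ⟨_, mem_cubeEdge.2 (Or.inl rfl), h⟩

theorem color_eq_none_iff {v : Fin d → Bool} {j : Fin d} :
    φ.color (cubeEdge v j) = none ↔ ∀ c, ¬ Has φ.entries v j c := by
  simp only [has_entries, Option.eq_none_iff_forall_ne_some]

theorem good_entries : Good Finset.univ Finset.univ φ.entries := by
  refine ⟨fun _ _ => Finset.mem_univ _, fun _ _ => Finset.mem_univ _, fun {v j k c c'} h h' => ?_⟩
  rw [has_entries] at h h'
  constructor
  · rintro rfl
    exact Option.some_injective _ (h.symm.trans h')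
  · rintro rfl
    by_contra hjk
    exact φ.proper _ _ (lineGraph_adj_cubeEdge v hjk) _ h h'

theorem cubeEdge_injOn_entries :
    Set.InjOn (fun t : Entry (Fin d) (Fin d) => cubeEdge t.1 t.2.1) φ.entries := by
  rintro ⟨v, j, c⟩ ht ⟨w, k, c'⟩ hu h
  obtain ⟨h1, h1'⟩ := mem_entries.1 ht
  obtain ⟨h2, h2'⟩ := mem_entries.1 hu
  simp only at h h1 h1' h2 h2'
  rw [h, h2'] at h1'
  obtain rfl : c' = c := Option.some_injective _ h1'
  obtain ⟨rfl, rfl | rfl⟩ := cubeEdge_eq_iff.1 h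
  · rfl
  · simp [h2] at h1

theorem image_entries :
    (fun t : Entry (Fin d) (Fin d) => cubeEdge t.1 t.2.1) '' φ.entries = φ.coloredEdges := by
  ext e
  constructor
  · rintro ⟨t, ht, rfl⟩
    exact fun h => by simp [(mem_entries.1 ht).2] at h
  · intro he
    obtain ⟨c, hc⟩ := Option.ne_none_iff_exists'.1 he
    obtain ⟨v, j, rfl⟩ := exists_cubeEdge e
    obtain ⟨t, ht, rfl, -, rfl | rfl⟩ := has_entries.2 hc
    · exact ⟨t, ht, rfl⟩
    · exact ⟨t, ht, (cubeEdge_flipAt _ _).symm⟩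

theorem card_entries : φ.entries.card = φ.coloredEdges.ncard := by
  rw [← image_entries, cubeEdge_injOn_entries.ncard_image, Set.ncard_coe_finset]

theorem extendable_iff : φ.Extendable ↔ Extends Finset.univ Finset.univ φ.entries := by
  constructor
  · rintro ⟨f, hf⟩
    refine ⟨fun v j => f (cubeEdge v j), ⟨fun _ _ _ => Finset.mem_univ _, fun v j _ => ?_,
      fun v j _ k _ h => ?_⟩, fun t ht => hf _ _ (mem_entries.1 ht).2⟩
    · simp only [cubeEdge_flipAt]
    · by_contra hjk
      exact f.valid (lineGraph_adj_cubeEdge v hjk) h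
  · rintro ⟨f, hf, hfP⟩
    choose v j hvj using fun e : (hypercube d).edgeSet => exists_cubeEdge e
    have key : ∀ w k, f (v (cubeEdge w k)) (j (cubeEdge w k)) = f w k := by
      intro w k
      obtain ⟨h1, h2 | h2⟩ := cubeEdge_eq_iff.1 (hvj (cubeEdge w k))
      · rw [h1, h2]
      · rw [h1, h2, hf.symm _ _ (Finset.mem_univ _)]
    refine ⟨SimpleGraph.Coloring.mk (fun e => f (v e) (j e)) fun {e e'} h => ?_, fun e c h => ?_⟩
    · obtain ⟨hne, w, hw, hw'⟩ := h
      obtain ⟨k, rfl⟩ := exists_cubeEdge_of_mem hw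
      obtain ⟨k', rfl⟩ := exists_cubeEdge_of_mem hw'
      rw [key, key]
      exact fun h => hne (by rw [hf.inj w k (Finset.mem_univ _) k' (Finset.mem_univ _) h])
    · obtain ⟨w, k, rfl⟩ := exists_cubeEdge e
      exact (key w k).trans (hf.eq_of_has good_entries hfP (has_entries.2 h))

theorem hasSaturatedEdge_iff :
    φ.HasSaturatedEdge ↔ Sat Finset.univ Finset.univ φ.entries := by
  have hcov : ∀ v j, φ.colorsAt v ∪ φ.colorsAt (flipAt j v) = Set.univ ↔
      ∀ c ∈ Finset.univ, ∃ k, Has φ.entries v k c ∨ Has φ.entries (flipAt j v) k c := by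
    intro v j
    simp only [Set.eq_univ_iff_forall, Set.mem_union, mem_colorsAt, exists_or, Finset.mem_univ,
      forall_true_left]
  constructor
  · rintro ⟨u, v, h, h0, h1⟩
    obtain ⟨j, rfl⟩ := hypercube_adj_iff.1 h
    exact ⟨u, j, Finset.mem_univ j, color_eq_none_iff.1 h0, (hcov u j).1 h1⟩
  · rintro ⟨u, j, -, h0, h1⟩
    exact ⟨u, _, hypercube_adj_flipAt j u, color_eq_none_iff.2 h0, (hcov u j).2 h1⟩

theorem hasBlockedVertex_iff : φ.HasBlockedVertex ↔ Blk Finset.univ Finset.univ φ.entries := by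
  constructor
  · rintro ⟨u, c, h0, h1⟩
    rw [mem_colorsAt, not_exists] at h0
    refine ⟨u, c, Finset.mem_univ c, h0, fun j _ => ?_⟩
    by_cases h : φ.color (cubeEdge u j) = none
    · exact Or.inr (mem_colorsAt.1 (h1 _ (hypercube_adj_flipAt j u) h))
    · obtain ⟨x, hx⟩ := Option.ne_none_iff_exists'.1 h
      exact Or.inl ⟨x, has_entries.2 hx⟩
  · rintro ⟨u, c, -, h0, h1⟩
    refine ⟨u, c, fun h => (mem_colorsAt.1 h).elim h0, fun v h hn => ?_⟩
    obtain ⟨j, rfl⟩ := hypercube_adj_iff.1 h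
    rcases h1 j (Finset.mem_univ j) with ⟨x, hx⟩ | h2
    · exact (color_eq_none_iff.1 hn x hx).elim
    · exact mem_colorsAt.2 h2

/-- No edge at `u` is colored, so the adjacent edge of color `c` meets the edge `uv` at `v`. Hence
condition 3 adds nothing to condition 2. -/
theorem HasBlockedUncoloredVertex.hasBlockedVertex (h : φ.HasBlockedUncoloredVertex) :
    φ.HasBlockedVertex := by
  obtain ⟨u, c, h⟩ := h
  have hu : c ∉ φ.colorsAt u := fun hc => by
    obtain ⟨k, hk⟩ := mem_colorsAt.1 hc
    exact color_eq_none_iff.1 (h _ (hypercube_adj_flipAt k u)).1 _ hk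
  refine ⟨u, c, hu, fun v hv _ => ?_⟩
  obtain ⟨e, ⟨-, w, hw, hw'⟩, he⟩ := (h v hv).2
  rcases Sym2.mem_iff.1 hw with rfl | rfl
  · exact (hu ⟨e, hw', he⟩).elim
  · exact ⟨e, hw', he⟩

theorem cubeEdge_mem_dimensionalMatching {v : Fin d → Bool} {j i : Fin d} :
    cubeEdge v j ∈ dimensionalMatching d i ↔ j = i := by
  constructor
  · rintro ⟨u, w, h, hne⟩
    have h' : s(v, flipAt j v) = s(u, w) := h
    by_contra hji
    rcases Sym2.eq_iff.1 h' with ⟨rfl, rfl⟩ | ⟨rfl, rfl⟩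
    · exact hne (flipAt_apply_of_ne (Ne.symm hji) _).symm
    · exact hne (flipAt_apply_of_ne (Ne.symm hji) _)
  · rintro rfl
    exact ⟨v, flipAt j v, rfl, by simp⟩

theorem not_extends_of_isParallelTriple (h : IsParallelTriple φ) :
    ¬ Extends Finset.univ Finset.univ φ.entries := by
  obtain ⟨rfl, hcard, hinj, i, hi⟩ := h
  rw [← card_entries] at hcard
  have hmem : ∀ t ∈ φ.entries, cubeEdge t.1 t.2.1 ∈ φ.coloredEdges := fun t ht =>
    image_entries ▸ Set.mem_image_of_mem _ ht
  have hdir : ∀ t ∈ φ.entries, t.2.1 = i := fun t ht =>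
    cubeEdge_mem_dimensionalMatching.1 (hi (hmem t ht))
  have hcol : ∀ t ∈ φ.entries, ∀ u ∈ φ.entries, t ≠ u → t.2.2 ≠ u.2.2 := fun t ht u hu hne h =>
    hne (cubeEdge_injOn_entries ht hu (hinj (hmem t ht) (hmem u hu)
      (by rw [(mem_entries.1 ht).2, (mem_entries.1 hu).2, h])))
  obtain ⟨t₁, m1, t₂, m2, t₃, m3, h12, h13, h23⟩ := Finset.two_lt_card.1
    (show 2 < φ.entries.card by omega)
  exact not_extends_of_parallel m1 m2 m3 (hdir _ m1) (hdir _ m2) (hdir _ m3) (hcol _ m1 _ m2 h12)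
    (hcol _ m1 _ m3 h13) (hcol _ m2 _ m3 h23)

theorem isParallelTriple_of_parallel (h : Parallel d φ.entries) (hφ : φ.coloredEdges.ncard = d) :
    IsParallelTriple φ := by
  obtain ⟨rfl, hdir, hinj⟩ := h
  obtain ⟨t, ht⟩ := Finset.card_pos.1 (show 0 < φ.entries.card by rw [card_entries]; omega)
  refine ⟨rfl, hφ, ?_, t.2.1, ?_⟩
  · rw [← image_entries]
    rintro _ ⟨u, hu, rfl⟩ _ ⟨w, hw, rfl⟩ h
    rw [(mem_entries.1 hu).2, (mem_entries.1 hw).2] at h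
    rw [hinj u hu w hw (Option.some_injective _ h)]
  · rw [← image_entries]
    rintro _ ⟨u, hu, rfl⟩
    exact cubeEdge_mem_dimensionalMatching.2 (hdir u hu t ht)

end EdgePrecoloring

end Translation

theorem mainTheorem1 (d : ℕ) (hd : 1 ≤ d) (φ : EdgePrecoloring (hypercube d) d)
    (hφ : φ.coloredEdges.ncard = d) :
    φ.Extendable ↔ φ ∉ obstructionClass d := by
  have hP := φ.good_entries
  have hcard : φ.entries.card ≤ d := (φ.card_entries.trans hφ).le
  rw [EdgePrecoloring.extendable_iff]
  constructor
  · rintro h (h' | h' | h' | h')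
    · exact (EdgePrecoloring.hasSaturatedEdge_iff.1 h').not_extends hP h
    · exact (EdgePrecoloring.hasBlockedVertex_iff.1 h').not_extends hP le_rfl h
    · exact (EdgePrecoloring.hasBlockedVertex_iff.1 h'.hasBlockedVertex).not_extends hP le_rfl h
    · exact EdgePrecoloring.not_extends_of_isParallelTriple h' h
  · intro h
    have hsat : ¬ Sat Finset.univ Finset.univ φ.entries := fun h' =>
      h (Or.inl (EdgePrecoloring.hasSaturatedEdge_iff.2 h'))
    have hblk : ¬ Blk Finset.univ Finset.univ φ.entries := fun h' =>
      h (Or.inr (Or.inl (EdgePrecoloring.hasBlockedVertex_iff.2 h')))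
    -- Only below dimension `4` does the parallel triple have to be taken into account.
    rcases Nat.lt_or_ge d 4 with hd4 | hd4
    · rcases extends_or_obstructed_of_le_four hd hd4.le (Finset.card_fin d) (Finset.card_fin d) hP hcard
        with h' | h' | h' | h'
      · exact h'
      · exact (hsat h').elim
      · exact (hblk h').elim
      · exact (h (Or.inr (Or.inr (Or.inr
          (EdgePrecoloring.isParallelTriple_of_parallel h' hφ))))).elim
    · exact extendsAt hd4 _ _ _ (Finset.card_fin d) (Finset.card_fin d) hP hcard hsat hblk
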